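/- \textbf{Push Fight.} A board is a polyomino (a nonempty, orthogonally connected finite set of unit squares of the square grid); each boundary edge of the board may carry a side rail. Every square is empty or holds one piece. A piece is a pawn or a king and is white or black; in addition at most one king carries the anchor. Such a board with rails, pieces and anchor is a \emph{game state}. If the anchor is on a white king, it is Black's turn; if it is on a black king, or if there is no anchor, it is White's turn. A \emph{move} takes one piece of the player whose turn it is along a simple path of orthogonally adjacent empty squares of the board. In a \emph{push}, an unanchored king of that player moves one square in one of the four directions into an occupied adjacent square; the $m\ge 1$ consecutive pieces in front of it, up to the first position in that direction that is an empty square or lies off the board, are each pushed one square in the same direction. The push is not allowed if it would push the anchored king or push a piece through a side rail. The player \emph{wins with the push} if it pushes a piece of the opponent off the board. \textsc{Unbounded-Move Push Fight Mate-in-1} is the following decision problem: given a game state, can the player whose turn it is win this turn by making any finite number of moves (possibly none) followed by one push? Here a game state is written as a word over a fixed finite alphabet, by listing row by row, from the top and from left to right, the positions of a drawing of the board, with one symbol per position (not a square of the board, or a square with its piece and the rails on its edges) and an end-of-row mark after each row. \textbf{Theorem.} \textsc{Unbounded-Move Push Fight Mate-in-1} is in P: there is a deterministic Turing machine that, on every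 word over this alphabet, decides in time polynomial in the length of the word whether the word encodes a game state in which the player whose turn it is can win this turn. -/

import Mathlib

/-! Generalized Push Fight, the Unbounded-Move Mate-in-1 problem, and the complexity class P. -/

namespace PushFight

/-- A language over `Γ` is in P: some multi-stack Turing machine (Mathlib's `FinTM2`), started with
an arbitrary word `w` over `Γ` on its input stack, halts after at most `p (length w)` steps for a
fixed polynomial `p`, with the single bit `true` on its output stack if `w ∈ L` and the single bit
`false` otherwise. (`FinTM2` forces the input alphabet `Γ` to be finite.) -/
def InP {Γ : Type} (L : Language Γ) : Prop :=
  open Classical in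
  Nonempty (Turing.TM2ComputableInPolyTime (id : List Γ → List Γ) Computability.encodeBool
    (fun w => decide (w ∈ L)))

/-- The two players. -/
inductive Color
  | white
  | black
  deriving DecidableEq

instance : Fintype Color := ⟨{.white, .black}, by intro c; cases c <;> simp⟩

/-- The opponent. -/
def Color.other : Color → Color
  | white => black
  | black => white

/-- The four orthogonal directions. -/
inductive Dir
  | north
  | south
  | west
  | east
  deriving DecidableEq

instance : Fintype Dir := ⟨{.north, .south, .west, .east}, by intro d; cases d <;> simp⟩

/-- Positions of the square grid, as (row, column); rows are counted downwards. -/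
abbrev Pos : Type := ℤ × ℤ

/-- The next position in a given direction. -/
def Dir.step : Dir → Pos → Pos
  | north, p => (p.1 - 1, p.2)
  | south, p => (p.1 + 1, p.2)
  | west, p => (p.1, p.2 - 1)
  | east, p => (p.1, p.2 + 1)

/-- Orthogonal adjacency. -/
def Adj (p q : Pos) : Prop := ∃ d : Dir, q = d.step p

/-- The pieces. The anchor only ever lies on a king. -/
inductive Piece
  | pawn (c : Color)
  | king (c : Color)
  | anchoredKing (c : Color)
  deriving DecidableEq, Fintype

/-- The owner of a piece. -/
def Piece.color : Piece → Color
  | pawn c => c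
  | king c => c
  | anchoredKing c => c

/-- The description of one square of the board: the piece on it, if any, and for each of its four
edges whether there is a side rail along that edge. -/
structure Square where
  piece : Option Piece
  rail : Dir → Bool
  deriving DecidableEq, Fintype

/-- A drawing of a board, row by row from the top and each row from the left; the entry `none` is a
position that is not a square of the board, and so is everything outside the drawing. -/
abbrev Diagram : Type := List (List (Option Square))

namespace Diagram

/-- The square at a position, if there is one. -/
def squareAt (D : Diagram) (p : Pos) : Option Square :=
  if 0 ≤ p.1 ∧ 0 ≤ p.2 then
    (D[p.1.toNat]?.bind fun row => row[p.2.toNat]?).join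
  else none

/-- The set of squares of the board. -/
def board (D : Diagram) : Set Pos := {p | (D.squareAt p).isSome}

/-- There is a side rail along the edge of the square `p` in direction `d`. -/
def HasRail (D : Diagram) (p : Pos) (d : Dir) : Prop :=
  ∃ sq, D.squareAt p = some sq ∧ sq.rail d = true

/-- The piece drawn at a position, if any. -/
def pieceAt (D : Diagram) (p : Pos) : Option Piece := (D.squareAt p).bind Square.piece

end Diagram

/-- A (necessarily finite) board is a polyomino: nonempty and orthogonally connected. -/
def IsPolyomino (B : Set Pos) : Prop :=
  B.Nonempty ∧
    ∀ p ∈ B, ∀ q ∈ B, Relation.ReflTransGen (fun a b => a ∈ B ∧ b ∈ B ∧ Adj a b) p q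

/-- A Push Fight game state: a polyomino board, side rails along some of the boundary edges,
and pieces on some of the squares, of which at most one carries the anchor. -/
structure GameState where
  diagram : Diagram
  polyomino : IsPolyomino diagram.board
  rail_boundary : ∀ p d, diagram.HasRail p d → d.step p ∉ diagram.board
  anchor_unique : ∀ p q c c', diagram.pieceAt p = some (Piece.anchoredKing c) →
    diagram.pieceAt q = some (Piece.anchoredKing c') → p = q

/-- Placements of pieces on the grid. -/
abbrev Placement : Type := Pos → Option Piece

/-- One move of player `c` on the board `B`, from the placement `P` to the placement `Q`: a piece of
`c` moves from its square `s` along a simple path `l` of orthogonally adjacent empty squares, to the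
last square of that path. -/
def IsMove (B : Set Pos) (c : Color) (P Q : Placement) : Prop :=
  ∃ (s : Pos) (x : Piece) (l : List Pos) (hl : l ≠ []),
    P s = some x ∧ x.color = c ∧
    (s :: l).IsChain Adj ∧ (s :: l).Nodup ∧ (∀ q ∈ l, q ∈ B ∧ P q = none) ∧
    Q = Function.update (Function.update P s none) (l.getLast hl) (some x)

/-- The position `i` steps away from `s` in direction `d`. -/
def ray (s : Pos) (d : Dir) (i : ℕ) : Pos := d.step^[i] s

namespace GameState

/-- The player whose turn it is: the opponent of the owner of the anchored king, and White if the
anchor has not been placed. -/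
noncomputable def turn (S : GameState) : Color :=
  open Classical in
  if ∃ p, S.diagram.pieceAt p = some (Piece.anchoredKing Color.white) then Color.black
  else Color.white

/-- In the placement `P`, player `c` may push with the king on the square `s` in direction `d`, and
this push moves exactly the `m ≥ 1` pieces on the next `m` squares by one square each: none of them
is the anchored king, and the last one enters an empty square or leaves the board through an edge
without a side rail. -/
def IsLegalPush (S : GameState) (c : Color) (P : Placement) (s : Pos) (d : Dir) (m : ℕ) : Prop :=
  P s = some (Piece.king c) ∧ 1 ≤ m ∧
  (∀ i, 1 ≤ i → i ≤ m → ∃ x, P (ray s d i) = some x ∧ ∀ c', x ≠ Piece.anchoredKing c') ∧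
  ((ray s d (m + 1) ∈ S.diagram.board ∧ P (ray s d (m + 1)) = none) ∨
    (ray s d (m + 1) ∉ S.diagram.board ∧ ¬ S.diagram.HasRail (ray s d m) d))

/-- In the placement `P`, player `c` can win with one push: there is a legal push that pushes a
piece of the opponent off the board. -/
def WinsWithPush (S : GameState) (c : Color) (P : Placement) : Prop :=
  ∃ s d m, S.IsLegalPush c P s d m ∧ ray s d (m + 1) ∉ S.diagram.board ∧
    ∃ x, P (ray s d m) = some x ∧ x.color = c.other

/-- The player whose turn it is can win this turn by making any number of moves (possibly none)
followed by one push. -/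
def UnboundedMateInOne (S : GameState) : Prop :=
  ∃ P : Placement, Relation.ReflTransGen (IsMove S.diagram.board S.turn) S.diagram.pieceAt P ∧
    S.WinsWithPush S.turn P

end GameState

/-- The input alphabet: one symbol for each possible entry of a drawing, and an end-of-row mark. -/
inductive Symbol
  | entry (e : Option Square)
  | endRow
  deriving DecidableEq, Fintype

/-- A drawing is written down row by row. -/
def Diagram.encode (D : Diagram) : List Symbol :=
  D.flatMap fun row => row.map Symbol.entry ++ [Symbol.endRow]

/-- The decision problem Unbounded-Move Push Fight Mate-in-1, as the language of the words that
encode a game state in which the player whose turn it is can win this turn. -/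
def unboundedMoveMateInOne : Language Symbol :=
  {w | ∃ S : GameState, S.diagram.encode = w ∧ S.UnboundedMateInOne}

end PushFight

/-! During a turn only pieces of the player to move change place, and none of them is anchored
(`turn_ne_of_anchored`). Let `G` be the set of board squares without an enemy piece. Once the king
that will push is fixed, the other own pieces are interchangeable: a winning push needs certain
squares of `G` filled by any own pieces, in line with enemy pieces that have not moved. A turn is
therefore a token game on the grid graph induced on `G`, with one distinguished token and a set of
anonymous ones (`unboundedMateInOne_iff`).

While the distinguished token rests on `v`, the anonymous ones rearrange freely inside each
component of `G \ {v}`: sets with equally many elements in every component can be slid into each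
other (`Tokens.slide_of_card_eq`), and a target set can be covered if no component has too few
tokens (`Tokens.exists_slide_superset`). Only the counts per component matter. When the
distinguished token passes from `v` to an adjacent `u`, the others lie in `G \ {v, u}`, and their
counts in the components of that graph determine the counts in the components of `G \ {v}` before
the step and of `G \ {u}` after it. A component of `G \ {v, u}` that touches neither `v` nor `u` is
a component of `G`, so its count is still the initial one. Each other component contains one of the
at most eight neighbours of `v` and `u`. Hence each pair `(v, u)` has only polynomially many
relevant count vectors, and `candidates` holds a representative of each (`exists_candidate`).

The triples `(v, u, Y)` with `Y` a candidate form a graph of polynomial size, with an edge to `(u,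
u', Y')` when `Y` and `Y'` have equal counts in the components of `G \ {u}`. Every reachable
position is equivalent, up to sliding, to the start or to a reachable triple (`Tokens.exists_plan`),
and reachable triples are reachable positions (`Tokens.Plan.reachable`). For each of them, comparing
counts decides whether some rearrangement allows a winning push (`winb_iff`). This gives a correct
decision procedure (`mateb_iff`).

For the time bound, structured programs on stacks of bits are simulated by multi-stack Turing
machines step for step (`StackProg.Exec.reaches`). The functions computed by such programs in
polynomial time (`PolyTime`) are closed under composition, pairing, case distinction and folds whose
intermediate results have polynomial size (`PolyTime.foldl`). List operations, unary arithmetic and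
graph search follow from these, and `fun_prop` assembles them into a bound for the whole procedure.
`inP_of_polyTime` returns from bit strings to words. -/

open Function StateTransition

/-! ### Structured programs on stacks of bits -/

/-- Structured programs acting on countably many stacks of bits. -/
inductive StackProg
  | skip
  | push (r : ℕ) (b : Bool)
  | seq (p q : StackProg)
  /-- Pop from `r` and continue according to the result (empty, `false`, `true`). -/
  | cases (r : ℕ) (p₀ p₁ p₂ : StackProg)
  /-- While `r` is nonempty, pop from `r` and run `p₁` or `p₂` according to the bit. -/
  | loop (r : ℕ) (p₁ p₂ : StackProg)

namespace StackProg

/-- The contents of the stacks. -/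
abbrev State := ℕ → List Bool

/-- `Exec p s s' t`: the program `p` takes the state `s` to `s'` in `t` steps. -/
inductive Exec : StackProg → State → State → ℕ → Prop
  | skip (s : State) : Exec skip s s 1
  | push (r : ℕ) (b : Bool) (s : State) : Exec (push r b) s (update s r (b :: s r)) 1
  | seq {p q : StackProg} {s s' s'' : State} {t t' : ℕ} :
      Exec p s s' t → Exec q s' s'' t' → Exec (seq p q) s s'' (t + t')
  | cases_nil {r : ℕ} {p₀ p₁ p₂ : StackProg} {s s' : State} {t : ℕ} :
      s r = [] → Exec p₀ s s' t → Exec (cases r p₀ p₁ p₂) s s' (1 + t)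
  | cases_cons {r : ℕ} {p₀ p₁ p₂ : StackProg} {b : Bool} {l : List Bool} {s s' : State} {t : ℕ} :
      s r = b :: l → Exec (bif b then p₂ else p₁) (update s r l) s' t →
      Exec (cases r p₀ p₁ p₂) s s' (1 + t)
  | loop_nil {r : ℕ} {p₁ p₂ : StackProg} {s : State} : s r = [] → Exec (loop r p₁ p₂) s s 1
  | loop_cons {r : ℕ} {p₁ p₂ : StackProg} {b : Bool} {l : List Bool} {s s' s'' : State}
      {t t' : ℕ} : s r = b :: l → Exec (bif b then p₂ else p₁) (update s r l) s' t →
      Exec (loop r p₁ p₂) s' s'' t' → Exec (loop r p₁ p₂) s s'' (1 + t + t')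

/-- No stack grows by more than the number of steps. -/
theorem Exec.length_le {p : StackProg} {s s' : State} {t : ℕ} (h : Exec p s s' t) (i : ℕ) :
    (s' i).length ≤ (s i).length + t := by
  have key : ∀ (s : State) (r : ℕ) (b : Bool) (l : List Bool), s r = b :: l →
      (update s r l i).length ≤ (s i).length := by
    intro s r b l h
    by_cases hi : i = r
    · subst hi; simp [h]
    · simp [hi]
  induction h with
  | skip s => omega
  | push r b s =>
    by_cases hi : i = r
    · subst hi; simp
    · simp [hi]
  | seq _ _ ih₁ ih₂ => omega
  | cases_nil _ _ ih => omega
  | cases_cons hr _ ih => have := key _ _ _ _ hr; omega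
  | loop_nil => omega
  | loop_cons hr _ _ ih₁ ih₂ => have := key _ _ _ _ hr; omega

/-- A bound for the stacks that the program uses. -/
def bound : StackProg → ℕ
  | skip => 0
  | push r _ => r
  | seq p q => max p.bound q.bound
  | cases r p₀ p₁ p₂ => max r (max p₀.bound (max p₁.bound p₂.bound))
  | loop r p₁ p₂ => max r (max p₁.bound p₂.bound)

/-! ### Translation to Turing machines -/

/-- The points of a program, which become the labels of a machine. -/
def Label : StackProg → Type
  | skip => Unit
  | push _ _ => Unit
  | seq p q => p.Label ⊕ q.Label
  | cases _ p₀ p₁ p₂ => Option (p₀.Label ⊕ (p₁.Label ⊕ p₂.Label))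
  | loop _ p₁ p₂ => Option (p₁.Label ⊕ p₂.Label)

noncomputable instance fintypeLabel : (p : StackProg) → Fintype p.Label
  | skip => inferInstanceAs (Fintype Unit)
  | push _ _ => inferInstanceAs (Fintype Unit)
  | seq p q =>
    have := fintypeLabel p
    have := fintypeLabel q
    inferInstanceAs (Fintype (p.Label ⊕ q.Label))
  | cases _ p₀ p₁ p₂ =>
    have := fintypeLabel p₀
    have := fintypeLabel p₁
    have := fintypeLabel p₂
    inferInstanceAs (Fintype (Option (p₀.Label ⊕ (p₁.Label ⊕ p₂.Label))))
  | loop _ p₁ p₂ =>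
    have := fintypeLabel p₁
    have := fintypeLabel p₂
    inferInstanceAs (Fintype (Option (p₁.Label ⊕ p₂.Label)))

/-- The point where a program starts. -/
def entry : (p : StackProg) → p.Label
  | skip => ()
  | push _ _ => ()
  | seq p _ => Sum.inl p.entry
  | cases _ _ _ _ => (none : Option _)
  | loop _ _ _ => (none : Option _)

section Machine

variable (A : Type) (n : ℕ)

/-- The stack alphabets of the machine: one input stack over `A`, and `n + 1` stacks of bits. -/
abbrev Alphabet : Option (Fin (n + 1)) → Type
  | none => A
  | some _ => Bool

/-- The internal memory of the machine: the last symbols popped. -/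
abbrev Memory : Type := Option A × Option Bool

variable {A n}

/-- The machine code for the points of a program `p` embedded into a machine by `e`, where `x` is
the label at which to continue after `p`. -/
def code {Λ : Type} : (p : StackProg) → (p.Label → Λ) → Λ → p.Label →
    Turing.TM2.Stmt (Alphabet A n) Λ (Memory A)
  | skip, _, x, _ => .goto fun _ => x
  | push r b, _, x, _ => .push (some (Fin.ofNat (n + 1) r)) (fun _ => b) (.goto fun _ => x)
  | seq p q, e, x, l => Sum.casesOn (motive := fun _ => _) (l : p.Label ⊕ q.Label)
      (fun l => code p (fun l => e (Sum.inl l)) (e (Sum.inr q.entry)) l)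
      (fun l => code q (fun l => e (Sum.inr l)) x l)
  | cases r p₀ p₁ p₂, e, x, l =>
    match (l : Option (p₀.Label ⊕ (p₁.Label ⊕ p₂.Label))) with
    | none => .pop (some (Fin.ofNat (n + 1) r)) (fun v b => (v.1, b)) (.goto fun v =>
        match v.2 with
        | none => e (some (Sum.inl p₀.entry))
        | some false => e (some (Sum.inr (Sum.inl p₁.entry)))
        | some true => e (some (Sum.inr (Sum.inr p₂.entry))))
    | some (Sum.inl l) => code p₀ (fun l => e (some (Sum.inl l))) x l
    | some (Sum.inr (Sum.inl l)) => code p₁ (fun l => e (some (Sum.inr (Sum.inl l)))) x l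
    | some (Sum.inr (Sum.inr l)) => code p₂ (fun l => e (some (Sum.inr (Sum.inr l)))) x l
  | loop r p₁ p₂, e, x, l =>
    match (l : Option (p₁.Label ⊕ p₂.Label)) with
    | none => .pop (some (Fin.ofNat (n + 1) r)) (fun v b => (v.1, b)) (.goto fun v =>
        match v.2 with
        | none => x
        | some false => e (some (Sum.inl p₁.entry))
        | some true => e (some (Sum.inr p₂.entry)))
    | some (Sum.inl l) => code p₁ (fun l => e (some (Sum.inl l))) (e none) l
    | some (Sum.inr l) => code p₂ (fun l => e (some (Sum.inr l))) (e none) l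

/-- The stacks of the machine. -/
def stackFun (w : List A) (s : State) : ∀ k : Option (Fin (n + 1)), List (Alphabet A n k)
  | none => w
  | some i => s i

theorem stackFun_some (w : List A) (s : State) {r : ℕ} (hr : r ≤ n) :
    stackFun w s (some (Fin.ofNat (n + 1) r)) = s r := by
  simp [stackFun, Nat.mod_eq_of_lt (Nat.lt_succ_of_le hr)]

theorem update_stackFun (w : List A) (s : State) {r : ℕ} (hr : r ≤ n) (l : List Bool) :
    update (stackFun w s) (some (Fin.ofNat (n + 1) r)) l = stackFun (n := n) w (update s r l) := by
  funext k
  match k with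
  | none => simp [stackFun]
  | some i =>
    by_cases h : i = Fin.ofNat (n + 1) r
    · subst h
      rw [update_self, stackFun_some _ _ hr, update_self]
    · have h' : (i : ℕ) ≠ r := by
        rintro rfl; exact h (by ext; simp)
      rw [update_of_ne (by simpa using h)]
      simp [stackFun, h']

/-- The machine `M` goes from `a` to `b` in at most `t` steps. -/
def Reaches {Λ : Type} (M : Λ → Turing.TM2.Stmt (Alphabet A n) Λ (Memory A))
    (a b : Turing.TM2.Cfg (Alphabet A n) Λ (Memory A)) (t : ℕ) : Prop :=
  Nonempty (EvalsToInTime (Turing.TM2.step M) a (some b) t)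

variable {Λ : Type} {M : Λ → Turing.TM2.Stmt (Alphabet A n) Λ (Memory A)}

theorem Reaches.trans {a b c : Turing.TM2.Cfg (Alphabet A n) Λ (Memory A)} {t t' : ℕ}
    (h : Reaches M a b t) (h' : Reaches M b c t') : Reaches M a c (t + t') := by
  obtain ⟨h⟩ := h
  obtain ⟨h'⟩ := h'
  exact ⟨Nat.add_comm t t' ▸ EvalsToInTime.trans _ _ _ _ _ _ h h'⟩

theorem Reaches.mono {a b : Turing.TM2.Cfg (Alphabet A n) Λ (Memory A)} {t t' : ℕ}
    (h : Reaches M a b t) (ht : t ≤ t') : Reaches M a b t' := by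
  obtain ⟨h⟩ := h
  exact ⟨⟨h.toEvalsTo, h.steps_le_m.trans ht⟩⟩

theorem Reaches.single {l : Λ} {v : Memory A}
    {S : ∀ k : Option (Fin (n + 1)), List (Alphabet A n k)}
    {b : Turing.TM2.Cfg (Alphabet A n) Λ (Memory A)}
    (h : Turing.TM2.stepAux (M l) v S = b) : Reaches M ⟨some l, v, S⟩ b 1 :=
  ⟨⟨⟨1, by subst h; rfl⟩, le_rfl⟩⟩

/-- A machine that contains the code of a program simulates its executions. -/
theorem Exec.reaches {p : StackProg} {s s' : State} {t : ℕ} (h : Exec p s s' t) :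
    ∀ (e : p.Label → Λ) (x : Λ) (_ : ∀ l, M (e l) = code p e x l) (_ : p.bound ≤ n) (w : List A)
      (v : Memory A),
      ∃ v', Reaches M ⟨some (e p.entry), v, stackFun w s⟩ ⟨some x, v', stackFun w s'⟩ t := by
  induction h with
  | skip s =>
    intro e x hM hn w v
    exact ⟨v, .single (by rw [hM]; rfl)⟩
  | push r b s =>
    intro e x hM hn w v
    have hr : r ≤ n := hn
    refine ⟨v, .single ?_⟩
    rw [hM]
    simp only [code, Turing.TM2.stepAux]
    rw [stackFun_some _ _ hr, update_stackFun _ _ hr]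
  | @seq p q s s' s'' t t' h₁ h₂ ih₁ ih₂ =>
    intro e x hM hn w v
    simp only [bound, max_le_iff] at hn
    obtain ⟨v', h'⟩ := ih₁ (fun l => e (Sum.inl l)) (e (Sum.inr q.entry))
      (fun l => hM (Sum.inl l)) hn.1 w v
    obtain ⟨v'', h''⟩ := ih₂ (fun l => e (Sum.inr l)) x (fun l => hM (Sum.inr l)) hn.2 w v'
    exact ⟨v'', h'.trans h''⟩
  | @cases_nil r p₀ p₁ p₂ s s' t hr h ih =>
    intro e x hM hn w v
    simp only [bound, max_le_iff] at hn
    obtain ⟨v', h'⟩ := ih (fun l => e (some (Sum.inl l))) x (fun l => hM (some (Sum.inl l)))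
      hn.2.1 w (v.1, none)
    refine ⟨v', Reaches.trans (.single ?_) h'⟩
    have : M (e (cases r p₀ p₁ p₂).entry) = _ := hM none
    rw [this]
    simp only [code, Turing.TM2.stepAux]
    rw [stackFun_some _ _ hn.1, hr, update_stackFun _ _ hn.1]
    have hs : update s r [] = s := by rw [← hr]; exact update_eq_self _ _
    simp [hs]
  | @cases_cons r p₀ p₁ p₂ b l s s' t hr h ih =>
    intro e x hM hn w v
    simp only [bound, max_le_iff] at hn
    have : M (e (cases r p₀ p₁ p₂).entry) = _ := hM none
    cases b
    · obtain ⟨v', h'⟩ := ih (fun l => e (some (Sum.inr (Sum.inl l)))) x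
        (fun l => hM (some (Sum.inr (Sum.inl l)))) hn.2.2.1 w (v.1, some false)
      refine ⟨v', Reaches.trans (.single ?_) h'⟩
      rw [this]
      simp only [code, Turing.TM2.stepAux]
      rw [stackFun_some _ _ hn.1, hr, update_stackFun _ _ hn.1]
      simp
    · obtain ⟨v', h'⟩ := ih (fun l => e (some (Sum.inr (Sum.inr l)))) x
        (fun l => hM (some (Sum.inr (Sum.inr l)))) hn.2.2.2 w (v.1, some true)
      refine ⟨v', Reaches.trans (.single ?_) h'⟩
      rw [this]
      simp only [code, Turing.TM2.stepAux]
      rw [stackFun_some _ _ hn.1, hr, update_stackFun _ _ hn.1]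
      simp
  | @loop_nil r p₁ p₂ s hr =>
    intro e x hM hn w v
    simp only [bound, max_le_iff] at hn
    refine ⟨(v.1, none), .single ?_⟩
    have : M (e (loop r p₁ p₂).entry) = _ := hM none
    rw [this]
    simp only [code, Turing.TM2.stepAux]
    rw [stackFun_some _ _ hn.1, hr, update_stackFun _ _ hn.1]
    have hs : update s r [] = s := by rw [← hr]; exact update_eq_self _ _
    simp [hs]
  | @loop_cons r p₁ p₂ b l s s' s'' t t' hr h₁ h₂ ih₁ ih₂ =>
    intro e x hM hn w v
    have hn' := hn
    simp only [bound, max_le_iff] at hn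
    have : M (e (loop r p₁ p₂).entry) = _ := hM none
    cases b
    · obtain ⟨v', h'⟩ := ih₁ (fun l => e (some (Sum.inl l))) (e none)
        (fun l => hM (some (Sum.inl l))) hn.2.1 w (v.1, some false)
      obtain ⟨v'', h''⟩ := ih₂ e x hM hn' w v'
      refine ⟨v'', (Reaches.trans (.single ?_) h').trans h''⟩
      rw [this]
      simp only [code, Turing.TM2.stepAux]
      rw [stackFun_some _ _ hn.1, hr, update_stackFun _ _ hn.1]
      simp
    · obtain ⟨v', h'⟩ := ih₁ (fun l => e (some (Sum.inr l))) (e none)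
        (fun l => hM (some (Sum.inr l))) hn.2.2 w (v.1, some true)
      obtain ⟨v'', h''⟩ := ih₂ e x hM hn' w v'
      refine ⟨v'', (Reaches.trans (.single ?_) h').trans h''⟩
      rw [this]
      simp only [code, Turing.TM2.stepAux]
      rw [stackFun_some _ _ hn.1, hr, update_stackFun _ _ hn.1]
      simp

/-- Machine code that pushes a list of bits onto the stack `0`, the last bit first. -/
def pushAll {Λ : Type} : List Bool → Turing.TM2.Stmt (Alphabet A n) Λ (Memory A) →
    Turing.TM2.Stmt (Alphabet A n) Λ (Memory A)
  | [], q => q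
  | b :: l, q => pushAll l (.push (some (Fin.ofNat (n + 1) 0)) (fun _ => b) q)

theorem stepAux_pushAll (l : List Bool) (q : Turing.TM2.Stmt (Alphabet A n) Λ (Memory A))
    (v : Memory A) (w : List A) (s : State) :
    Turing.TM2.stepAux (pushAll l q) v (stackFun w s) =
      Turing.TM2.stepAux q v (stackFun w (update s 0 (l ++ s 0))) := by
  induction l generalizing q with
  | nil => simp [pushAll]
  | cons b l ih =>
    rw [pushAll, ih]
    simp only [Turing.TM2.stepAux]
    rw [stackFun_some _ _ (Nat.zero_le n), update_stackFun _ _ (Nat.zero_le n)]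
    simp

/-- The machine that translates its input to bits, symbol by symbol, and then runs a program. -/
def machine (p : StackProg) (f : A → List Bool) : Option A ⊕ (p.Label ⊕ Unit) →
    Turing.TM2.Stmt (Alphabet A p.bound) (Option A ⊕ (p.Label ⊕ Unit)) (Memory A)
  | Sum.inl none => .pop none (fun v a => (a, v.2)) (.goto fun v =>
      match v.1 with
      | none => Sum.inr (Sum.inl p.entry)
      | some a => Sum.inl (some a))
  | Sum.inl (some a) => pushAll (f a) (.goto fun _ => Sum.inl none)
  | Sum.inr (Sum.inl l) => code p (fun l => Sum.inr (Sum.inl l)) (Sum.inr (Sum.inr ())) l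
  | Sum.inr (Sum.inr ()) => .load (fun _ => (none, none)) .halt

/-- Reading from the front and pushing leaves the last symbol on top, hence `w.reverse`. The bits of
one symbol are pushed last bit first, so each code itself stays in reading order. -/
theorem machine_read (p : StackProg) (f : A → List Bool) (w : List A) (s : State) (v : Memory A) :
    ∃ v', Reaches (machine p f) ⟨some (Sum.inl none), v, stackFun w s⟩
      ⟨some (Sum.inr (Sum.inl p.entry)), v', stackFun [] (update s 0 (w.reverse.flatMap f ++ s 0))⟩
      (2 * w.length + 1) := by
  induction w generalizing s v with
  | nil =>
    refine ⟨(none, v.2), .single ?_⟩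
    have : update (stackFun (n := p.bound) ([] : List A) s) none ([] : List A) = stackFun [] s :=
      update_eq_self _ _
    simp only [machine, Turing.TM2.stepAux]
    simp [stackFun, this]
  | cons a w ih =>
    obtain ⟨v', h⟩ := ih (update s 0 (f a ++ s 0)) (some a, v.2)
    refine ⟨v', ?_⟩
    have h₁ : Reaches (machine p f) ⟨some (Sum.inl none), v, stackFun (a :: w) s⟩
        ⟨some (Sum.inl (some a)), (some a, v.2), stackFun w s⟩ 1 := by
      refine .single ?_
      have : update (stackFun (n := p.bound) (a :: w) s) none w = stackFun w s := by
        funext k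
        cases k <;> simp [stackFun]
      simp only [machine, Turing.TM2.stepAux]
      simpa [stackFun] using this
    -- A `TM2` statement runs up to its next `goto` in a single step, so pushing a whole code costs
    -- one step.
    have h₂ : Reaches (machine p f) ⟨some (Sum.inl (some a)), (some a, v.2), stackFun w s⟩
        ⟨some (Sum.inl none), (some a, v.2), stackFun w (update s 0 (f a ++ s 0))⟩ 1 := by
      refine .single ?_
      rw [machine, stepAux_pushAll]
      rfl
    have h₃ := (h₁.trans h₂).trans h
    simp only [update_idem, update_self] at h₃
    simp only [List.reverse_cons, List.flatMap_append, List.flatMap_singleton, List.append_assoc]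
    exact h₃.mono (by simp only [List.length_cons]; omega)

/-- The Turing machine that translates its input to bits, symbol by symbol, and then runs a
program. -/
noncomputable def turingMachine [Fintype A] (p : StackProg) (f : A → List Bool) : Turing.FinTM2 where
  K := Option (Fin (p.bound + 1))
  k₀ := none
  k₁ := some 0
  Γ := Alphabet A p.bound
  Λ := Option A ⊕ (p.Label ⊕ Unit)
  main := Sum.inl none
  σ := Memory A
  initialState := (none, none)
  Γk₀Fin := inferInstanceAs (Fintype A)
  m := machine p f

theorem initList_turingMachine [Fintype A] (p : StackProg) (f : A → List Bool) (w : List A) :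
    Turing.initList (turingMachine p f) w =
      ⟨some (Sum.inl none), (none, none), stackFun w fun _ => []⟩ := by
  unfold Turing.initList
  congr 1
  funext k
  match k with
  | none => rfl
  | some i => rfl

theorem haltList_turingMachine [Fintype A] (p : StackProg) (f : A → List Bool) (l : List Bool) :
    Turing.haltList (turingMachine p f) l =
      ⟨none, (none, none), stackFun [] (update (fun _ => []) 0 l)⟩ := by
  unfold Turing.haltList
  congr 1
  funext k
  match k with
  | none => rfl
  | some i =>
    by_cases hi : i = 0
    · subst hi
      rfl
    · have h₁ : (i : ℕ) ≠ 0 := fun h => hi (Fin.ext h)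
      have h₂ : some i ≠ (turingMachine p f).k₁ := fun h => hi (Option.some.inj h)
      exact (dif_neg h₂).trans (update_of_ne h₁ l fun _ => []).symm

/-- A program that computes a Boolean from the translated input in polynomial time yields a
Turing machine that does so. -/
theorem tm2ComputableInPolyTime [Fintype A] (p : StackProg) (f : A → List Bool)
    (g : List A → Bool) (T : Polynomial ℕ)
    (h : ∀ w, ∃ t ≤ T.eval w.length, Exec p (update (fun _ => []) 0 (w.reverse.flatMap f))
      (update (fun _ => []) 0 [g w]) t) :
    Nonempty (Turing.TM2ComputableInPolyTime (id : List A → List A) Computability.encodeBool g) := by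
  refine ⟨{
    tm := turingMachine p f
    inputAlphabet := Equiv.refl A
    outputAlphabet := Equiv.refl Bool
    time := 2 * Polynomial.X + 2 + T
    outputsFun := fun w => Classical.choice ?_ }⟩
  obtain ⟨t, ht, h⟩ := h w
  obtain ⟨v₁, h₁⟩ := machine_read p f w (fun _ => []) (none, none)
  obtain ⟨v₂, h₂⟩ := h.reaches (M := machine p f) (fun l => Sum.inr (Sum.inl l))
    (Sum.inr (Sum.inr ())) (fun _ => rfl) le_rfl [] v₁
  -- The final label resets the memory to `(none, none)`, because `haltList` prescribes the initial
  -- internal state along with the stacks.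
  have h₃ : Reaches (machine p f) ⟨some (Sum.inr (Sum.inr ())), v₂,
      stackFun [] (update (fun _ => []) 0 [g w])⟩
      ⟨none, (none, none), stackFun [] (update (fun _ => []) 0 [g w])⟩ 1 := .single rfl
  simp only [List.append_nil] at h₁
  have h₄ := ((h₁.trans h₂).trans h₃).mono
    (show _ ≤ (2 * Polynomial.X + 2 + T).eval w.length by simp; omega)
  have hw : List.map (Equiv.refl A).invFun (id w) = w := List.map_id w
  have hi := (congrArg (Turing.initList (turingMachine p f)) hw).trans
    (initList_turingMachine p f w)
  have ho := haltList_turingMachine p f [g w]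
  have key : ∀ {a a' b b' : (turingMachine p f).Cfg} {m : ℕ}, a = a' → b = b' →
      Nonempty (EvalsToInTime (turingMachine p f).step a' (some b') m) →
      Nonempty (EvalsToInTime (turingMachine p f).step a (some b) m) := by
    rintro _ _ _ _ _ rfl rfl h
    exact h
  exact key hi ho h₄

end Machine

end StackProg


/-! ### Executions with an upper bound on the time -/

open Function StateTransition

namespace StackProg

/-- The program `p` takes the state `s` to `s'` in at most `t` steps. -/
def Runs (p : StackProg) (s s' : State) (t : ℕ) : Prop := ∃ t' ≤ t, Exec p s s' t'

namespace Runs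

variable {p q p₀ p₁ p₂ : StackProg} {s s' s'' : State} {t t' r : ℕ}

theorem congr (h : Runs p s s' t) (hs : s' = s'') (ht : t ≤ t') : Runs p s s'' t' := by
  obtain ⟨t₀, h₀, h⟩ := h
  exact ⟨t₀, h₀.trans ht, hs ▸ h⟩

theorem mono (h : Runs p s s' t) (ht : t ≤ t') : Runs p s s' t' := h.congr rfl ht

theorem skip (s : State) : Runs .skip s s 1 := ⟨1, le_rfl, .skip s⟩

theorem push (r : ℕ) (b : Bool) (s : State) : Runs (.push r b) s (update s r (b :: s r)) 1 :=
  ⟨1, le_rfl, .push r b s⟩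

theorem seq (h : Runs p s s' t) (h' : Runs q s' s'' t') : Runs (.seq p q) s s'' (t + t') := by
  obtain ⟨t₀, h₀, h⟩ := h
  obtain ⟨t₁, h₁, h'⟩ := h'
  exact ⟨_, Nat.add_le_add h₀ h₁, .seq h h'⟩

theorem cases_nil (hr : s r = []) (h : Runs p₀ s s' t) :
    Runs (.cases r p₀ p₁ p₂) s s' (1 + t) := by
  obtain ⟨t₀, h₀, h⟩ := h
  exact ⟨_, Nat.add_le_add_left h₀ 1, .cases_nil hr h⟩

theorem cases_cons {b : Bool} {l : List Bool} (hr : s r = b :: l)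
    (h : Runs (bif b then p₂ else p₁) (update s r l) s' t) :
    Runs (.cases r p₀ p₁ p₂) s s' (1 + t) := by
  obtain ⟨t₀, h₀, h⟩ := h
  exact ⟨_, Nat.add_le_add_left h₀ 1, .cases_cons hr h⟩

theorem loop_nil (hr : s r = []) : Runs (.loop r p₁ p₂) s s 1 := ⟨1, le_rfl, .loop_nil hr⟩

theorem loop_cons {b : Bool} {l : List Bool} (hr : s r = b :: l)
    (h : Runs (bif b then p₂ else p₁) (update s r l) s' t)
    (h' : Runs (.loop r p₁ p₂) s' s'' t') : Runs (.loop r p₁ p₂) s s'' (1 + t + t') := by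
  obtain ⟨t₀, h₀, h⟩ := h
  obtain ⟨t₁, h₁, h'⟩ := h'
  exact ⟨_, by omega, .loop_cons hr h h'⟩

end Runs

theorem Runs.length_le {p : StackProg} {s s' : State} {t : ℕ} (h : Runs p s s' t) (i : ℕ) :
    (s' i).length ≤ (s i).length + t := by
  obtain ⟨t₀, h₀, h⟩ := h
  exact (h.length_le i).trans (by omega)

/-! ### Basic programs -/

theorem update_nil {s : State} {r : ℕ} (h : s r = []) : update s r [] = s := by
  rw [← h]; exact update_eq_self _ _

/-- Move the contents of `a` onto `b`, reversed. -/
def rev (a b : ℕ) : StackProg := loop a (push b false) (push b true)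

theorem runs_rev {a b : ℕ} (hab : a ≠ b) (s : State) :
    Runs (rev a b) s (update (update s a []) b ((s a).reverse ++ s b)) (2 * (s a).length + 1) := by
  generalize hl : s a = l
  induction l generalizing s with
  | nil =>
    exact (Runs.loop_nil hl).congr (by simp [update_nil hl]) (by simp)
  | cons c l ih =>
    have h₁ : Runs (bif c then push b true else push b false) (update s a l)
        (update (update s a l) b (c :: s b)) 1 := by
      have := Runs.push b c (update s a l)
      rw [update_of_ne hab.symm] at this
      cases c <;> exact this
    refine (Runs.loop_cons hl h₁ (ih _ (by simp [hab]))).congr ?_ (by simp; omega)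
    funext i
    simp only [update_apply, List.reverse_cons, List.append_assoc]
    split_ifs <;> simp_all

/-- Empty the stack `a`. -/
def clear (a : ℕ) : StackProg := loop a skip skip

theorem runs_clear (a : ℕ) (s : State) :
    Runs (clear a) s (update s a []) (2 * (s a).length + 1) := by
  generalize hl : s a = l
  induction l generalizing s with
  | nil => exact (Runs.loop_nil hl).congr (by simp [update_nil hl]) (by simp)
  | cons c l ih =>
    have h₁ : Runs (bif c then skip else skip) (update s a l) (update s a l) 1 := by
      cases c <;> exact Runs.skip _
    exact (Runs.loop_cons hl h₁ (ih _ (by simp))).congr (by simp) (by simp; omega)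

/-- Move the contents of `a` onto `b`, using the auxiliary stack `t`. -/
def move (a b t : ℕ) : StackProg := seq (rev a t) (rev t b)

theorem runs_move {a b t : ℕ} (hab : a ≠ b) (hat : a ≠ t) (hbt : b ≠ t) {s : State}
    (hb : s b = []) (ht : s t = []) :
    Runs (move a b t) s (update (update s a []) b (s a)) (4 * (s a).length + 2) := by
  refine ((runs_rev hat s).seq (runs_rev hbt.symm _)).congr ?_ ?_
  · funext i
    simp only [update_apply]
    split_ifs <;> simp_all
  · simp [ht]; omega

/-- Copy the contents of `a` onto `b`, using the auxiliary stack `t`. -/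
def copy (a b t : ℕ) : StackProg :=
  seq (rev a t) (loop t (seq (push a false) (push b false)) (seq (push a true) (push b true)))

theorem runs_copy {a b t : ℕ} (hab : a ≠ b) (hat : a ≠ t) (hbt : b ≠ t) {s : State}
    (hb : s b = []) (ht : s t = []) :
    Runs (copy a b t) s (update s b (s a)) (5 * (s a).length + 2) := by
  have key : ∀ (l : List Bool) (s : State), s t = l →
      Runs (loop t (seq (push a false) (push b false)) (seq (push a true) (push b true))) s
        (update (update (update s t []) a (l.reverse ++ s a)) b (l.reverse ++ s b))
        (3 * l.length + 1) := by
    intro l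
    induction l with
    | nil =>
      intro s hs
      exact (Runs.loop_nil hs).congr (by simp [update_nil hs]) (by simp)
    | cons c l ih =>
      intro s hs
      have h₁ : Runs (bif c then seq (push a true) (push b true) else
          seq (push a false) (push b false)) (update s t l)
          (update (update (update s t l) a (c :: s a)) b (c :: s b)) 2 := by
        have := (Runs.push a c (update s t l)).seq (Runs.push b c _)
        rw [update_of_ne hat, update_of_ne hab.symm, update_of_ne hbt] at this
        cases c <;> exact this
      refine (Runs.loop_cons hs h₁ (ih _ ?_)).congr ?_ (by simp; omega)
      · simp [hat.symm, hbt.symm]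
      · funext i
        simp only [update_apply]
        split_ifs <;> simp_all
  refine ((runs_rev hat s).seq (key (s a).reverse _ ?_)).congr ?_ ?_
  · simp [ht]
  · funext i
    simp only [update_apply]
    split_ifs <;> simp_all
  · simp; omega

/-- The self-delimiting form of a word: each bit is preceded by `true`. -/
def dbl (l : List Bool) : List Bool := l.flatMap fun b => [true, b]

@[simp] theorem dbl_nil : dbl [] = [] := rfl

@[simp] theorem dbl_cons (b : Bool) (l : List Bool) : dbl (b :: l) = true :: b :: dbl l := rfl

@[simp] theorem dbl_append (l l' : List Bool) : dbl (l ++ l') = dbl l ++ dbl l' := by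
  simp [dbl]

@[simp] theorem length_dbl (l : List Bool) : (dbl l).length = 2 * l.length := by
  induction l with
  | nil => rfl
  | cons b l ih => simp [ih]; omega

/-- The marker before each bit is `true`, so the first `false` in marker position ends the word:
these strings form a prefix code. The injectivity of the encodings of pairs and lists rests on this.
-/
theorem dbl_append_inj {x x' y y' : List Bool} (h : dbl x ++ false :: y = dbl x' ++ false :: y') :
    x = x' ∧ y = y' := by
  induction x generalizing x' with
  | nil => cases x' <;> simp_all
  | cons b x ih =>
    cases x' with
    | nil => simp at h
    | cons b' x' =>
      simp only [dbl_cons, List.cons_append, List.cons.injEq, true_and] at h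
      obtain ⟨rfl, h⟩ := h
      obtain ⟨rfl, rfl⟩ := ih h
      exact ⟨rfl, rfl⟩

/-- Put the contents of `a` in self-delimiting form onto `b`, using the auxiliary stack `t`. -/
def pairUp (a b t : ℕ) : StackProg :=
  seq (push b false) (seq (rev a t)
    (loop t (seq (push b false) (push b true)) (seq (push b true) (push b true))))

theorem runs_pairUp {a b t : ℕ} (hab : a ≠ b) (hat : a ≠ t) (hbt : b ≠ t) {s : State}
    (ht : s t = []) :
    Runs (pairUp a b t) s (update (update s a []) b (dbl (s a) ++ false :: s b))
      (5 * (s a).length + 3) := by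
  have key : ∀ (l : List Bool) (s : State), s t = l →
      Runs (loop t (seq (push b false) (push b true)) (seq (push b true) (push b true))) s
        (update (update s t []) b (dbl l.reverse ++ s b)) (3 * l.length + 1) := by
    intro l
    induction l with
    | nil =>
      intro s hs
      exact (Runs.loop_nil hs).congr (by simp [update_nil hs]) (by simp)
    | cons c l ih =>
      intro s hs
      have h₁ : Runs (bif c then seq (push b true) (push b true) else
          seq (push b false) (push b true)) (update s t l)
          (update (update s t l) b (true :: c :: s b)) 2 := by
        have := (Runs.push b c (update s t l)).seq (Runs.push b true _)
        rw [update_of_ne hbt, update_self, update_idem] at this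
        cases c <;> exact this
      refine (Runs.loop_cons hs h₁ (ih _ ?_)).congr ?_ (by simp; omega)
      · simp [hbt.symm]
      · funext i
        simp only [update_apply]
        split_ifs <;> simp_all
  refine ((Runs.push b false s).seq ((runs_rev hat _).seq (key (s a).reverse _ ?_))).congr ?_ ?_
  · simp [ht, hab, hbt.symm]
  · funext i
    simp only [update_apply]
    split_ifs <;> simp_all
  · simp [hab]; omega

/-- Remove the leading word in self-delimiting form from `a` and put it onto `b`, using the
auxiliary stacks `t` and `f`. -/
def unpair (a b t f : ℕ) : StackProg :=
  let body := cases a skip skip (cases a skip (seq (push t false) (push f true))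
    (seq (push t true) (push f true)))
  seq (push f true) (seq (loop f body body) (rev t b))

/-- Stack `f` is a flag that keeps the loop alive. Each round consumes the flag and a marker; the
marker `true` transfers a bit to `t` and raises the flag again, while the terminator `false` leaves
it down, which stops the loop with the rest of `a` intact. -/
theorem runs_unpair {a b t f : ℕ} (hab : a ≠ b) (hat : a ≠ t) (haf : a ≠ f) (hbt : b ≠ t)
    (hbf : b ≠ f) (htf : t ≠ f) {s : State} {x y : List Bool} (ha : s a = dbl x ++ false :: y)
    (hb : s b = []) (ht : s t = []) (hf : s f = []) :
    Runs (unpair a b t f) s (update (update s a y) b x) (7 * x.length + 6) := by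
  have key : ∀ (x : List Bool) (s : State), s a = dbl x ++ false :: y → s f = [true] →
      Runs (loop f
        (cases a skip skip (cases a skip (seq (push t false) (push f true))
          (seq (push t true) (push f true))))
        (cases a skip skip (cases a skip (seq (push t false) (push f true))
          (seq (push t true) (push f true))))) s
        (update (update (update s f []) a y) t (x.reverse ++ s t)) (5 * x.length + 4) := by
    intro x
    induction x with
    | nil =>
      intro s ha hf
      refine (Runs.loop_cons hf (Runs.cases_cons (b := false) (l := y) ?_ (Runs.skip _))
        (Runs.loop_nil ?_)).congr ?_ (by simp)
      · simpa [haf] using ha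
      · simp [haf.symm]
      · funext i
        simp only [update_apply]
        split_ifs <;> simp_all
    | cons c x ih =>
      intro s ha hf
      have h₁ : Runs (cases a skip skip (cases a skip (seq (push t false) (push f true))
          (seq (push t true) (push f true)))) (update s f [])
          (update (update s a (dbl x ++ false :: y)) t (c :: s t)) 4 := by
        refine (Runs.cases_cons (b := true) (l := c :: (dbl x ++ false :: y)) ?_
          (Runs.cases_cons (b := c) (l := dbl x ++ false :: y) (t := 2)
            (s' := update (update s a (dbl x ++ false :: y)) t (c :: s t)) ?_ ?_)).mono ?_
        · simpa [haf] using ha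
        · simp
        · have := (Runs.push t c (update (update (update s f []) a (c :: (dbl x ++ false :: y))) a
            (dbl x ++ false :: y))).seq (Runs.push f true _)
          have := this.congr (s'' := update (update s a (dbl x ++ false :: y)) t (c :: s t)) (by
            funext i
            simp only [update_apply]
            split_ifs <;> simp_all) le_rfl
          cases c <;> exact this
        · norm_num
      refine (Runs.loop_cons hf h₁ (ih _ ?_ ?_)).congr ?_ (by simp; omega)
      · simp [hat]
      · simp [hf, htf.symm, haf.symm]
      · funext i
        simp only [update_apply]
        split_ifs <;> simp_all
  refine ((Runs.push f true s).seq ((key x _ ?_ ?_).seq (runs_rev hbt.symm _))).congr ?_ ?_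
  · simp [haf, ha]
  · simp [hf]
  · funext i
    simp only [update_apply]
    split_ifs <;> simp_all
  · simp [htf, ht]; omega

/-- Push a list of bits onto the stack `0`, the last bit first. -/
def pushList : List Bool → StackProg
  | [] => skip
  | b :: l => seq (pushList l) (push 0 b)

theorem runs_pushList (l : List Bool) (s : State) :
    Runs (pushList l) s (update s 0 (l ++ s 0)) (l.length + 1) := by
  induction l with
  | nil => exact (Runs.skip s).congr (by simp) (by simp)
  | cons b l ih =>
    exact (ih.seq (Runs.push 0 b _)).congr (by simp) (by simp)

/-- Compare the contents of the stacks `0` and `1`, emptying both; stack `2` stays empty if they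
are equal. -/
def compare : StackProg :=
  seq (loop 1 (cases 0 (push 2 true) skip (push 2 true)) (cases 0 (push 2 true) (push 2 true) skip))
    (seq (loop 0 (push 2 true) (push 2 true))
      (cases 2 (push 0 true) (seq (clear 2) (push 0 false)) (seq (clear 2) (push 0 false))))

theorem runs_compare {s : State} (h₂ : s 2 = []) :
    Runs compare s (update (update s 1 []) 0 [decide (s 1 = s 0)])
      (7 * ((s 0).length + (s 1).length) + 10) := by
  -- Here `k` counts the mismatches recorded on stack `2`, a premature end of stack `0` included,
  -- and `l` is what remains of stack `0`. The words agree exactly when both are trivial.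
  have key₁ : ∀ (x : List Bool) (s : State), s 1 = x → ∃ k l,
      Runs (loop 1 (cases 0 (push 2 true) skip (push 2 true))
        (cases 0 (push 2 true) (push 2 true) skip)) s
        (update (update (update s 1 []) 0 l) 2 (List.replicate k true ++ s 2)) (3 * x.length + 1) ∧
      (k = 0 ∧ l = [] ↔ x = s 0) ∧ k ≤ x.length ∧ l.length ≤ (s 0).length := by
    intro x
    induction x with
    | nil =>
      intro s hs
      refine ⟨0, s 0, (Runs.loop_nil hs).congr ?_ (by simp), ⟨fun h => h.2.symm, fun h => ⟨rfl, h.symm⟩⟩,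
        by simp, by simp⟩
      funext i
      simp only [update_apply]
      split_ifs <;> simp_all
    | cons c x ih =>
      intro s hs
      have h₁ : ∃ (k : ℕ) (l : List Bool), Runs (bif c then cases 0 (push 2 true) (push 2 true) skip
          else cases 0 (push 2 true) skip (push 2 true)) (update s 1 x)
          (update (update (update s 1 x) 0 l) 2 (List.replicate k true ++ s 2)) 2 ∧
          (k = 0 ∧ x = l ↔ c :: x = s 0) ∧ k ≤ 1 ∧ l.length ≤ (s 0).length := by
        cases h₀ : s 0 with
        | nil =>
          refine ⟨1, [], ?_, by simp, le_rfl, le_rfl⟩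
          have h := Runs.push 2 true (update s 1 x)
          have := h.congr (s'' := update (update (update s 1 x) 0 []) 2
            (List.replicate 1 true ++ s 2)) (by
              funext i
              simp only [update_apply]
              split_ifs <;> simp_all) le_rfl
          cases c <;> exact Runs.cases_nil (by simpa using h₀) this
        | cons d y =>
          by_cases hcd : c = d
          · subst hcd
            refine ⟨0, y, ?_, by simp, by simp, by simp⟩
            have h := (Runs.skip (update (update s 1 x) 0 y)).congr (t' := 1)
              (s'' := update (update (update s 1 x) 0 y) 2 (List.replicate 0 true ++ s 2)) (by
              funext i
              simp only [update_apply]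
              split_ifs <;> simp_all) le_rfl
            cases c
            · exact Runs.cases_cons (b := false) (l := y) (by simpa using h₀) h
            · exact Runs.cases_cons (b := true) (l := y) (by simpa using h₀) h
          · refine ⟨1, y, ?_, by simp [hcd], le_rfl, by simp⟩
            have h := (Runs.push 2 true (update (update s 1 x) 0 y)).congr
              (s'' := update (update (update s 1 x) 0 y) 2 (List.replicate 1 true ++ s 2)) (by
              funext i
              simp only [update_apply]
              split_ifs <;> simp_all) le_rfl
            cases c
            · obtain rfl : d = true := by simpa using Ne.symm hcd
              exact Runs.cases_cons (b := true) (l := y) (by simpa using h₀) h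
            · obtain rfl : d = false := by simpa using Ne.symm hcd
              exact Runs.cases_cons (b := false) (l := y) (by simpa using h₀) h
      obtain ⟨k, l, h₁, hk, hk', hl⟩ := h₁
      obtain ⟨k', l', h₂, hk₂, hk₂', hl₂⟩ :=
        ih (update (update (update s 1 x) 0 l) 2 (List.replicate k true ++ s 2)) (by simp)
      refine ⟨k' + k, l', (Runs.loop_cons hs h₁ h₂).congr ?_ (by simp; omega), ?_, by simp; omega, ?_⟩
      · rw [List.replicate_add, List.append_assoc]
        funext i
        simp only [update_apply]
        split_ifs <;> simp_all
      · simp only [update_apply, OfNat.zero_ne_ofNat, ↓reduceIte] at hk₂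
        rw [← hk, ← hk₂]
        constructor <;> rintro ⟨h, h'⟩
        · exact ⟨by omega, by omega, h'⟩
        · exact ⟨by omega, h'.2⟩
      · simp only [update_apply, OfNat.zero_ne_ofNat, ↓reduceIte] at hl₂
        omega
  have key₂ : ∀ (x : List Bool) (s : State), s 0 = x →
      Runs (loop 0 (push 2 true) (push 2 true)) s
        (update (update s 0 []) 2 (List.replicate x.length true ++ s 2)) (2 * x.length + 1) := by
    intro x
    induction x with
    | nil => exact fun s hs => (Runs.loop_nil hs).congr (by simp [update_nil hs]) (by simp)
    | cons c x ih =>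
      intro s hs
      have h₁ : Runs (bif c then push 2 true else push 2 true) (update s 0 x)
          (update (update s 0 x) 2 (true :: s 2)) 1 := by
        cases c <;> exact Runs.push 2 true (update s 0 x)
      refine (Runs.loop_cons hs h₁ (ih _ (by simp))).congr ?_ (by simp; omega)
      funext i
      simp only [update_apply]
      split_ifs <;> simp_all [List.replicate_succ']
  -- The leftover `l` is added to the mismatches, so afterwards stack `2` alone tells whether the
  -- words were equal.
  obtain ⟨k, l, h₁, hk, hk', hl⟩ := key₁ (s 1) s rfl
  have h₃ := key₂ l _ (show update (update (update s 1 []) 0 l) 2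
    (List.replicate k true ++ s 2) 0 = l by simp)
  set s₂ := update (update (update (update (update s 1 []) 0 l) 2
    (List.replicate k true ++ s 2)) 0 []) 2 (List.replicate l.length true ++ update (update (update
      s 1 []) 0 l) 2 (List.replicate k true ++ s 2) 2) with hs₂
  have e₂ : s₂ 2 = List.replicate (l.length + k) true := by
    simp [hs₂, h₂]
  have h₄ : Runs (cases 2 (push 0 true) (seq (clear 2) (push 0 false))
      (seq (clear 2) (push 0 false))) s₂ (update (update s 1 []) 0 [decide (s 1 = s 0)])
      (2 * (l.length + k) + 5) := by
    by_cases h : s 1 = s 0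
    · obtain ⟨rfl, rfl⟩ := hk.2 h
      refine (Runs.cases_nil (by simpa using e₂) (Runs.push 0 true _)).congr ?_ (by simp)
      funext i
      simp only [update_apply, hs₂, h]
      split_ifs <;> simp_all
    · obtain ⟨j, hj⟩ : ∃ j, l.length + k = j + 1 := by
        refine Nat.exists_eq_succ_of_ne_zero fun h0 => h (hk.1 ⟨by omega, ?_⟩)
        exact List.length_eq_zero_iff.1 (by omega)
      rw [hj, List.replicate_succ] at e₂
      refine (Runs.cases_cons e₂ ((runs_clear 2 _).seq (Runs.push 0 false _))).congr ?_ ?_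
      · funext i
        simp only [update_apply, hs₂, h]
        split_ifs <;> simp_all
      · simp; omega
  exact (h₁.seq (h₃.seq h₄)).mono (by omega)

end StackProg


open Function

/-! ### Encodings by bit strings and functions computable in polynomial time -/

/-- An injective encoding by bit strings. -/
class BitEnc (α : Type) where
  /-- The bit string of an element. -/
  enc : α → List Bool
  enc_injective : Injective enc

namespace BitEnc

variable {α β : Type}

/-- The encoding pulled back along an injective function. -/
@[reducible] def ofInjective [BitEnc β] (f : α → β) (hf : Injective f) : BitEnc α where
  enc a := enc (f a)
  enc_injective := enc_injective.comp hf

instance : BitEnc Bool where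
  enc b := [b]
  enc_injective _ _ h := List.singleton_inj.1 h

instance : BitEnc Unit where
  enc _ := []
  enc_injective _ _ _ := rfl

instance [BitEnc α] [BitEnc β] : BitEnc (α × β) where
  enc p := StackProg.dbl (enc p.1) ++ false :: enc p.2
  enc_injective p q h := by
    obtain ⟨h₁, h₂⟩ := StackProg.dbl_append_inj h
    exact Prod.ext (enc_injective h₁) (enc_injective h₂)

theorem enc_prod [BitEnc α] [BitEnc β] (a : α) (b : β) :
    enc (a, b) = StackProg.dbl (enc a) ++ false :: enc b := rfl

/-- The encoding of a list. -/
def encList [BitEnc α] : List α → List Bool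
  | [] => []
  | a :: l => StackProg.dbl (enc a) ++ false :: encList l

instance [BitEnc α] : BitEnc (List α) where
  enc := encList
  enc_injective := by
    intro l
    induction l with
    | nil => intro l' h; cases l' <;> simp_all [encList]
    | cons a l ih =>
      intro l' h
      cases l' with
      | nil => simp [encList] at h
      | cons a' l' =>
        obtain ⟨h₁, h₂⟩ := StackProg.dbl_append_inj h
        rw [enc_injective h₁, ih h₂]

theorem enc_cons [BitEnc α] (a : α) (l : List α) :
    enc (a :: l) = StackProg.dbl (enc a) ++ false :: enc l := rfl

instance : BitEnc ℕ :=
  ofInjective (fun n => List.replicate n ()) fun _ _ h => by simpa using congrArg List.length h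

instance : BitEnc ℤ :=
  ofInjective (fun z : ℤ => match z with
    | Int.ofNat n => (false, n)
    | Int.negSucc n => (true, n)) fun a b h => by
      cases a <;> cases b <;> simp_all

/-- The encoding of a finite type by numbers. -/
@[reducible] noncomputable def ofFinite (α : Type) [Finite α] : BitEnc α :=
  ofInjective (fun a => (Finite.equivFin α a : ℕ))
    fun _ _ h => (Finite.equivFin α).injective (Fin.ext h)

/-- The length of the encoding. -/
def size [BitEnc α] (a : α) : ℕ := (enc a).length

theorem size_prod [BitEnc α] [BitEnc β] (a : α) (b : β) : size (a, b) = 2 * size a + 1 + size b := by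
  simp [size, enc_prod]; omega

theorem size_nil [BitEnc α] : size ([] : List α) = 0 := rfl

theorem size_cons [BitEnc α] (a : α) (l : List α) : size (a :: l) = 2 * size a + 1 + size l := by
  simp [size, enc_cons]; omega

theorem size_le_of_mem [BitEnc α] {a : α} {l : List α} (h : a ∈ l) : size a ≤ size l := by
  induction l with
  | nil => simp at h
  | cons b l ih =>
    rw [size_cons]
    rcases List.mem_cons.1 h with rfl | h
    · omega
    · have := ih h; omega

theorem length_le_size [BitEnc α] (l : List α) : l.length ≤ size l := by
  induction l with
  | nil => simp
  | cons b l ih => rw [size_cons, List.length_cons]; omega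

theorem size_list_le [BitEnc α] {l : List α} {B : ℕ} (h : ∀ a ∈ l, size a ≤ B) :
    size l ≤ l.length * (2 * B + 1) := by
  induction l with
  | nil => simp [size_nil]
  | cons b l ih =>
    have h₁ := h b (by simp)
    have h₂ := ih fun a ha => h a (by simp [ha])
    rw [size_cons, List.length_cons, Nat.add_mul]; omega

theorem size_append [BitEnc α] (l l' : List α) : size (l ++ l') = size l + size l' := by
  induction l with
  | nil => simp [size_nil]
  | cons b l ih => rw [List.cons_append, size_cons, size_cons, ih]; omega

theorem size_sublist [BitEnc α] {l l' : List α} (h : l.Sublist l') : size l ≤ size l' := by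
  induction h with
  | slnil => exact le_rfl
  | cons a _ ih => rw [size_cons]; omega
  | cons_cons a _ ih => rw [size_cons, size_cons]; omega

theorem size_bool (b : Bool) : size b = 1 := rfl

theorem size_nat (n : ℕ) : size n = n := by
  change size (List.replicate n ()) = n
  induction n with
  | zero => rfl
  | succ n ih => rw [List.replicate_succ, size_cons, ih]; simp [size, enc]; omega

end BitEnc

theorem Polynomial.eval_nat_mono (p : Polynomial ℕ) {m n : ℕ} (h : m ≤ n) :
    p.eval m ≤ p.eval n := by
  rw [Polynomial.eval_eq_sum, Polynomial.eval_eq_sum]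
  exact Finset.sum_le_sum fun i _ => Nat.mul_le_mul_left _ (Nat.pow_le_pow_left h i)

/-! ### Functions computable in polynomial time by stack programs -/

open BitEnc StackProg

/-- Functions computable in polynomial time by a program on stacks of bits. The program takes its
input from the stack `0` and puts its output there; it uses finitely many further stacks, which have
to be empty initially and are left empty. -/
@[fun_prop]
def PolyTime {α β : Type} [BitEnc α] [BitEnc β] (f : α → β) : Prop :=
  ∃ (p : StackProg) (n : ℕ) (T : Polynomial ℕ), ∀ (x : α) (s : State), s 0 = enc x →
    (∀ i, 0 < i → i < n → s i = []) → Runs p s (update s 0 (enc (f x))) (T.eval (size x))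

namespace PolyTime

variable {α β γ δ σ : Type} [BitEnc α] [BitEnc β] [BitEnc γ] [BitEnc δ] [BitEnc σ]

/-- A stack gains at most one bit per step, so the running time also bounds the output. In a
composition this turns the time of the second program into a polynomial in the original input size.
-/
theorem exists_size_le {f : α → β} (hf : PolyTime f) :
    ∃ Q : Polynomial ℕ, ∀ x, size (f x) ≤ Q.eval (size x) := by
  obtain ⟨p, n, T, h⟩ := hf
  refine ⟨Polynomial.X + T, fun x => ?_⟩
  have := (h x (update (fun _ => []) 0 (enc x)) (by simp) fun i hi _ => by simp [hi.ne']).length_le 0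
  simpa [size] using this

/-- A function that does not change the encoding is computable in polynomial time. -/
theorem of_enc_eq {f : α → β} (h : ∀ x, enc (f x) = enc x) : PolyTime f :=
  ⟨.skip, 0, 1, fun x s hs _ => (Runs.skip s).congr (by rw [h, ← hs, update_eq_self]) (by simp)⟩

@[fun_prop]
theorem id : PolyTime fun x : α => x := of_enc_eq fun _ => rfl

@[fun_prop]
theorem const (b : β) : PolyTime fun _ : α => b := by
  refine ⟨.seq (clear 0) (pushList (enc b)), 0, 2 * Polynomial.X + Polynomial.C (size b) + 2,
    fun x s hs _ => ?_⟩
  refine ((runs_clear 0 s).seq (runs_pushList (enc b) _)).congr (by simp) ?_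
  simp [size, hs]; omega

@[fun_prop]
theorem comp {g : β → γ} {f : α → β} (hg : PolyTime g) (hf : PolyTime f) :
    PolyTime fun x => g (f x) := by
  obtain ⟨Q, hQ⟩ := hf.exists_size_le
  obtain ⟨p, n, T, hf⟩ := hf
  obtain ⟨q, m, U, hg⟩ := hg
  refine ⟨.seq p q, max n m, T + U.comp Q, fun x s hs h => ?_⟩
  refine ((hf x s hs fun i hi hn => h i hi (by omega)).seq (hg (f x) _ (by simp) ?_)).congr
    (by simp) ?_
  · intro i hi hn
    rw [update_of_ne hi.ne']
    exact h i hi (by omega)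
  · simpa using U.eval_nat_mono (hQ x)

@[fun_prop]
theorem prodMk {f : α → β} {g : α → γ} (hf : PolyTime f) (hg : PolyTime g) :
    PolyTime fun x => (f x, g x) := by
  obtain ⟨Q, hQ⟩ := hf.exists_size_le
  obtain ⟨p, n, T, hf⟩ := hf
  obtain ⟨q, m, U, hg⟩ := hg
  -- Stacks from `N` on lie outside the workspaces of `p` and `q`, which preserve whatever is stored
  -- there. Stack `N` keeps the input for `q`, stack `N + 2` the first result, and `N + 1` is
  -- scratch space; the `+ 1` keeps `N` away from stack `0`.
  obtain ⟨N, hN⟩ : ∃ N, N = max n m + 1 := ⟨_, rfl⟩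
  refine ⟨.seq (copy 0 N (N + 1)) (.seq p (.seq (move 0 (N + 2) (N + 1)) (.seq (move N 0 (N + 1))
    (.seq q (pairUp (N + 2) 0 (N + 1)))))), N + 3, 9 * Polynomial.X + 9 * Q + T + U + 9,
    fun x s hs h => ?_⟩
  have e₀ : s N = [] := h _ (by omega) (by omega)
  have e₁ : s (N + 1) = [] := h _ (by omega) (by omega)
  have e₂ : s (N + 2) = [] := h _ (by omega) (by omega)
  have N0 : N ≠ 0 := by omega
  have N0' : 0 ≠ N := by omega
  have r₁ := runs_copy (a := 0) (b := N) (t := N + 1) N0' (by omega) (by omega) (s := s) e₀ e₁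
  have r₂ := hf x (update s N (s 0)) (by simp [N0', hs]) fun i hi hn => by
    rw [update_of_ne (by omega)]; exact h i hi (by omega)
  have r₃ := runs_move (a := 0) (b := N + 2) (t := N + 1) (by omega) (by omega) (by omega)
    (s := update (update s N (s 0)) 0 (enc (f x))) (by simp [e₂]) (by simp [e₁])
  have r₄ := runs_move (a := N) (b := 0) (t := N + 1) N0 (by omega) (by omega)
    (s := update (update (update (update s N (s 0)) 0 (enc (f x))) 0 []) (N + 2) (enc (f x)))
    (by simp) (by simp [e₁])
  have r₅ := hg x (update (update (update s N []) (N + 2) (enc (f x))) 0 (enc x))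
    (by simp) fun i hi hn => by
      rw [update_of_ne (by omega), update_of_ne (by omega), update_of_ne (by omega)]
      exact h i hi (by omega)
  have r₆ := runs_pairUp (a := N + 2) (b := 0) (t := N + 1) (by omega) (by omega) (by omega)
    (s := update (update (update s N []) (N + 2) (enc (f x))) 0 (enc (g x))) (by simp [e₁])
  refine (r₁.seq (r₂.seq ((r₃.congr ?_ le_rfl).seq ((r₄.congr ?_ le_rfl).seq
    ((r₅.congr ?_ le_rfl).seq r₆))))).congr ?_ ?_
  · simp
  · funext i
    simp only [update_apply]
    split_ifs <;> first | rfl | omega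
  · simp
  · funext i
    simp only [update_apply]
    split_ifs <;> first | rfl | omega | contradiction | (subst i; simp [e₀, e₂])
  · have h₁ := hQ x
    simp only [size] at h₁ ⊢
    simp [hs, N0]
    omega

@[fun_prop]
theorem fst {f : α → β × γ} (hf : PolyTime f) : PolyTime fun x => (f x).1 := by
  refine comp (g := Prod.fst) ?_ hf
  refine ⟨.seq (unpair 0 1 2 3) (.seq (clear 0) (move 1 0 2)), 4, 20 * Polynomial.X + 20,
    fun x s hs h => ?_⟩
  obtain ⟨x, y⟩ := x
  have e₁ : s 1 = [] := h 1 (by omega) (by omega)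
  have e₂ : s 2 = [] := h 2 (by omega) (by omega)
  have e₃ : s 3 = [] := h 3 (by omega) (by omega)
  refine ((runs_unpair (a := 0) (b := 1) (t := 2) (f := 3) (by omega) (by omega) (by omega)
    (by omega) (by omega) (by omega) hs e₁ e₂ e₃).seq ((runs_clear 0 _).seq
      (runs_move (by omega) (by omega) (by omega) (by simp) (by simp [e₂])))).congr ?_ ?_
  · funext i
    simp only [update_apply]
    split_ifs <;> simp_all
  · rw [size_prod]
    simp [size]
    omega

@[fun_prop]
theorem snd {f : α → β × γ} (hf : PolyTime f) : PolyTime fun x => (f x).2 := by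
  refine comp (g := Prod.snd) ?_ hf
  refine ⟨.seq (unpair 0 1 2 3) (clear 1), 4, 20 * Polynomial.X + 20, fun x s hs h => ?_⟩
  obtain ⟨x, y⟩ := x
  have e₁ : s 1 = [] := h 1 (by omega) (by omega)
  have e₂ : s 2 = [] := h 2 (by omega) (by omega)
  have e₃ : s 3 = [] := h 3 (by omega) (by omega)
  refine ((runs_unpair (a := 0) (b := 1) (t := 2) (f := 3) (by omega) (by omega) (by omega)
    (by omega) (by omega) (by omega) hs e₁ e₂ e₃).seq (runs_clear 1 _)).congr ?_ ?_
  · funext i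
    simp only [update_apply]
    split_ifs <;> simp_all
  · rw [size_prod]
    simp [size]
    omega

/-- Case distinction, where the cases are computed by functions on other types whose elements have
the same encodings. -/
theorem branch {c : α → Bool} {f : α → β} {g : γ → β} {h : δ → β} (hc : PolyTime c)
    (hg : PolyTime g) (hh : PolyTime h)
    (ht : ∀ x, c x = true → ∃ y, enc y = enc x ∧ g y = f x)
    (hf : ∀ x, c x = false → ∃ y, enc y = enc x ∧ h y = f x) : PolyTime f := by
  obtain ⟨p, n, T, hc⟩ := hc
  obtain ⟨q, m, U, hg⟩ := hg
  obtain ⟨r, k, V, hh⟩ := hh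
  -- The Boolean is the only bit on stack `0`, so popping it for the case distinction also clears
  -- that stack for the saved copy of the input. The branch for an empty stack is never taken.
  obtain ⟨N, hN⟩ : ∃ N, N = max n (max m k) + 1 := ⟨_, rfl⟩
  refine ⟨.seq (copy 0 N (N + 1)) (.seq p (.cases 0 .skip (.seq (move N 0 (N + 1)) r)
    (.seq (move N 0 (N + 1)) q))), N + 2, 9 * Polynomial.X + T + U + V + 5, fun x s hs hi => ?_⟩
  have e₀ : s N = [] := hi _ (by omega) (by omega)
  have e₁ : s (N + 1) = [] := hi _ (by omega) (by omega)
  have N0 : N ≠ 0 := by omega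
  have N0' : 0 ≠ N := by omega
  have r₁ := runs_copy (a := 0) (b := N) (t := N + 1) N0' (by omega) (by omega) (s := s) e₀ e₁
  have r₂ := hc x (update s N (s 0)) (by simp [N0', hs]) fun i h0 hn => by
    rw [update_of_ne (by omega)]; exact hi i h0 (by omega)
  have r₃ := (runs_move (a := N) (b := 0) (t := N + 1) N0 (by omega) (by omega)
    (s := update (update s N (s 0)) 0 []) (by simp) (by simp [e₁])).congr (s'' := s) (by
      funext i
      simp only [update_apply]
      split_ifs <;> simp_all) le_rfl
  have hs' : (s 0).length = size x := by rw [hs, size]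
  cases hx : c x with
  | false =>
    obtain ⟨y, hy, hy'⟩ := hf x hx
    have r₄ := hh y s (hs.trans hy.symm) fun i h0 hn => hi i h0 (by omega)
    rw [hy'] at r₄
    have r₅ : Runs (.cases 0 .skip (.seq (move N 0 (N + 1)) r) (.seq (move N 0 (N + 1)) q))
        (update (update s N (s 0)) 0 (enc (c x))) _ _ :=
      Runs.cases_cons (b := false) (l := []) (by simp [hx, enc])
        ((r₃.seq r₄).congr (s'' := update s 0 (enc (f x))) rfl le_rfl |> fun h => by
          simpa using h)
    refine (r₁.seq (r₂.seq r₅)).mono ?_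
    have : size y = size x := congrArg List.length hy
    simp [hs', N0, this]
    omega
  | true =>
    obtain ⟨y, hy, hy'⟩ := ht x hx
    have r₄ := hg y s (hs.trans hy.symm) fun i h0 hn => hi i h0 (by omega)
    rw [hy'] at r₄
    have r₅ : Runs (.cases 0 .skip (.seq (move N 0 (N + 1)) r) (.seq (move N 0 (N + 1)) q))
        (update (update s N (s 0)) 0 (enc (c x))) _ _ :=
      Runs.cases_cons (b := true) (l := []) (by simp [hx, enc])
        ((r₃.seq r₄).congr (s'' := update s 0 (enc (f x))) rfl le_rfl |> fun h => by
          simpa using h)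
    refine (r₁.seq (r₂.seq r₅)).mono ?_
    have : size y = size x := congrArg List.length hy
    simp [hs', N0, this]
    omega

@[fun_prop]
theorem cond {c : α → Bool} {f g : α → β} (hc : PolyTime c) (hf : PolyTime f) (hg : PolyTime g) :
    PolyTime fun x => bif c x then f x else g x :=
  hc.branch hf hg (fun x hx => ⟨x, rfl, by simp [hx]⟩) fun x hx => ⟨x, rfl, by simp [hx]⟩

-- Since encodings are injective, comparing the two bit strings decides equality.
@[fun_prop]
theorem decide_eq [DecidableEq β] {f g : α → β} (hf : PolyTime f) (hg : PolyTime g) :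
    PolyTime fun x => decide (f x = g x) := by
  refine comp (g := fun p : β × β => decide (p.1 = p.2)) ?_ (hf.prodMk hg)
  refine ⟨.seq (unpair 0 1 2 3) compare, 4, 20 * Polynomial.X + 20, fun x s hs h => ?_⟩
  obtain ⟨x, y⟩ := x
  have e₁ : s 1 = [] := h 1 (by omega) (by omega)
  have e₂ : s 2 = [] := h 2 (by omega) (by omega)
  have e₃ : s 3 = [] := h 3 (by omega) (by omega)
  refine ((runs_unpair (a := 0) (b := 1) (t := 2) (f := 3) (by omega) (by omega) (by omega)
    (by omega) (by omega) (by omega) hs e₁ e₂ e₃).seq (runs_compare (by simp [e₂]))).congr ?_ ?_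
  · have : (enc x = enc y) = (x = y) := propext ⟨fun h => enc_injective h, fun h => h ▸ rfl⟩
    funext i
    simp only [update_apply]
    split_ifs <;> simp_all [enc]
  · rw [size_prod]
    simp [size]
    omega

/-- Recursion along a list, if the intermediate results have polynomial size. -/
theorem foldl_of_enc_eq {f : σ × α → σ} {g : γ → σ × List α} (hf : PolyTime f)
    (hg : ∀ c, enc (g c) = enc c) (Q : Polynomial ℕ)
    (hQ : ∀ c l, l <+: (g c).2 → size (l.foldl (fun s a => f (s, a)) (g c).1) ≤ Q.eval (size c)) :
    PolyTime fun c => (g c).2.foldl (fun s a => f (s, a)) (g c).1 := by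
  obtain ⟨p, n, T, hf⟩ := hf
  obtain ⟨N, hN⟩ : ∃ N, N = n + 1 := ⟨_, rfl⟩
  set body : StackProg := .seq (unpair (N + 3) N (N + 1) (N + 2)) (.seq (pairUp 0 N (N + 1))
    (.seq (move N 0 (N + 1)) p)) with hbody
  have N0 : N ≠ 0 := by omega
  have N0' : 0 ≠ N := by omega
  have step : ∀ (a : α) (y : List Bool) (x : σ) (s : State) (B : ℕ), s 0 = enc x →
      s (N + 3) = dbl (enc a) ++ false :: y → (∀ i, 0 < i → i < N + 3 → s i = []) →
      size x ≤ B → size a ≤ B →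
      Runs body s (update (update s (N + 3) y) 0 (enc (f (x, a))))
        (24 * B + 15 + T.eval (3 * B + 1)) := by
    intro a y x s B h₀ hL hi hx ha
    have e₀ : s N = [] := hi _ (by omega) (by omega)
    have e₁ : s (N + 1) = [] := hi _ (by omega) (by omega)
    have e₂ : s (N + 2) = [] := hi _ (by omega) (by omega)
    have r₁ := runs_unpair (a := N + 3) (b := N) (t := N + 1) (f := N + 2) (by omega) (by omega)
      (by omega) (by omega) (by omega) (by omega) hL e₀ e₁ e₂
    have r₂ := runs_pairUp (a := 0) (b := N) (t := N + 1) (by omega) (by omega) (by omega)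
      (s := update (update s (N + 3) y) N (enc a)) (by simp [e₁])
    have r₃ := runs_move (a := N) (b := 0) (t := N + 1) (by omega) (by omega) (by omega)
      (s := update (update (update s (N + 3) y) 0 []) N (enc (x, a))) (by simp [N0']) (by simp [e₁])
    have r₄ := hf (x, a) (update (update s (N + 3) y) 0 (enc (x, a))) (by simp) fun i h0 hn => by
      rw [update_of_ne (by omega), update_of_ne (by omega)]; exact hi i h0 (by omega)
    refine (r₁.seq ((r₂.congr ?_ le_rfl).seq ((r₃.congr ?_ le_rfl).seq r₄))).congr ?_ ?_
    · funext i
      simp only [update_apply]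
      split_ifs <;> first | rfl | omega | contradiction | (subst i; simp [h₀, enc_prod])
    · funext i
      simp only [update_apply]
      split_ifs <;> first | rfl | omega | contradiction | (subst i; simp [e₀])
    · simp
    · have h₁ : size (x, a) ≤ 3 * B + 1 := by rw [size_prod]; omega
      have h₂ := T.eval_nat_mono h₁
      have h₃ : (enc (x, a)).length ≤ 3 * B + 1 := h₁
      simp only [size] at hx ha
      simp [N0', h₀]
      omega
  have key : ∀ (l : List α) (x : σ) (s : State) (B : ℕ), s 0 = enc x → s (N + 3) = enc l →
      (∀ i, 0 < i → i < N + 3 → s i = []) →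
      (∀ l', l' <+: l → size (l'.foldl (fun s a => f (s, a)) x) ≤ B) → (∀ a ∈ l, size a ≤ B) →
      Runs (.loop (N + 3) (.seq (.push (N + 3) false) body) (.seq (.push (N + 3) true) body)) s
        (update (update s (N + 3) []) 0 (enc (l.foldl (fun s a => f (s, a)) x)))
        (l.length * (24 * B + 17 + T.eval (3 * B + 1)) + 1) := by
    intro l
    induction l with
    | nil =>
      intro x s B h₀ hL hi _ _
      refine (Runs.loop_nil hL).congr ?_ (by simp)
      have hL' : s (N + 3) = [] := hL
      rw [update_nil hL', List.foldl_nil, ← h₀, update_eq_self]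
    | cons a l ih =>
      intro x s B h₀ hL hi hx ha
      rw [enc_cons] at hL
      -- The loop tests for remaining elements by popping a bit of the encoded list. Each branch
      -- first pushes this bit back, so that `body` finds the encoding unharmed.
      obtain ⟨b, z, hbz⟩ : ∃ b z, dbl (enc a) ++ false :: enc l = b :: z := by
        cases dbl (enc a) <;> simp
      have r₁ := (Runs.push (N + 3) b (update s (N + 3) z)).congr (s'' := s) (t' := 1) (by
        rw [update_self, update_idem, ← hbz, ← hL, update_eq_self]) le_rfl
      have r₂ := r₁.seq (step a (enc l) x s B h₀ hL hi (hx [] (List.nil_prefix))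
        (ha a (by simp)))
      have r₃ : Runs (bif b then .seq (.push (N + 3) true) body
          else .seq (.push (N + 3) false) body) (update s (N + 3) z)
          (update (update s (N + 3) (enc l)) 0 (enc (f (x, a))))
          (1 + (24 * B + 15 + T.eval (3 * B + 1))) := by
        cases b <;> exact r₂
      refine (Runs.loop_cons (hL.trans hbz) r₃ (ih (f (x, a)) _ B (by simp) (by simp) ?_ ?_ ?_)).congr
        ?_ ?_
      · intro i h0 hn
        rw [update_of_ne (by omega), update_of_ne (by omega)]
        exact hi i h0 hn
      · intro l' hl'
        have := hx (a :: l') (by simpa using hl')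
        simpa using this
      · exact fun a' ha' => ha a' (by simp [ha'])
      · funext i
        simp only [update_apply, List.foldl_cons]
        split_ifs <;> rfl
      · rw [List.length_cons, Nat.add_mul]
        omega
  refine ⟨.seq (unpair 0 N (N + 1) (N + 2)) (.seq (move 0 (N + 3) (N + 1))
    (.seq (move N 0 (N + 1)) (.loop (N + 3) (.seq (.push (N + 3) false) body)
      (.seq (.push (N + 3) true) body)))), N + 4,
    15 * Polynomial.X + 11 + Polynomial.X * (24 * (Q + Polynomial.X) + 17 +
      T.comp (3 * (Q + Polynomial.X) + 1)), fun c s hs hi => ?_⟩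
  replace hQ := hQ c
  have hsize : size c = size (g c) := congrArg List.length (hg c).symm
  rw [← hg c] at hs
  rw [hsize] at hQ ⊢
  beta_reduce
  generalize g c = y at hs hQ ⊢
  obtain ⟨x, l⟩ := y
  have e₀ : s N = [] := hi _ (by omega) (by omega)
  have e₁ : s (N + 1) = [] := hi _ (by omega) (by omega)
  have e₂ : s (N + 2) = [] := hi _ (by omega) (by omega)
  have e₃ : s (N + 3) = [] := hi _ (by omega) (by omega)
  have hsz := size_prod x l
  have r₁ := runs_unpair (a := 0) (b := N) (t := N + 1) (f := N + 2) (by omega) (by omega)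
    (by omega) (by omega) (by omega) (by omega) (hs.trans (enc_prod x l)) e₀ e₁ e₂
  have r₂ := runs_move (a := 0) (b := N + 3) (t := N + 1) (by omega) (by omega) (by omega)
    (s := update (update s 0 (enc l)) N (enc x)) (by simp [e₃]) (by simp [e₁])
  have r₃ := runs_move (a := N) (b := 0) (t := N + 1) (by omega) (by omega) (by omega)
    (s := update (update (update s (N + 3) (enc l)) 0 []) N (enc x)) (by simp [N0']) (by simp [e₁])
  have r₄ := key l x (update (update s (N + 3) (enc l)) 0 (enc x)) (Q.eval (size (x, l)) + size (x, l))
    (by simp) (by simp) (fun i h0 hn => by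
      rw [update_of_ne (by omega), update_of_ne (by omega)]; exact hi i h0 (by omega))
    (fun l' hl' => (hQ l' hl').trans (by omega))
    fun a ha => (size_le_of_mem ha).trans (by omega)
  refine (r₁.seq ((r₂.congr ?_ le_rfl).seq ((r₃.congr ?_ le_rfl).seq r₄))).congr ?_ ?_
  · funext i
    simp only [update_apply]
    split_ifs <;> first | rfl | omega
  · funext i
    simp only [update_apply]
    split_ifs <;> first | rfl | omega | contradiction | (subst i; simp [e₀])
  · funext i
    simp only [update_apply]
    split_ifs <;> first | rfl | omega | contradiction | (subst i; simp [e₃])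
  · have h₁ := Nat.mul_le_mul_right (24 * (Q.eval (size (x, l)) + size (x, l)) + 17 +
      T.eval (3 * (Q.eval (size (x, l)) + size (x, l)) + 1))
      ((length_le_size l).trans (show size l ≤ size (x, l) by omega))
    simp [N0']
    simp only [size] at h₁ hsz ⊢
    omega

/-- Recursion along a list, if the intermediate results have polynomial size. -/
theorem foldl {s₀ : γ → σ} {l : γ → List α} {f : γ → σ → α → σ} (hs : PolyTime s₀)
    (hl : PolyTime l) (hf : PolyTime fun p : γ × σ × α => f p.1 p.2.1 p.2.2) (Q : Polynomial ℕ)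
    (hQ : ∀ c l', l' <+: l c → size (l'.foldl (f c) (s₀ c)) ≤ Q.eval (size c)) :
    PolyTime fun c => (l c).foldl (f c) (s₀ c) := by
  -- The parameter `c` travels inside the fold state, because the step function needs it in every
  -- round.
  let g : γ → (γ × σ) × List α := fun c => ((c, s₀ c), l c)
  -- The size bound is known only for starting data of the form `g c`; the subtype restricts to
  -- these without changing the bit strings.
  let ι := {p : (γ × σ) × List α // ∃ c, g c = p}
  let _ : BitEnc ι := ofInjective Subtype.val Subtype.val_injective
  have hg : PolyTime fun c => (⟨g c, c, rfl⟩ : ι) := (PolyTime.id.prodMk hs).prodMk hl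
  let f' : (γ × σ) × α → γ × σ := fun p => (p.1.1, f p.1.1 p.1.2 p.2)
  have hf' : PolyTime f' := by
    have h : PolyTime fun p : (γ × σ) × α => (p.1.1, p.1.2, p.2) := by fun_prop
    have := hf.comp h
    fun_prop
  have fold : ∀ (l : List α) (c : γ) (s : σ),
      l.foldl (fun s a => f' (s, a)) (c, s) = (c, l.foldl (f c) s) := by
    intro l c
    induction l with
    | nil => intro s; rfl
    | cons a l ih => exact fun s => ih _
  have h := (foldl_of_enc_eq (g := (Subtype.val : ι → _)) hf' (fun _ => rfl)
    (2 * Polynomial.X + 1 + Q) ?_).comp hg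
  · have h' := h.snd
    simpa [g, fold] using h'
  · rintro ⟨_, c, rfl⟩ l' hl'
    have h₁ := hQ c l' hl'
    have h₂ : size c ≤ size (g c) := by simp only [g, size_prod]; omega
    have h₃ := Q.eval_nat_mono h₂
    have h₄ : size (⟨g c, c, rfl⟩ : ι) = size (g c) := rfl
    simp only [h₄, g, fold, size_prod] at h₁ h₂ h₃ ⊢
    simp
    omega

end PolyTime


/-! ### Polynomial-time operations on Booleans, lists, numbers and integers -/

open Function

open BitEnc

namespace PolyTime

variable {α β γ δ σ : Type} [BitEnc α] [BitEnc β] [BitEnc γ] [BitEnc δ] [BitEnc σ]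

@[fun_prop]
theorem not {f : γ → Bool} (hf : PolyTime f) : PolyTime fun c => !f c := by
  have : PolyTime fun c => bif f c then false else true := by fun_prop
  convert this using 2 with c
  cases f c <;> rfl

@[fun_prop]
theorem and {f g : γ → Bool} (hf : PolyTime f) (hg : PolyTime g) :
    PolyTime fun c => f c && g c := by
  have : PolyTime fun c => bif f c then g c else false := by fun_prop
  convert this using 2 with c
  cases f c <;> rfl

@[fun_prop]
theorem or {f g : γ → Bool} (hf : PolyTime f) (hg : PolyTime g) :
    PolyTime fun c => f c || g c := by
  have : PolyTime fun c => bif f c then true else g c := by fun_prop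
  convert this using 2 with c
  cases f c <;> rfl

/-- Every function on a finite type is computable in polynomial time. -/
@[fun_prop]
theorem of_finite [Finite α] (f : α → β) : PolyTime f := by
  classical
  have := Fintype.ofFinite α
  -- The function is a table: a cascade of comparisons with the elements of `l`, built one entry at
  -- a time.
  have key : ∀ l : List α, ∃ g : α → β, PolyTime g ∧ ∀ a ∈ l, g a = f a := by
    intro l
    induction l with
    | nil =>
      by_cases h : Nonempty α
      · exact ⟨fun _ => f h.some, const _, by simp⟩
      · exact ⟨f, of_enc_eq fun x => absurd ⟨x⟩ h, by simp⟩
    | cons a l ih =>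
      obtain ⟨g, hg, h⟩ := ih
      refine ⟨fun x => bif decide (x = a) then f a else g x, by fun_prop, fun x hx => ?_⟩
      by_cases hxa : x = a
      · simp [hxa]
      · simpa [hxa] using h x (by simpa [hxa] using hx)
  obtain ⟨g, hg, h⟩ := key Finset.univ.toList
  rwa [show f = g from funext fun a => (h a (by simp)).symm]

@[fun_prop]
theorem cons {f : γ → α} {g : γ → List α} (hf : PolyTime f) (hg : PolyTime g) :
    PolyTime fun c => f c :: g c :=
  comp (g := fun p : α × List α => p.1 :: p.2) (of_enc_eq fun _ => rfl) (hf.prodMk hg)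

@[fun_prop]
theorem any {l : γ → List α} {p : γ → α → Bool} (hl : PolyTime l)
    (hp : PolyTime fun q : γ × α => p q.1 q.2) : PolyTime fun c => (l c).any (p c) := by
  have h : PolyTime fun c => (l c).foldl (fun b a => b || p c a) false := by
    refine foldl (by fun_prop) hl ?_ 1 fun c l' _ => by simp [size_bool]
    have : PolyTime fun q : γ × Bool × α => p q.1 q.2.2 :=
      hp.comp (f := fun q : γ × Bool × α => (q.1, q.2.2)) (by fun_prop)
    fun_prop
  convert h using 2 with c
  have : ∀ (l : List α) (b : Bool), l.foldl (fun b a => b || p c a) b = (b || l.any (p c)) := by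
    intro l
    induction l with
    | nil => simp
    | cons a l ih => intro b; rw [List.foldl_cons, ih, List.any_cons, Bool.or_assoc]
  simp [this]

@[fun_prop]
theorem all {l : γ → List α} {p : γ → α → Bool} (hl : PolyTime l)
    (hp : PolyTime fun q : γ × α => p q.1 q.2) : PolyTime fun c => (l c).all (p c) := by
  have h : PolyTime fun c => !(l c).any fun a => !p c a := by fun_prop
  simpa [List.any_eq_not_all_not] using h

@[fun_prop]
theorem reverse {l : γ → List α} (hl : PolyTime l) : PolyTime fun c => (l c).reverse := by
  have h : PolyTime fun c => (l c).foldl (fun l' a => a :: l') [] := by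
    obtain ⟨Q, hQ⟩ := hl.exists_size_le
    refine foldl (by fun_prop) hl (by fun_prop) Q fun c l' hl' => ?_
    have : l'.foldl (fun l' a => a :: l') [] = l'.reverse := by simp
    rw [this]
    refine le_trans ?_ ((size_sublist hl'.sublist).trans (hQ c))
    clear this hl'
    induction l' with
    | nil => simp
    | cons a l ih => rw [List.reverse_cons, size_append, size_cons, size_cons, size_nil]; omega
  simpa using h

@[fun_prop]
theorem append {f g : γ → List α} (hf : PolyTime f) (hg : PolyTime g) :
    PolyTime fun c => f c ++ g c := by
  have h : PolyTime fun c => (f c).reverse.foldl (fun l' a => a :: l') (g c) := by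
    obtain ⟨Q, hQ⟩ := hf.reverse.exists_size_le
    obtain ⟨R, hR⟩ := hg.exists_size_le
    refine foldl hg (by fun_prop) (by fun_prop) (Q + R) fun c l' hl' => ?_
    have h₁ := size_sublist hl'.sublist
    have h₂ : ∀ (l l₀ : List α), size (l.foldl (fun l' a => a :: l') l₀) = size l + size l₀ := by
      intro l
      induction l with
      | nil => simp [size_nil]
      | cons a l ih => intro l₀; rw [List.foldl_cons, ih, size_cons, size_cons]; omega
    have h₃ := hQ c
    have h₄ := hR c
    rw [h₂, Polynomial.eval_add]
    omega
  simpa using h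

@[fun_prop]
theorem map {l : γ → List α} {f : γ → α → β} (hl : PolyTime l)
    (hf : PolyTime fun q : γ × α => f q.1 q.2) : PolyTime fun c => (l c).map (f c) := by
  have h : PolyTime fun c => ((l c).foldl (fun l' a => f c a :: l') []).reverse := by
    obtain ⟨Q, hQ⟩ := hl.exists_size_le
    obtain ⟨R, hR⟩ := hf.exists_size_le
    refine reverse (foldl (by fun_prop) hl ?_
      (Q * (2 * R.comp (2 * Polynomial.X + 1 + Q) + 1)) fun c l' hl' => ?_)
    · have : PolyTime fun q : γ × List β × α => f q.1 q.2.2 :=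
        hf.comp (f := fun q : γ × List β × α => (q.1, q.2.2)) (by fun_prop)
      fun_prop
    · have h₁ : l'.foldl (fun l' a => f c a :: l') [] = (l'.map (f c)).reverse := by simp
      have h₂ : ∀ b ∈ l'.foldl (fun l' a => f c a :: l') [],
          size b ≤ R.eval (2 * size c + 1 + Q.eval (size c)) := by
        intro b hb
        rw [h₁, List.mem_reverse, List.mem_map] at hb
        obtain ⟨a, ha, rfl⟩ := hb
        refine (hR (c, a)).trans (R.eval_nat_mono ?_)
        have := (size_le_of_mem (hl'.subset ha)).trans (hQ c)
        rw [size_prod]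
        omega
      refine (size_list_le h₂).trans ?_
      rw [h₁]
      simp only [Polynomial.eval_mul, Polynomial.eval_add, Polynomial.eval_comp,
        Polynomial.eval_X, Polynomial.eval_one, Polynomial.eval_ofNat]
      refine Nat.mul_le_mul_right _ ?_
      have := (hl'.length_le.trans (length_le_size _)).trans (hQ c)
      simpa using this
  simpa using h

@[fun_prop]
theorem flatten {l : γ → List (List α)} (hl : PolyTime l) : PolyTime fun c => (l c).flatten := by
  have h : PolyTime fun c => (l c).foldl (fun l₁ l₂ => l₁ ++ l₂) [] := by
    obtain ⟨Q, hQ⟩ := hl.exists_size_le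
    refine foldl (by fun_prop) hl (by fun_prop) Q fun c l' hl' => ?_
    have h₁ := (size_sublist hl'.sublist).trans (hQ c)
    have h₂ : ∀ (l : List (List α)) (l₀ : List α),
        size (l.foldl (fun l₁ l₂ => l₁ ++ l₂) l₀) ≤ size l₀ + size l := by
      intro l
      induction l with
      | nil => simp
      | cons a l ih =>
        intro l₀
        have := ih (l₀ ++ a)
        rw [size_append] at this
        rw [List.foldl_cons, size_cons]
        omega
    have := h₂ l' []
    rw [size_nil] at this
    omega
  convert h using 2 with c
  have h₂ : ∀ (l : List (List α)) (l₀ : List α),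
      l.foldl (fun l₁ l₂ => l₁ ++ l₂) l₀ = l₀ ++ l.flatten := by
    intro l
    induction l with
    | nil => simp
    | cons a l ih => intro l₀; rw [List.foldl_cons, ih, List.flatten_cons, List.append_assoc]
  simp [h₂]

@[fun_prop]
theorem flatMap {l : γ → List α} {f : γ → α → List β} (hl : PolyTime l)
    (hf : PolyTime fun q : γ × α => f q.1 q.2) : PolyTime fun c => (l c).flatMap (f c) := by
  have h : PolyTime fun c => ((l c).map (f c)).flatten := by fun_prop
  simpa [List.flatMap] using h

@[fun_prop]
theorem filter {l : γ → List α} {p : γ → α → Bool} (hl : PolyTime l)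
    (hp : PolyTime fun q : γ × α => p q.1 q.2) : PolyTime fun c => (l c).filter (p c) := by
  have h : PolyTime fun c => (l c).flatMap fun a => bif p c a then [a] else [] := by fun_prop
  convert h using 2 with c
  induction l c with
  | nil => rfl
  | cons a l ih => cases ha : p c a <;> simp [ha, ih]

@[fun_prop]
theorem succ {f : γ → ℕ} (hf : PolyTime f) : PolyTime fun c => f c + 1 :=
  comp (g := fun p : Unit × ℕ => p.2 + 1) (of_enc_eq fun _ => rfl) ((const ()).prodMk hf)

@[fun_prop]
theorem length {l : γ → List α} (hl : PolyTime l) : PolyTime fun c => (l c).length := by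
  have h : PolyTime fun c => (l c).foldl (fun n _ => n + 1) 0 := by
    obtain ⟨Q, hQ⟩ := hl.exists_size_le
    refine foldl (by fun_prop) hl (by fun_prop) Q fun c l' hl' => ?_
    rw [size_nat]
    simpa using (hl'.length_le.trans (length_le_size _)).trans (hQ c)
  simpa using h

@[fun_prop]
theorem replicate {f : γ → ℕ} (hf : PolyTime f) : PolyTime fun c => List.replicate (f c) () :=
  comp (g := fun n => List.replicate n ()) (of_enc_eq fun _ => rfl) hf

@[fun_prop]
theorem range {f : γ → ℕ} (hf : PolyTime f) : PolyTime fun c => List.range (f c) := by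
  have key : ∀ n, (List.replicate n ()).foldl (fun l _ => l ++ [l.length]) [] = List.range n := by
    intro n
    induction n with
    | zero => rfl
    | succ n ih =>
      rw [List.replicate_succ', List.foldl_append, ih, List.range_succ]
      simp only [List.foldl_cons, List.foldl_nil, List.length_range]
  have h : PolyTime fun c => (List.replicate (f c) ()).foldl (fun l _ => l ++ [l.length]) [] := by
    obtain ⟨Q, hQ⟩ := hf.exists_size_le
    refine foldl (by fun_prop) (by fun_prop) (by fun_prop) (Q * (2 * Q + 1)) fun c l' hl' => ?_
    obtain ⟨n, rfl⟩ : ∃ n, l' = List.replicate n () := ⟨l'.length, List.eq_replicate_of_mem fun _ _ => rfl⟩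
    have hn : n ≤ Q.eval (size c) := by
      have h₁ := hl'.length_le
      have h₂ := hQ c
      rw [size_nat] at h₂
      simp at h₁
      omega
    rw [key]
    refine (size_list_le (B := n) fun a ha => ?_).trans ?_
    · rw [size_nat]; exact (List.mem_range.1 ha).le
    · simp only [List.length_range, Polynomial.eval_mul, Polynomial.eval_add,
        Polynomial.eval_one, Polynomial.eval_ofNat]
      gcongr
  simpa [key] using h

-- A nonempty list and the pair of its head and tail have the same bit string, so this is a second
-- projection after a test for emptiness.
@[fun_prop]
theorem tail {l : γ → List α} (hl : PolyTime l) : PolyTime fun c => (l c).tail := by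
  classical
  refine comp (g := List.tail) ?_ hl
  refine branch (c := fun l : List α => decide (l = [])) (g := fun _ : List α => [])
    (h := fun p : α × List α => p.2) (by fun_prop) (by fun_prop) (by fun_prop) ?_ ?_
  · rintro l hl
    obtain rfl : l = [] := by simpa using hl
    exact ⟨[], rfl, rfl⟩
  · rintro (_ | ⟨a, l⟩) hl
    · simp at hl
    · exact ⟨(a, l), rfl, rfl⟩

@[fun_prop]
theorem drop {l : γ → List α} {f : γ → ℕ} (hf : PolyTime f) (hl : PolyTime l) :
    PolyTime fun c => (l c).drop (f c) := by
  have key : ∀ (l₀ : List Unit) (l : List α), l₀.foldl (fun l _ => l.tail) l = l.drop l₀.length := by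
    intro l₀
    induction l₀ with
    | nil => simp
    | cons a l₀ ih => intro l; rw [List.foldl_cons, ih]; simp
  have h : PolyTime fun c => (List.replicate (f c) ()).foldl (fun l _ => l.tail) (l c) := by
    obtain ⟨Q, hQ⟩ := hl.exists_size_le
    refine foldl hl (by fun_prop) (by fun_prop) Q fun c l' hl' => ?_
    rw [key]
    exact (size_sublist (List.drop_sublist _ _)).trans (hQ c)
  simpa [key] using h

-- Numbers are encoded in unary, so `f c ≤ g c` means that deleting `g c` entries from a list of
-- length `f c` leaves nothing.
@[fun_prop]
theorem decide_le {f g : γ → ℕ} (hf : PolyTime f) (hg : PolyTime g) :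
    PolyTime fun c => decide (f c ≤ g c) := by
  have h : PolyTime fun c => decide ((List.replicate (f c) ()).drop (g c) = []) := by fun_prop
  simpa [Nat.sub_eq_zero_iff_le] using h

@[fun_prop]
theorem pred {f : γ → ℕ} (hf : PolyTime f) : PolyTime fun c => f c - 1 := by
  have h : PolyTime fun c => (List.replicate (f c) ()).tail.length := by fun_prop
  simpa using h

/-- An integer with a given sign and magnitude. -/
def intOfPair (p : Bool × ℕ) : ℤ := bif p.1 then Int.negSucc p.2 else Int.ofNat p.2

/-- The sign and magnitude of an integer. -/
def intToPair : ℤ → Bool × ℕ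
  | Int.ofNat n => (false, n)
  | Int.negSucc n => (true, n)

@[fun_prop]
theorem polyTime_intOfPair {f : γ → Bool × ℕ} (hf : PolyTime f) :
    PolyTime fun c => intOfPair (f c) :=
  comp (g := intOfPair) (of_enc_eq (by rintro ⟨⟨⟩, n⟩ <;> rfl)) hf

@[fun_prop]
theorem polyTime_intToPair {f : γ → ℤ} (hf : PolyTime f) : PolyTime fun c => intToPair (f c) :=
  comp (g := intToPair) (of_enc_eq (by rintro (n | n) <;> rfl)) hf

@[fun_prop]
theorem natCast {f : γ → ℕ} (hf : PolyTime f) : PolyTime fun c => (f c : ℤ) := by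
  have h : PolyTime fun c => intOfPair (false, f c) := by fun_prop
  exact h

@[fun_prop]
theorem int_succ {f : γ → ℤ} (hf : PolyTime f) : PolyTime fun c => f c + 1 := by
  have h : PolyTime fun c => intOfPair (bif (intToPair (f c)).1 then
      bif decide ((intToPair (f c)).2 = 0) then (false, 0) else (true, (intToPair (f c)).2 - 1)
      else (false, (intToPair (f c)).2 + 1)) := by fun_prop
  convert h using 2 with c
  rcases f c with n | (_ | n) <;> simp [intOfPair, intToPair, Int.negSucc_eq]

@[fun_prop]
theorem int_pred {f : γ → ℤ} (hf : PolyTime f) : PolyTime fun c => f c - 1 := by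
  have h : PolyTime fun c => intOfPair (bif (intToPair (f c)).1 then
      (true, (intToPair (f c)).2 + 1) else
      bif decide ((intToPair (f c)).2 = 0) then (true, 0) else (false, (intToPair (f c)).2 - 1)) := by
    fun_prop
  convert h using 2 with c
  rcases f c with (_ | n) | n <;> simp [intOfPair, intToPair, Int.negSucc_eq]
  omega

end PolyTime

/-! ### Reachability in finite graphs -/

/-- The elements of `dom` that can be reached from an element satisfying `start` along `edge`,
without leaving `dom`. -/
def reach {α : Type} (dom : List α) (start : α → Bool) (edge : α → α → Bool) : List α :=
  dom.foldl (fun S _ => dom.filter fun x => start x || S.any fun y => edge y x) []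

section Reach

variable {α : Type} {dom : List α} {start : α → Bool} {edge : α → α → Bool}

theorem mem_reach_iff {x : α} : x ∈ reach dom start edge ↔
    ∃ y ∈ dom, start y = true ∧
      Relation.ReflTransGen (fun a b => a ∈ dom ∧ b ∈ dom ∧ edge a b = true) y x := by
  let F : List α → List α := fun S => dom.filter fun x => start x || S.any fun y => edge y x
  have hF : reach dom start edge = F^[dom.length] [] := List.foldl_const F [] dom
  have hmem : ∀ S x, x ∈ F S ↔ x ∈ dom ∧ (start x = true ∨ ∃ y ∈ S, edge y x = true) := by
    intro S x
    simp [F]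
  have hmono : ∀ S S' : List α, S.Sublist dom → (∀ x ∈ S, x ∈ S') → (F S).Sublist (F S') := by
    intro S S' _ h
    refine List.monotone_filter_right dom fun x hx => ?_
    simp only [Bool.or_eq_true, List.any_eq_true] at hx ⊢
    exact hx.imp id fun ⟨y, hy, hyx⟩ => ⟨y, h y hy, hyx⟩
  have hsub : ∀ k, (F^[k] []).Sublist dom := by
    intro k
    cases k with
    | zero => simp
    | succ k => rw [iterate_succ_apply']; exact List.filter_sublist
  have hchain : ∀ k, (F^[k] []).Sublist (F^[k + 1] []) := by
    intro k
    induction k with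
    | zero => simp
    | succ k ih =>
      rw [iterate_succ_apply' F k, iterate_succ_apply' F (k + 1)]
      exact hmono _ _ (hsub k) fun x hx => ih.subset hx
  -- The iterates form an increasing chain of sublists of `dom`, and each round either stabilises
  -- for good or lengthens the list. Hence as many rounds as `dom` has entries suffice.
  have hfix : F (F^[dom.length] []) = F^[dom.length] [] := by
    have : ∀ k, F (F^[k] []) = F^[k] [] ∨ k ≤ (F^[k] []).length := by
      intro k
      induction k with
      | zero => simp
      | succ k ih =>
        rcases ih with h | h
        · left; rw [iterate_succ_apply', h, h]
        · by_cases he : F^[k] [] = F^[k + 1] []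
          · left
            rw [← he, ← iterate_succ_apply' F, ← he]
          · right
            refine Nat.lt_of_le_of_lt h (lt_of_le_of_ne (hchain k).length_le fun hl => he ?_)
            exact (hchain k).eq_of_length hl
    rcases this dom.length with h | h
    · exact h
    · have h₁ := (hsub dom.length).eq_of_length_le h
      have h₂ := (hchain dom.length).length_le
      rw [← iterate_succ_apply' F]
      rw [h₁] at h₂ ⊢
      exact (hsub _).eq_of_length_le h₂
  constructor
  · rw [hF]
    generalize dom.length = k
    induction k generalizing x with
    | zero => simp
    | succ k ih =>
      intro hx
      rw [iterate_succ_apply', hmem] at hx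
      obtain ⟨hx, hs | ⟨y, hy, hyx⟩⟩ := hx
      · exact ⟨x, hx, hs, .refl⟩
      · obtain ⟨z, hz, hs, h⟩ := ih hy
        exact ⟨z, hz, hs, h.tail ⟨(hsub k).subset hy, hx, hyx⟩⟩
  · rintro ⟨y, hy, hs, h⟩
    rw [hF]
    induction h with
    | refl => rw [← hfix, hmem]; exact ⟨hy, .inl hs⟩
    | tail _ h ih => rw [← hfix, hmem]; exact ⟨h.2.1, .inr ⟨_, ih, h.2.2⟩⟩

theorem reach_sublist : (reach dom start edge).Sublist dom := by
  have hF : reach dom start edge =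
      (fun S => dom.filter fun x => start x || S.any fun y => edge y x)^[dom.length] [] :=
    List.foldl_const _ [] dom
  rw [hF]
  cases dom.length with
  | zero => simp
  | succ k => rw [iterate_succ_apply']; exact List.filter_sublist

end Reach

@[fun_prop]
theorem PolyTime.reach {α γ : Type} [BitEnc α] [BitEnc γ] {dom : γ → List α}
    {start : γ → α → Bool} {edge : γ → α → α → Bool} (hd : PolyTime dom)
    (hs : PolyTime fun p : γ × α => start p.1 p.2)
    (he : PolyTime fun p : (γ × α) × α => edge p.1.1 p.1.2 p.2) :
    PolyTime fun c => reach (dom c) (start c) (edge c) := by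
  obtain ⟨Q, hQ⟩ := hd.exists_size_le
  refine foldl (by fun_prop) hd ?_ Q fun c l' _ => ?_
  · refine PolyTime.filter (by fun_prop) (PolyTime.or ?_ (PolyTime.any (by fun_prop) ?_))
    · exact hs.comp (f := fun q : (γ × List α × α) × α => (q.1.1, q.2)) (by fun_prop)
    · exact he.comp (f := fun q : ((γ × List α × α) × α) × α => ((q.1.1.1, q.2), q.1.2))
        (by fun_prop)
  · refine le_trans (size_sublist ?_) (hQ c)
    rcases List.eq_nil_or_concat l' with rfl | ⟨l, a, rfl⟩
    · simp
    · rw [List.concat_eq_append, List.foldl_append]; exact List.filter_sublist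


open Relation

/-! ### Sliding tokens on a graph -/

namespace Tokens

variable {V : Type} (adj : V → V → Prop)

/-- Connectedness by paths in `W`. -/
def Conn (W : Finset V) : V → V → Prop := ReflTransGen fun a b => a ∈ W ∧ b ∈ W ∧ adj a b

/-- A set of vertices is a union of components of the graph induced on `W`. -/
def Closed (W S : Finset V) : Prop := ∀ a ∈ W, ∀ b ∈ W, adj a b → (a ∈ S ↔ b ∈ S)

theorem Conn.symm {adj : V → V → Prop} {W : Finset V} {a b : V} (hadj : ∀ ⦃a b⦄, adj a b → adj b a) (h : Conn adj W a b) :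
    Conn adj W b a := by
  induction h with
  | refl => exact .refl
  | tail _ h ih => exact ih.head ⟨h.2.1, h.1, hadj h.2.2⟩

theorem Closed.mono {adj : V → V → Prop} {W W' S : Finset V} (h : Closed adj W S) (hW : W' ⊆ W) : Closed adj W' S :=
  fun a ha b hb hab => h a (hW ha) b (hW hb) hab

variable [DecidableEq V]

open Classical in
/-- The connected component of `w` in the graph induced on `W`; it is empty if `w ∉ W`. -/
noncomputable def comp (W : Finset V) (w : V) : Finset V := {x ∈ W | w ∈ W ∧ Conn adj W w x}

/-- One token moves along an edge of the graph induced on `W`. -/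
def SlideStep (W X Y : Finset V) : Prop :=
  ∃ a ∈ X, ∃ b ∈ W, b ∉ X ∧ adj a b ∧ Y = insert b (X.erase a)

/-- Tokens move along edges of the graph induced on `W`. -/
def Slide (W : Finset V) : Finset V → Finset V → Prop := ReflTransGen (SlideStep adj W)

variable {adj}
variable {W W' X Y S T : Finset V} {a b u v w x t : V}

theorem mem_comp : x ∈ comp adj W w ↔ w ∈ W ∧ x ∈ W ∧ Conn adj W w x := by
  simp only [comp, Finset.mem_filter]; tauto

theorem comp_subset : comp adj W w ⊆ W := fun _ h => (mem_comp.1 h).2.1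

theorem mem_comp_self (hw : w ∈ W) : w ∈ comp adj W w := mem_comp.2 ⟨hw, hw, .refl⟩

theorem comp_eq_of_mem (hadj : ∀ ⦃a b⦄, adj a b → adj b a) (h : x ∈ comp adj W w) :
    comp adj W x = comp adj W w := by
  obtain ⟨hw, hx, h⟩ := mem_comp.1 h
  ext y
  rw [mem_comp, mem_comp]
  exact ⟨fun h' => ⟨hw, h'.2.1, h.trans h'.2.2⟩, fun h' => ⟨hx, h'.2.1, (h.symm hadj).trans h'.2.2⟩⟩

theorem disjoint_comp (hadj : ∀ ⦃a b⦄, adj a b → adj b a) (h : x ∉ comp adj W w) :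
    Disjoint (comp adj W x) (comp adj W w) := by
  rw [Finset.disjoint_left]
  intro y hy hy'
  obtain ⟨hx, -, -⟩ := mem_comp.1 hy
  have := comp_eq_of_mem hadj hy
  rw [comp_eq_of_mem hadj hy'] at this
  exact h (this ▸ mem_comp_self hx)

theorem closed_comp (hadj : ∀ ⦃a b⦄, adj a b → adj b a) (w : V) : Closed adj W (comp adj W w) := by
  intro a ha b hb hab
  rw [mem_comp, mem_comp]
  exact ⟨fun h => ⟨h.1, hb, h.2.2.tail ⟨ha, hb, hab⟩⟩,
    fun h => ⟨h.1, ha, h.2.2.tail ⟨hb, ha, hadj hab⟩⟩⟩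

theorem SlideStep.subset (h : SlideStep adj W X Y) (hX : X ⊆ W) : Y ⊆ W := by
  obtain ⟨a, _, b, hb, _, _, rfl⟩ := h
  exact Finset.insert_subset hb ((Finset.erase_subset _ _).trans hX)

/-- Both ends of an edge inside `W` lie on the same side of a closed set, so no token crosses its
boundary. With `S` a component, this is the basic invariant of sliding. -/
theorem SlideStep.card_inter (h : SlideStep adj W X Y) (hX : X ⊆ W) (hS : Closed adj W S) :
    (Y ∩ S).card = (X ∩ S).card := by
  obtain ⟨a, ha, b, hb, hbX, hab, rfl⟩ := h
  have hS := hS a (hX ha) b hb hab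
  by_cases h : b ∈ S
  · rw [Finset.insert_inter_of_mem h, Finset.erase_inter, Finset.card_insert_of_notMem,
      Finset.card_erase_of_mem (by simp [ha, hS.2 h])]
    · have : 0 < (X ∩ S).card := Finset.card_pos.2 ⟨a, by simp [ha, hS.2 h]⟩
      omega
    · simp [hbX]
  · rw [Finset.insert_inter_of_notMem h, Finset.erase_inter, Finset.erase_eq_of_notMem]
    simp [mt hS.1 h]

theorem Slide.subset (h : Slide adj W X Y) (hX : X ⊆ W) : Y ⊆ W := by
  induction h with
  | refl => exact hX
  | tail _ h ih => exact h.subset ih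

theorem Slide.card_inter (h : Slide adj W X Y) (hX : X ⊆ W) (hS : Closed adj W S) :
    (Y ∩ S).card = (X ∩ S).card := by
  induction h with
  | refl => rfl
  | tail h' h ih => rw [h.card_inter (Slide.subset h' hX) hS, ih]

theorem Slide.mono (h : Slide adj W X Y) (hW : W ⊆ W') : Slide adj W' X Y :=
  ReflTransGen.mono (fun _ _ ⟨a, ha, b, hb, h⟩ => ⟨a, ha, b, hW hb, h⟩) _ _ h

/-- A token can be moved to any free vertex of its component, all others staying where they are or
being moved up. -/
theorem slide_of_conn (h : Conn adj W x t) (hx : x ∈ X) (ht : t ∉ X) :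
    Slide adj W X (insert t (X.erase x)) := by
  induction h generalizing X with
  | refl => exact absurd hx ht
  | @tail b c _ hbc ih =>
    obtain ⟨hb, hc, hbc⟩ := hbc
    by_cases hbX : b ∈ X
    -- The path is blocked at `b`: the token there advances to `c`, and the token on `x` then moves
    -- up to `b`. As tokens are indistinguishable, the result is the same as moving `x` to `c`.
    · have h₁ : SlideStep adj W X (insert c (X.erase b)) := ⟨b, hbX, c, hc, ht, hbc, rfl⟩
      by_cases hbx : b = x
      · subst hbx
        exact .single h₁
      · refine .head h₁ ?_
        have h₂ := ih (X := insert c (X.erase b)) (by simp [hx, Ne.symm hbx])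
          (by simp; rintro rfl; exact ht hbX)
        have h₃ : insert b ((insert c (X.erase b)).erase x) = insert c (X.erase x) := by
          have hcx : c ≠ x := by rintro rfl; exact ht hx
          ext y
          simp only [Finset.mem_insert, Finset.mem_erase]
          by_cases hyb : y = b
          · subst hyb; simp [hbx, hbX]
          · by_cases hyc : y = c
            · subst hyc; simp [hcx]
            · simp [hyb, hyc]
        rwa [h₃] at h₂
    · by_cases hcb : c = b
      · subst hcb
        exact ih hx hbX
      · refine ReflTransGen.tail (ih hx hbX) ⟨b, by simp, c, hc, by simp [hcb, ht], hbc, ?_⟩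
        rw [Finset.erase_insert]
        simp [hbX]

/-- Tokens can be moved to cover a set if every component contains enough of them. -/
theorem exists_slide_superset (hX : X ⊆ W) (hT : T ⊆ W)
    (h : ∀ w ∈ W, (T ∩ comp adj W w).card ≤ (X ∩ comp adj W w).card) (hadj : ∀ ⦃a b⦄, adj a b → adj b a) :
    ∃ Y, Slide adj W X Y ∧ T ⊆ Y := by
  induction hn : (T \ X).card generalizing X with
  | zero =>
    refine ⟨X, .refl, ?_⟩
    rwa [Finset.card_eq_zero, Finset.sdiff_eq_empty_iff_subset] at hn
  | succ n ih =>
    obtain ⟨t, ht⟩ : (T \ X).Nonempty := Finset.card_pos.1 (by omega)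
    obtain ⟨htT, htX⟩ := Finset.mem_sdiff.1 ht
    have htW := hT htT
    -- The component of `t` has a surplus token: if all its tokens stood on `T`, the inequality of
    -- counts would force the two sets to coincide there, although `t` is uncovered. Moving the
    -- surplus token to `t` covers one more target and uncovers none.
    obtain ⟨x, hx⟩ : ((X ∩ comp adj W t) \ (T ∩ comp adj W t)).Nonempty := by
      rw [Finset.nonempty_iff_ne_empty, Ne, Finset.sdiff_eq_empty_iff_subset]
      intro hsub
      have := Finset.eq_of_subset_of_card_le hsub (h t htW)
      have ht' : t ∈ T ∩ comp adj W t := by simp [htT, mem_comp_self htW]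
      rw [← this] at ht'
      exact htX (Finset.mem_inter.1 ht').1
    simp only [Finset.mem_sdiff, Finset.mem_inter, not_and] at hx
    obtain ⟨⟨hxX, hxt⟩, hxT⟩ := hx
    have hxT : x ∉ T := fun h => hxT h hxt
    have hs := slide_of_conn ((mem_comp.1 hxt).2.2.symm hadj) hxX htX
    have h₁ : ∀ w ∈ W, (T ∩ comp adj W w).card ≤ (insert t (X.erase x) ∩ comp adj W w).card := by
      intro w hw
      rw [hs.card_inter hX (closed_comp hadj w)]
      exact h w hw
    have h₂ : T \ insert t (X.erase x) = (T \ X).erase t := by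
      ext y
      simp only [Finset.mem_sdiff, Finset.mem_insert, Finset.mem_erase]
      by_cases hyx : y = x
      · subst hyx; simp [hxT]
      · simp [hyx]; tauto
    obtain ⟨Y, hY, hTY⟩ := ih (hs.subset hX) h₁ (by
      rw [h₂, Finset.card_erase_of_mem ht, hn, Nat.add_sub_cancel])
    exact ⟨Y, ReflTransGen.trans hs hY, hTY⟩

/-- The components partition `W`, so the total is the sum of the counts in them. -/
theorem card_eq_of_inter_comp (hX : X ⊆ W) (hY : Y ⊆ W)
    (h : ∀ w ∈ W, (X ∩ comp adj W w).card = (Y ∩ comp adj W w).card) (hadj : ∀ ⦃a b⦄, adj a b → adj b a) :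
    X.card = Y.card := by
  have key : ∀ Z ⊆ W, Z.card = ∑ A ∈ W.image (comp adj W), (Z ∩ A).card := by
    intro Z hZ
    rw [← Finset.card_biUnion]
    · congr 1
      ext z
      simp only [Finset.mem_biUnion, Finset.mem_image, Finset.mem_inter]
      exact ⟨fun hz => ⟨_, ⟨z, hZ hz, rfl⟩, hz, mem_comp_self (hZ hz)⟩,
        fun ⟨_, _, hz, _⟩ => hz⟩
    · rintro _ hA _ hB hAB
      obtain ⟨a, -, rfl⟩ := Finset.mem_image.1 hA
      obtain ⟨b, -, rfl⟩ := Finset.mem_image.1 hB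
      refine Disjoint.mono Finset.inter_subset_right Finset.inter_subset_right
        (disjoint_comp hadj fun hab => hAB (comp_eq_of_mem hadj hab))
  rw [key X hX, key Y hY]
  refine Finset.sum_congr rfl fun A hA => ?_
  obtain ⟨w, hw, rfl⟩ := Finset.mem_image.1 hA
  exact h w hw

/-- Tokens can be moved from one set to another if every component contains equally many vertices
of the two sets. -/
theorem slide_of_card_eq (hadj : ∀ ⦃a b⦄, adj a b → adj b a) (hX : X ⊆ W) (hY : Y ⊆ W)
    (h : ∀ w ∈ W, (X ∩ comp adj W w).card = (Y ∩ comp adj W w).card) : Slide adj W X Y := by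
  -- Tokens are slid until they cover `Y`; since the totals agree, they then cover nothing else.
  obtain ⟨Z, hZ, hYZ⟩ := exists_slide_superset hX hY (fun w hw => (h w hw).ge) hadj
  have h₁ : Y.card = Z.card := card_eq_of_inter_comp hY (hZ.subset hX) (fun w hw => by
    rw [hZ.card_inter hX (closed_comp hadj w), h w hw]) hadj
  rwa [Finset.eq_of_subset_of_card_le hYZ h₁.ge]

/-! ### One distinguished token -/

variable (adj) in
/-- A distinguished token and a set of other tokens: one of them moves along an edge. -/
def Step (G : Finset V) (p q : V × Finset V) : Prop :=
  (∃ Y, SlideStep adj (G.erase p.1) p.2 Y ∧ q = (p.1, Y)) ∨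
    ∃ u ∈ G, u ∉ p.2 ∧ adj p.1 u ∧ q = (u, p.2)

variable (adj) in
/-- Every component of the graph without `v` contains equally many vertices of the two sets. -/
def Same (G : Finset V) (v : V) (X Y : Finset V) : Prop :=
  ∀ w ∈ G.erase v, (X ∩ comp adj (G.erase v) w).card = (Y ∩ comp adj (G.erase v) w).card

variable (adj) in
/-- Positions with the distinguished token about to move from `v` to `u`, where the other tokens
are restricted to given candidate sets. -/
inductive Plan (G : Finset V) (k : V) (X₀ : Finset V) (Ω : V → V → List V → Prop) :
    V → V → List V → Prop
  | start {u : V} {Y : List V} : u ∈ G → adj k u → Ω k u Y → Same adj G k X₀ Y.toFinset →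
      Plan G k X₀ Ω k u Y
  | next {v u u' : V} {Y Y' : List V} : Plan G k X₀ Ω v u Y → u' ∈ G → adj u u' → Ω u u' Y' →
      Same adj G u Y.toFinset Y'.toFinset → Plan G k X₀ Ω u u' Y'

variable {G X₀ : Finset V} {k : V} {Ω : V → V → List V → Prop}

theorem Slide.step (h : Slide adj (G.erase v) X Y) :
    ReflTransGen (Step adj G) (v, X) (v, Y) := by
  induction h with
  | refl => exact .refl
  | tail _ h ih => exact ih.tail (.inl ⟨_, h, rfl⟩)

theorem Step.valid {p q : V × Finset V} (h : Step adj G p q) (hp : p.1 ∈ G)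
    (hp' : p.2 ⊆ G.erase p.1) : q.1 ∈ G ∧ q.2 ⊆ G.erase q.1 := by
  rcases h with ⟨Y, hY, rfl⟩ | ⟨u, hu, hup, _, rfl⟩
  · exact ⟨hp, hY.subset hp'⟩
  · exact ⟨hu, fun x hx => Finset.mem_erase.2 ⟨by rintro rfl; exact hup hx,
      Finset.mem_of_mem_erase (hp' hx)⟩⟩

/-- Each stage of a plan is realised in two phases. While the distinguished token waits on `v`,
equality of counts lets the others slide to `Y`; since `Y` avoids `u`, the distinguished token can
then step there. -/
theorem Plan.reachable (hadj : ∀ ⦃a b⦄, adj a b → adj b a) (hX₀ : X₀ ⊆ G.erase k)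
    (hΩ : ∀ v u Y, Ω v u Y → Y.toFinset ⊆ (G.erase v).erase u) {Y : List V}
    (h : Plan adj G k X₀ Ω v u Y) :
    ReflTransGen (Step adj G) (k, X₀) (u, Y.toFinset) := by
  have key : ∀ {v u : V} {X : Finset V} {Y : List V}, X ⊆ G.erase v → u ∈ G → adj v u → Ω v u Y →
      Same adj G v X Y.toFinset → ReflTransGen (Step adj G) (v, X) (u, Y.toFinset) := by
    intro v u X Y hX hu hvu hY hs
    have hYs := hΩ _ _ _ hY
    refine (slide_of_card_eq hadj hX (hYs.trans (Finset.erase_subset _ _)) hs).step.tail ?_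
    exact .inr ⟨u, hu, fun h => by simpa using hYs h, hvu, rfl⟩
  induction h with
  | start hu hku hY hs => exact key hX₀ hu hku hY hs
  | @next v u u' Y Y' h hu' huu' hY' hs ih =>
    have hY : Y.toFinset ⊆ G.erase u := by
      have : Ω v u Y := by cases h <;> assumption
      exact (hΩ _ _ _ this).trans (Finset.erase_subset_erase _ (Finset.erase_subset _ _))
    exact ih.trans (key hY hu' huu' hY' hs)

/-- If the candidate sets represent all distributions of the tokens over components, every
reachable position is equivalent to the initial one or to one reached by a plan. -/
theorem exists_plan (hadj : ∀ ⦃a b⦄, adj a b → adj b a) (hk : k ∈ G) (hX₀ : X₀ ⊆ G.erase k)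
    (hΩ : ∀ v u Y, Ω v u Y → Y.toFinset ⊆ (G.erase v).erase u)
    (hΩ' : ∀ v ∈ G, ∀ u ∈ G, ∀ X ⊆ (G.erase v).erase u,
      (∀ w ∈ (G.erase v).erase u, (∀ x ∈ comp adj ((G.erase v).erase u) w, ¬ adj v x ∧ ¬ adj u x) →
        (X ∩ comp adj ((G.erase v).erase u) w).card =
          (X₀ ∩ comp adj ((G.erase v).erase u) w).card) →
      ∃ Y, Ω v u Y ∧ ∀ w ∈ (G.erase v).erase u,
        (Y.toFinset ∩ comp adj ((G.erase v).erase u) w).card =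
          (X ∩ comp adj ((G.erase v).erase u) w).card)
    {p : V × Finset V} (h : ReflTransGen (Step adj G) (k, X₀) p) :
    (p.1 = k ∧ Same adj G k X₀ p.2) ∨
      ∃ v Y, Plan adj G k X₀ Ω v p.1 Y ∧ Same adj G p.1 Y.toFinset p.2 := by
  -- The induction also carries the fact that counts of anonymous tokens in unions of components of
  -- `G` never change. It is needed for the components that a step of the distinguished token does
  -- not touch.
  suffices h' : (p.1 ∈ G ∧ p.2 ⊆ G.erase p.1 ∧
      ∀ S ⊆ G, Closed adj G S → (p.2 ∩ S).card = (X₀ ∩ S).card) ∧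
      ((p.1 = k ∧ Same adj G k X₀ p.2) ∨
      ∃ v Y, Plan adj G k X₀ Ω v p.1 Y ∧ Same adj G p.1 Y.toFinset p.2) from h'.2
  induction h with
  | refl => exact ⟨⟨hk, hX₀, fun _ _ _ => rfl⟩, .inl ⟨rfl, fun _ _ => rfl⟩⟩
  | @tail p q _ hpq ih =>
    obtain ⟨⟨hp, hp', hS⟩, ih⟩ := ih
    obtain ⟨v, X⟩ := p
    dsimp only at hp hp' hS ih
    have hq := hpq.valid hp hp'
    refine ⟨⟨hq.1, hq.2, ?_⟩, ?_⟩
    · intro S hSG hSc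
      rcases hpq with ⟨Y, hY, rfl⟩ | ⟨u, hu, hup, _, rfl⟩
      · rw [← hS S hSG hSc]
        exact hY.card_inter hp' (hSc.mono (Finset.erase_subset _ _))
      · exact hS S hSG hSc
    · rcases hpq with ⟨Z, hZ, rfl⟩ | ⟨u, hu, huX, hvu, rfl⟩
      · have hcard := fun w => hZ.card_inter hp' (closed_comp hadj w)
        rcases ih with ⟨rfl, ih⟩ | ⟨v', Y, hY, ih⟩
        · exact .inl ⟨rfl, fun w hw => (ih w hw).trans (hcard w).symm⟩
        · exact .inr ⟨v', Y, hY, fun w hw => (ih w hw).trans (hcard w).symm⟩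
      · right
        dsimp only at huX hvu ⊢
        have hXW : X ⊆ (G.erase v).erase u := fun x hx =>
          Finset.mem_erase.2 ⟨fun h => huX (h ▸ hx), hp' hx⟩
        -- A component of `G \ {v, u}` with no neighbour of `v` or `u` is closed in all of `G`, so
        -- its count is still the one in `X₀`, as `hΩ'` demands.
        obtain ⟨Z, hZ, hZX⟩ := hΩ' v hp u hu X hXW fun w hw hwn => by
          refine hS _ (comp_subset.trans ((Finset.erase_subset _ _).trans
            (Finset.erase_subset _ _))) ?_
          have key : ∀ a ∈ comp adj ((G.erase v).erase u) w, ∀ b ∈ G, adj a b →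
              b ∈ comp adj ((G.erase v).erase u) w := by
            intro a ha b hb hab
            have hbW : b ∈ (G.erase v).erase u := by
              refine Finset.mem_erase.2 ⟨?_, Finset.mem_erase.2 ⟨?_, hb⟩⟩
              · rintro rfl; exact (hwn a ha).2 (hadj hab)
              · rintro rfl; exact (hwn a ha).1 (hadj hab)
            exact (closed_comp hadj w a (comp_subset ha) b hbW hab).1 ha
          exact fun a ha b hb hab => ⟨fun h => key a h b hb hab, fun h => key b h a ha (hadj hab)⟩
        -- `Z` slides to `X` while avoiding both `v` and `u`, so the two are equivalent before the
        -- step (`hZv`) and after it (`hZu`). The first links the new stage to the preceding one,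
        -- the second to the position reached.
        have hslide := slide_of_card_eq hadj (hΩ _ _ _ hZ) hXW hZX
        have hZv : Same adj G v Z.toFinset X := fun w _ =>
          ((hslide.mono (Finset.erase_subset _ _)).card_inter
            ((hΩ _ _ _ hZ).trans (Finset.erase_subset _ _)) (closed_comp hadj w)).symm
        have hsub : (G.erase v).erase u ⊆ G.erase u :=
          Finset.erase_subset_erase _ (Finset.erase_subset _ _)
        have hZu : Same adj G u Z.toFinset X := fun w _ =>
          ((hslide.mono hsub).card_inter ((hΩ _ _ _ hZ).trans hsub) (closed_comp hadj w)).symm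
        rcases ih with ⟨rfl, ih⟩ | ⟨v', Y, hY, ih⟩
        · exact ⟨v, Z, .start hu hvu hZ fun w hw => (ih w hw).trans (hZv w hw).symm, hZu⟩
        · exact ⟨v, Z, .next hY hu hvu hZ fun w hw => (ih w hw).trans (hZv w hw).symm, hZu⟩

end Tokens


open Function Relation

/-! ### Push Fight as a token game -/

namespace PushFight

theorem Adj.symm ⦃p q : Pos⦄ (h : Adj p q) : Adj q p := by
  obtain ⟨d, rfl⟩ := h
  cases d
  · exact ⟨.south, by simp [Dir.step]⟩
  · exact ⟨.north, by simp [Dir.step]⟩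
  · exact ⟨.east, by simp [Dir.step]⟩
  · exact ⟨.west, by simp [Dir.step]⟩

theorem ray_succ (s : Pos) (d : Dir) (i : ℕ) : ray s d (i + 1) = d.step (ray s d i) :=
  iterate_succ_apply' _ _ _

theorem ray_injective (s : Pos) (d : Dir) : Injective (ray s d) := by
  have key : ∀ i : ℕ, ray s d i = match d with
      | .north => (s.1 - i, s.2)
      | .south => (s.1 + i, s.2)
      | .west => (s.1, s.2 - i)
      | .east => (s.1, s.2 + i) := by
    intro i
    induction i with
    | zero => cases d <;> simp [ray]
    | succ i ih => rw [ray_succ, ih]; cases d <;> simp [Dir.step] <;> ring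
  intro i j hij
  rw [key, key] at hij
  cases d <;> simpa using hij

theorem ray_ne {s : Pos} {d : Dir} {i : ℕ} (hi : 1 ≤ i) : ray s d i ≠ s := fun h => by
  have := ray_injective s d (h.trans (show s = ray s d 0 from rfl))
  omega

/-- A move to an adjacent square. -/
def IsSingleMove (B : Set Pos) (c : Color) (P Q : Placement) : Prop :=
  ∃ (s b : Pos) (x : Piece), P s = some x ∧ x.color = c ∧ Adj s b ∧ b ∈ B ∧ P b = none ∧
    Q = update (update P s none) b (some x)

theorem IsSingleMove.isMove {B : Set Pos} {c : Color} {P Q : Placement}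
    (h : IsSingleMove B c P Q) : IsMove B c P Q := by
  obtain ⟨s, b, x, hs, hx, hsb, hb, hPb, rfl⟩ := h
  have : s ≠ b := by rintro rfl; simp [hs] at hPb
  exact ⟨s, x, [b], by simp, hs, hx, by simpa using hsb, by simpa using this, by simp [hb, hPb],
    by simp⟩

/-- The piece walks along its path one square at a time; as the path is simple, the squares ahead
are still empty. -/
theorem IsMove.singleMoves {B : Set Pos} {c : Color} {P Q : Placement} (h : IsMove B c P Q) :
    ReflTransGen (IsSingleMove B c) P Q := by
  obtain ⟨s, x, l, hl, hs, hx, hch, hnd, he, rfl⟩ := h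
  induction l generalizing s P with
  | nil => exact absurd rfl hl
  | cons b l ih =>
    have hsb : s ≠ b := by
      simp only [List.nodup_cons, List.mem_cons, not_or] at hnd
      exact hnd.1.1
    have h₁ : IsSingleMove B c P (update (update P s none) b (some x)) :=
      ⟨s, b, x, hs, hx, (List.isChain_cons_cons.1 hch).1, (he b (by simp)).1, (he b (by simp)).2, rfl⟩
    rcases eq_or_ne l [] with rfl | hl'
    · exact .single h₁
    · refine .head h₁ ?_
      have h₂ := ih b hl' (P := update (update P s none) b (some x)) (by simp)
        (List.isChain_cons_cons.1 hch).2 (List.nodup_cons.1 hnd).2 (fun q hq => ⟨(he q (by simp [hq])).1, by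
          have hqb : q ≠ b := by
            rintro rfl
            exact (List.nodup_cons.1 (List.nodup_cons.1 hnd).2).1 hq
          rw [update_of_ne hqb]
          by_cases hqs : q = s
          · simp [hqs]
          · rw [update_of_ne hqs]; exact (he q (by simp [hq])).2⟩)
      rw [update_idem, update_comm hsb] at h₂
      have h₃ : update P b none = P := by
        rw [← (he b (by simp)).2, update_eq_self]
      rw [update_comm hsb, h₃] at h₂
      rw [List.getLast_cons hl', update_comm hsb]
      exact h₂

/-! ### Placements and the token positions they induce -/

namespace GameState

variable (S : GameState)

/-- The anchor is unique and decides the turn. Consequently no piece of the player to move is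
anchored, and all of them may be pushed. -/
theorem turn_ne_of_anchored {p : Pos} {c : Color}
    (h : S.diagram.pieceAt p = some (Piece.anchoredKing c)) : c ≠ S.turn := by
  unfold turn
  split_ifs with h'
  · obtain ⟨q, hq⟩ := h'
    have := S.anchor_unique _ _ _ _ h hq
    subst this
    rw [h] at hq
    simp only [Option.some.injEq, Piece.anchoredKing.injEq] at hq
    simp [hq]
  · rintro rfl
    exact h' ⟨p, h⟩

theorem mem_board_of_pieceAt {D : Diagram} {p : Pos} {x : Piece} (h : D.pieceAt p = some x) :
    p ∈ D.board := by
  unfold Diagram.pieceAt at h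
  unfold Diagram.board
  cases hp : D.squareAt p with
  | none => simp [hp] at h
  | some sq => simp [hp]

/-- `G` is the set of squares without a piece of the opponent, and `O` the set of squares with a
piece of the player whose turn it is. -/
structure Regions (G O : Finset Pos) : Prop where
  mem_free : ∀ p, p ∈ G ↔
    p ∈ S.diagram.board ∧ ∀ x, S.diagram.pieceAt p = some x → x.color = S.turn
  mem_own : ∀ p, p ∈ O ↔ ∃ x, S.diagram.pieceAt p = some x ∧ x.color = S.turn

/-- The properties of placements that are preserved by moves. -/
structure Normal (G : Finset Pos) (P : Placement) : Prop where
  eq_of_notMem : ∀ p ∉ G, P p = S.diagram.pieceAt p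
  own : ∀ p ∈ G, ∀ x, P p = some x → x.color = S.turn ∧ ∀ c, x ≠ Piece.anchoredKing c

/-- The squares of `G` that hold a piece. -/
def occupied (G : Finset Pos) (P : Placement) : Finset Pos := G.filter fun p => (P p).isSome

theorem mem_occupied {G : Finset Pos} {P : Placement} {p : Pos} :
    p ∈ occupied G P ↔ p ∈ G ∧ ∃ x, P p = some x := by
  simp [occupied, Option.isSome_iff_exists]

variable {S} {G O : Finset Pos} {P Q : Placement}

theorem Regions.normal (h : S.Regions G O) : S.Normal G S.diagram.pieceAt where
  eq_of_notMem _ _ := rfl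
  own p hp x hx := by
    have hc := ((h.mem_free p).1 hp).2 x hx
    refine ⟨hc, ?_⟩
    rintro c rfl
    exact S.turn_ne_of_anchored hx hc

theorem Regions.occupied_eq (h : S.Regions G O) : occupied G S.diagram.pieceAt = O := by
  ext p
  rw [mem_occupied, h.mem_own, h.mem_free]
  constructor
  · rintro ⟨⟨_, hp⟩, x, hx⟩
    exact ⟨x, hx, hp x hx⟩
  · rintro ⟨x, hx, hc⟩
    refine ⟨⟨mem_board_of_pieceAt hx, fun y hy => ?_⟩, x, hx⟩
    rw [hx] at hy
    cases hy
    exact hc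

theorem Normal.mem_of_color (h : S.Regions G O) (hP : S.Normal G P) {p : Pos} {x : Piece}
    (hx : P p = some x) (hc : x.color = S.turn) : p ∈ G := by
  by_contra hp
  have hx' := hx
  rw [hP.eq_of_notMem p hp] at hx'
  refine hp ((h.mem_free p).2 ⟨mem_board_of_pieceAt hx', fun y hy => ?_⟩)
  rw [hx'] at hy
  cases hy
  exact hc

theorem Normal.mem_of_eq_none (h : S.Regions G O) (hP : S.Normal G P) {p : Pos}
    (hp : p ∈ S.diagram.board) (hx : P p = none) : p ∈ G := by
  by_contra hpG
  have hx' := hx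
  rw [hP.eq_of_notMem p hpG] at hx'
  exact hpG ((h.mem_free p).2 ⟨hp, by simp [hx']⟩)

theorem Normal.update (hP : S.Normal G P) {s b : Pos} {x : Piece} (hs : s ∈ G) (hb : b ∈ G)
    (hx : P s = some x) : S.Normal G (update (update P s none) b (some x)) where
  eq_of_notMem p hp := by
    rw [update_of_ne (by rintro rfl; exact hp hb), update_of_ne (by rintro rfl; exact hp hs)]
    exact hP.eq_of_notMem p hp
  own p hp y hy := by
    by_cases hpb : p = b
    · subst hpb
      rw [update_self] at hy
      cases hy
      exact hP.own s hs _ hx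
    · rw [update_of_ne hpb] at hy
      by_cases hps : p = s
      · subst hps
        simp at hy
      · rw [update_of_ne hps] at hy
        exact hP.own p hp y hy

theorem occupied_update {s b : Pos} {x : Piece} (hb : b ∈ G) :
    occupied G (update (update P s none) b (some x)) = insert b ((occupied G P).erase s) := by
  ext p
  rw [Finset.mem_insert, Finset.mem_erase, mem_occupied, mem_occupied]
  by_cases hpb : p = b
  · subst hpb; simp [hb]
  · by_cases hps : p = s
    · subst hps; simp [hpb]
    · simp [hpb, hps]

/-- The king on `s` and the other pieces of its owner come from a king and the other pieces of the
initial placement. -/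
theorem king_reachable (h : S.Regions G O)
    (hP : ReflTransGen (IsSingleMove S.diagram.board S.turn) S.diagram.pieceAt P) :
    S.Normal G P ∧ ∀ s, P s = some (Piece.king S.turn) →
      ∃ k, S.diagram.pieceAt k = some (Piece.king S.turn) ∧
        ReflTransGen (Tokens.Step Adj G) (k, O.erase k) (s, (occupied G P).erase s) := by
  induction hP with
  | refl =>
    refine ⟨h.normal, fun s hs => ⟨s, hs, ?_⟩⟩
    rw [h.occupied_eq]
  | @tail P Q _ hPQ ih =>
    obtain ⟨hP, ih⟩ := ih
    obtain ⟨s, b, x, hs, hx, hsb, hb, hPb, rfl⟩ := hPQ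
    have hsG := hP.mem_of_color h hs hx
    have hbG := hP.mem_of_eq_none h hb hPb
    have hne : s ≠ b := by rintro rfl; simp [hs] at hPb
    have hbO : b ∉ occupied G P := by simp [mem_occupied, hPb]
    refine ⟨hP.update hsG hbG hs, fun s' hs' => ?_⟩
    rw [occupied_update hbG]
    -- If the king considered is the piece that just moved, the distinguished token takes a step and
    -- its origin is that of the king on `s`. Otherwise an anonymous token moves while the
    -- distinguished one stays.
    by_cases hsb' : s' = b
    · subst hsb'
      rw [update_self] at hs'
      cases hs'
      obtain ⟨k, hk, hks⟩ := ih s hs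
      refine ⟨k, hk, hks.tail (.inr ⟨s', hbG, by simp [hbO], hsb, ?_⟩)⟩
      rw [Finset.erase_insert (by simp [hbO])]
    · rw [update_of_ne hsb'] at hs'
      have hss' : s' ≠ s := by rintro rfl; simp at hs'
      rw [update_of_ne hss'] at hs'
      obtain ⟨k, hk, hks⟩ := ih s' hs'
      refine ⟨k, hk, hks.tail (.inl ⟨_, ⟨s, ?_, b, ?_, ?_, hsb, rfl⟩, ?_⟩)⟩
      · exact Finset.mem_erase.2 ⟨hss'.symm, mem_occupied.2 ⟨hsG, x, hs⟩⟩
      · exact Finset.mem_erase.2 ⟨Ne.symm hsb', hbG⟩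
      · simp [hbO]
      · rw [Finset.erase_insert_of_ne (Ne.symm hsb'), Finset.erase_right_comm]

/-- Converse of `king_reachable`: each token step is carried out by whichever piece stands on the
square in question, and its type is forgotten. -/
theorem exists_placement (h : S.Regions G O) {k : Pos}
    (hk : S.diagram.pieceAt k = some (Piece.king S.turn)) {p : Pos × Finset Pos}
    (hp : ReflTransGen (Tokens.Step Adj G) (k, O.erase k) p) :
    ∃ P, ReflTransGen (IsSingleMove S.diagram.board S.turn) S.diagram.pieceAt P ∧
      S.Normal G P ∧ P p.1 = some (Piece.king S.turn) ∧ p.2 = (occupied G P).erase p.1 := by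
  induction hp with
  | refl => exact ⟨_, .refl, h.normal, hk, by rw [h.occupied_eq]⟩
  | @tail p q _ hpq ih =>
    obtain ⟨P, hP, hN, hs, hX⟩ := ih
    obtain ⟨s, X⟩ := p
    dsimp only at hs hX
    have hsG := hN.mem_of_color h hs rfl
    rcases hpq with ⟨Y, ⟨a, ha, b, hb, hbX, hab, rfl⟩, rfl⟩ | ⟨u, hu, huX, hsu, rfl⟩
    · dsimp only at ha hb hbX hab ⊢
      rw [hX, Finset.mem_erase, mem_occupied] at ha
      rw [Finset.mem_erase] at hb
      obtain ⟨has, haG, x, hax⟩ := ha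
      have hPb : P b = none := by
        by_contra hPb
        obtain ⟨y, hy⟩ := Option.ne_none_iff_exists'.1 hPb
        exact hbX (by rw [hX, Finset.mem_erase, mem_occupied]; exact ⟨hb.1, hb.2, y, hy⟩)
      refine ⟨update (update P a none) b (some x), hP.tail ⟨a, b, x, hax, (hN.own a haG x hax).1,
        hab, ((h.mem_free b).1 hb.2).1, hPb, rfl⟩, hN.update haG hb.2 hax, ?_, ?_⟩
      · rw [update_of_ne hb.1.symm, update_of_ne has.symm, hs]
      · rw [occupied_update hb.2, Finset.erase_insert_of_ne hb.1, Finset.erase_right_comm, hX]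
    · dsimp only at huX hsu ⊢
      by_cases hus : u = s
      · subst hus
        exact ⟨P, hP, hN, hs, hX⟩
      have hPu : P u = none := by
        by_contra hPb
        obtain ⟨y, hy⟩ := Option.ne_none_iff_exists'.1 hPb
        exact huX (by rw [hX, Finset.mem_erase, mem_occupied]; exact ⟨hus, hu, y, hy⟩)
      refine ⟨update (update P s none) u (some (Piece.king S.turn)), hP.tail ⟨s, u, _, hs, rfl,
        hsu, ((h.mem_free u).1 hu).1, hPu, rfl⟩, hN.update hsG hu hs, by simp, ?_⟩
      rw [occupied_update hu, Finset.erase_insert (by simp [mem_occupied, hPu]), hX]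

/-- The king on `s` and the other pieces of its owner on the squares `X` allow a winning push. -/
def TokenWin (S : GameState) (G : Finset Pos) (s : Pos) (X : Finset Pos) : Prop :=
  ∃ d m, 1 ≤ m ∧
    (∀ i, 1 ≤ i → i ≤ m → ray s d i ∈ X ∨ ray s d i ∉ G ∧
      ∃ x, S.diagram.pieceAt (ray s d i) = some x ∧ ∀ c, x ≠ Piece.anchoredKing c) ∧
    ray s d (m + 1) ∉ S.diagram.board ∧ ¬ S.diagram.HasRail (ray s d m) d ∧
    ∃ x, S.diagram.pieceAt (ray s d m) = some x ∧ x.color = S.turn.other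

theorem Color.other_ne (c : Color) : c.other ≠ c := by cases c <;> simp [Color.other]

/-- On squares of `G` every piece is an unanchored own piece, and outside `G` the initial placement
persists. So only the identity of the pushing king and the set of occupied squares enter, and the
piece pushed off is an enemy piece in its original place. -/
theorem winsWithPush_iff (h : S.Regions G O) (hP : S.Normal G P) :
    S.WinsWithPush S.turn P ↔ ∃ s, P s = some (Piece.king S.turn) ∧
      S.TokenWin G s ((occupied G P).erase s) := by
  have hocc : ∀ s d i, 1 ≤ i → ((∃ x, P (ray s d i) = some x ∧ ∀ c, x ≠ Piece.anchoredKing c) ↔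
      (ray s d i ∈ (occupied G P).erase s ∨ ray s d i ∉ G ∧
      ∃ x, S.diagram.pieceAt (ray s d i) = some x ∧ ∀ c, x ≠ Piece.anchoredKing c)) := by
    intro s d i hi
    rw [Finset.mem_erase, mem_occupied]
    by_cases hG : ray s d i ∈ G
    · simp only [hG, not_true_eq_false, false_and, or_false, true_and]
      exact ⟨fun ⟨x, hx, _⟩ => ⟨ray_ne hi, x, hx⟩, fun ⟨_, x, hx⟩ => ⟨x, hx, (hP.own _ hG x hx).2⟩⟩
    · simp [hG, hP.eq_of_notMem _ hG]
  have hopp : ∀ p, (∃ x, P p = some x ∧ x.color = S.turn.other) ↔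
      ∃ x, S.diagram.pieceAt p = some x ∧ x.color = S.turn.other := by
    intro p
    by_cases hG : p ∈ G
    · constructor
      · rintro ⟨x, hx, hc⟩
        exact absurd (hc.symm.trans (hP.own p hG x hx).1) (Color.other_ne _)
      · rintro ⟨x, hx, hc⟩
        exact absurd (hc.symm.trans (((h.mem_free p).1 hG).2 x hx)) (Color.other_ne _)
    · rw [hP.eq_of_notMem p hG]
  constructor
  · rintro ⟨s, d, m, ⟨hs, hm, hi, hr⟩, hm', hx⟩
    refine ⟨s, hs, d, m, hm, fun i h₁ h₂ => (hocc s d i h₁).1 (hi i h₁ h₂), hm', ?_,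
      (hopp _).1 hx⟩
    exact (hr.resolve_left fun h => hm' h.1).2
  · rintro ⟨s, hs, d, m, hm, hi, hm', hr, hx⟩
    exact ⟨s, d, m, ⟨hs, hm, fun i h₁ h₂ => (hocc s d i h₁).2 (hi i h₁ h₂), .inr ⟨hm', hr⟩⟩, hm',
      (hopp _).2 hx⟩

theorem reflTransGen_isMove_iff {B : Set Pos} {c : Color} :
    ReflTransGen (IsMove B c) P Q ↔ ReflTransGen (IsSingleMove B c) P Q := by
  constructor
  · intro h
    induction h with
    | refl => exact .refl
    | tail _ h ih => exact ih.trans h.singleMoves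
  · intro h
    induction h with
    | refl => exact .refl
    | tail _ h ih => exact ih.tail h.isMove

theorem unboundedMateInOne_iff (h : S.Regions G O) :
    S.UnboundedMateInOne ↔ ∃ k, S.diagram.pieceAt k = some (Piece.king S.turn) ∧
      ∃ p, ReflTransGen (Tokens.Step Adj G) (k, O.erase k) p ∧ S.TokenWin G p.1 p.2 := by
  constructor
  · rintro ⟨P, hP, hw⟩
    obtain ⟨hN, hk⟩ := king_reachable h (reflTransGen_isMove_iff.1 hP)
    obtain ⟨s, hs, hw⟩ := (winsWithPush_iff h hN).1 hw
    obtain ⟨k, hk, hks⟩ := hk s hs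
    exact ⟨k, hk, _, hks, hw⟩
  · rintro ⟨k, hk, p, hp, hw⟩
    obtain ⟨P, hP, hN, hs, hX⟩ := exists_placement h hk hp
    exact ⟨P, reflTransGen_isMove_iff.2 hP, (winsWithPush_iff h hN).2 ⟨p.1, hs, hX ▸ hw⟩⟩

end GameState

end PushFight


open Function Relation

/-! ### The decision procedure -/

namespace PushFight

/-- The list of the directions. -/
def dirs : List Dir := [.north, .south, .west, .east]

theorem mem_dirs (d : Dir) : d ∈ dirs := by cases d <;> simp [dirs]

/-- Adjacency as a Boolean. -/
def adjb (p q : Pos) : Bool := dirs.any fun d => decide (q = d.step p)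

theorem adjb_iff {p q : Pos} : adjb p q = true ↔ Adj p q := by
  simp [adjb, Adj, mem_dirs]

/-- The connected component of a square. -/
def compList (W : List Pos) (w : Pos) : List Pos := reach W (fun x => decide (x = w)) adjb

/-- The number of elements of `X` in the connected component of a square. -/
def countComp (W : List Pos) (w : Pos) (X : List Pos) : ℕ :=
  ((compList W w).filter fun x => decide (x ∈ X)).length

/-- Whether every component contains equally many elements of the two lists. -/
def sameb (W X Y : List Pos) : Bool := W.all fun w => decide (countComp W w X = countComp W w Y)

/-- Remove a square from a list. -/
def without (W : List Pos) (v : Pos) : List Pos := W.filter fun x => !decide (x = v)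

/-- Replace the squares in the component of `n` by other squares of this component, in one way for
each possible number of them. -/
def redistribute (W : List Pos) (n : Pos) (Ys : List (List Pos)) : List (List Pos) :=
  Ys.flatMap fun Y => (List.range ((compList W n).length + 1)).map fun k =>
    Y.filter (fun x => !decide (x ∈ compList W n)) ++ (compList W n).drop k

/-- Sets of squares that represent all distributions of pieces over the components of `W` that
contain one of the squares in `ns`. -/
def distributions (W X : List Pos) (ns : List Pos) : List (List Pos) :=
  ns.foldr (redistribute W) [X.filter fun x => decide (x ∈ W)]

/-- Sets of squares for the other pieces while the king moves from `v` to `u`. -/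
def candidates (G X : List Pos) (v u : Pos) : List (List Pos) :=
  distributions (without (without G v) u) X
    (dirs.map (fun d => d.step v) ++ dirs.map fun d => d.step u)

/-- The positions, up to equivalence, in which the king that starts on `k` is about to move. -/
def plans (G X : List Pos) (k : Pos) : List (Pos × Pos × List Pos) :=
  reach
    (G.flatMap fun v => ((dirs.map fun d => d.step v).filter fun u => decide (u ∈ G)).flatMap
      fun u => (candidates G X v u).map fun Y => (v, u, Y))
    (fun t => decide (t.1 = k) && sameb (without G k) X t.2.2)
    fun t t' => decide (t'.1 = t.2.1) && sameb (without G t.2.1) t.2.2 t'.2.2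

/-! ### Correctness of the lists of candidates and plans -/

section

variable {W G X Y : List Pos} {k u v w x : Pos}

theorem mem_compList : x ∈ compList W w ↔ x ∈ Tokens.comp Adj W.toFinset w := by
  simp only [compList, mem_reach_iff, Tokens.mem_comp, Tokens.Conn, List.mem_toFinset,
    decide_eq_true_eq, adjb_iff]
  constructor
  · rintro ⟨y, hy, rfl, h⟩
    refine ⟨hy, ?_, h⟩
    rcases ReflTransGen.cases_tail h with rfl | ⟨z, _, hz⟩
    · exact hy
    · exact hz.2.1
  · rintro ⟨hw, _, h⟩
    exact ⟨w, hw, rfl, h⟩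

theorem toFinset_compList : (compList W w).toFinset = Tokens.comp Adj W.toFinset w := by
  ext x; rw [List.mem_toFinset, mem_compList]

theorem nodup_compList (hW : W.Nodup) : (compList W w).Nodup := reach_sublist.nodup hW

theorem countComp_eq (hW : W.Nodup) :
    countComp W w X = (X.toFinset ∩ Tokens.comp Adj W.toFinset w).card := by
  rw [countComp, ← List.toFinset_card_of_nodup ((nodup_compList hW).filter _)]
  congr 1
  ext x
  simp [mem_compList, and_comm]

theorem mem_without : x ∈ without W v ↔ x ∈ W ∧ x ≠ v := by simp [without]

theorem toFinset_without : (without W v).toFinset = W.toFinset.erase v := by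
  ext x; simp [mem_without, and_comm]

theorem nodup_without (hW : W.Nodup) : (without W v).Nodup := hW.filter _

theorem sameb_iff (hW : W.Nodup) : sameb W X Y = true ↔
    ∀ w ∈ W.toFinset, (X.toFinset ∩ Tokens.comp Adj W.toFinset w).card =
      (Y.toFinset ∩ Tokens.comp Adj W.toFinset w).card := by
  simp [sameb, countComp_eq hW]

theorem sameb_without_iff (hG : G.Nodup) : sameb (without G v) X Y = true ↔
    Tokens.Same Adj G.toFinset v X.toFinset Y.toFinset := by
  rw [sameb_iff (nodup_without hG), toFinset_without, Tokens.Same]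

theorem subset_of_mem_distributions {ns : List Pos} (h : Y ∈ distributions W X ns) : Y ⊆ W := by
  induction ns generalizing Y with
  | nil =>
    obtain rfl : Y = X.filter fun x => decide (x ∈ W) := by simpa [distributions] using h
    intro x hx
    simpa using (List.mem_filter.1 hx).2
  | cons n ns ih =>
    change Y ∈ redistribute W n (distributions W X ns) at h
    simp only [redistribute, List.mem_flatMap, List.mem_map] at h
    obtain ⟨Z, hZ, k, _, rfl⟩ := h
    intro x hx
    rcases List.mem_append.1 hx with hx | hx
    · exact ih hZ (List.mem_filter.1 hx).1
    · have := mem_compList.1 (List.mem_of_mem_drop hx)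
      simpa using Tokens.comp_subset this

/-- Each `redistribute` sets the count in the component of one `n` and leaves the other components
alone; if `n ∉ W`, this component is empty and nothing changes. Totals may differ from that of `X`;
such sets do no harm, since the links between plans are checked by `sameb`. -/
theorem exists_distribution (hW : W.Nodup) (ns : List Pos) (Z : Finset Pos) :
    ∃ Y ∈ distributions W X ns, ∀ w ∈ W.toFinset,
      (Y.toFinset ∩ Tokens.comp Adj W.toFinset w).card =
        ((if ∃ n ∈ ns, n ∈ Tokens.comp Adj W.toFinset w then Z else X.toFinset) ∩
          Tokens.comp Adj W.toFinset w).card := by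
  classical
  induction ns with
  | nil =>
    refine ⟨X.filter fun x => decide (x ∈ W), by simp [distributions], fun w _ => ?_⟩
    congr 1
    ext x
    simp only [Finset.mem_inter, List.mem_toFinset, List.mem_filter, decide_eq_true_eq,
      List.not_mem_nil, false_and, exists_false, if_false]
    exact ⟨fun h => ⟨h.1.1, h.2⟩,
      fun h => ⟨⟨h.1, List.mem_toFinset.1 (Tokens.comp_subset h.2)⟩, h.2⟩⟩
  | cons n ns ih =>
    obtain ⟨Y, hY, h⟩ := ih
    have hcard : (compList W n).length = (Tokens.comp Adj W.toFinset n).card := by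
      rw [← toFinset_compList, List.toFinset_card_of_nodup (nodup_compList hW)]
    have hle : (Z ∩ Tokens.comp Adj W.toFinset n).card ≤ (compList W n).length := by
      rw [hcard]; exact Finset.card_le_card Finset.inter_subset_right
    -- Dropping `k` squares of the component leaves as many as `Z` has in it.
    obtain ⟨k, hk⟩ := Nat.exists_eq_add_of_le hle
    refine ⟨Y.filter (fun x => !decide (x ∈ compList W n)) ++ (compList W n).drop k, ?_, ?_⟩
    · change _ ∈ redistribute W n (distributions W X ns)
      simp only [redistribute, List.mem_flatMap, List.mem_map, List.mem_range]
      exact ⟨Y, hY, k, by omega, rfl⟩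
    · intro w hw
      by_cases hn : n ∈ Tokens.comp Adj W.toFinset w
      · rw [if_pos ⟨n, by simp, hn⟩, ← Tokens.comp_eq_of_mem Adj.symm hn]
        have : (Y.filter (fun x => !decide (x ∈ compList W n)) ++
            (compList W n).drop k).toFinset ∩ Tokens.comp Adj W.toFinset n =
            ((compList W n).drop k).toFinset := by
          ext x
          simp only [Finset.mem_inter, List.mem_toFinset, List.mem_append, List.mem_filter,
            Bool.not_eq_true', decide_eq_false_iff_not, ← mem_compList]
          constructor
          · rintro ⟨h | h, h'⟩
            · exact absurd h' h.2
            · exact h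
          · exact fun h => ⟨.inr h, List.mem_of_mem_drop h⟩
        rw [this, List.toFinset_card_of_nodup ((List.drop_sublist _ _).nodup (nodup_compList hW)),
          List.length_drop]
        omega
      · have h₁ : (Y.filter (fun x => !decide (x ∈ compList W n)) ++
            (compList W n).drop k).toFinset ∩ Tokens.comp Adj W.toFinset w =
            Y.toFinset ∩ Tokens.comp Adj W.toFinset w := by
          ext x
          simp only [Finset.mem_inter, List.mem_toFinset, List.mem_append, List.mem_filter,
            Bool.not_eq_true', decide_eq_false_iff_not]
          have hx : x ∈ Tokens.comp Adj W.toFinset w → x ∉ compList W n := by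
            intro hx hx'
            rw [mem_compList] at hx'
            have h₁ := Tokens.comp_eq_of_mem Adj.symm hx
            rw [Tokens.comp_eq_of_mem Adj.symm hx'] at h₁
            exact hn (h₁ ▸ Tokens.mem_comp_self (Tokens.mem_comp.1 hx').1)
          constructor
          · rintro ⟨h | h, h'⟩
            · exact ⟨h.1, h'⟩
            · exact absurd (List.mem_of_mem_drop h) (hx h')
          · exact fun h => ⟨.inl ⟨h.1, hx h.2⟩, h.2⟩
        have h₂ : (∃ n' ∈ n :: ns, n' ∈ Tokens.comp Adj W.toFinset w) ↔
            ∃ n' ∈ ns, n' ∈ Tokens.comp Adj W.toFinset w := by simp [hn]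
        rw [h₁, h w hw]
        simp only [h₂]

theorem toFinset_subset_of_mem_candidates (h : Y ∈ candidates G X v u) :
    Y.toFinset ⊆ (G.toFinset.erase v).erase u := by
  rw [← toFinset_without, ← toFinset_without]
  intro x hx
  rw [List.mem_toFinset] at hx ⊢
  exact subset_of_mem_distributions h hx

/-- The neighbours of `v` and `u` meet every component that touches one of them, so exactly the
components with possibly changed counts are redistributed. -/
theorem exists_candidate (hG : G.Nodup) {Z : Finset Pos}
    (hZ : ∀ w ∈ (G.toFinset.erase v).erase u,
      (∀ x ∈ Tokens.comp Adj ((G.toFinset.erase v).erase u) w, ¬ Adj v x ∧ ¬ Adj u x) →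
        (Z ∩ Tokens.comp Adj ((G.toFinset.erase v).erase u) w).card =
          (X.toFinset ∩ Tokens.comp Adj ((G.toFinset.erase v).erase u) w).card) :
    ∃ Y ∈ candidates G X v u, ∀ w ∈ (G.toFinset.erase v).erase u,
      (Y.toFinset ∩ Tokens.comp Adj ((G.toFinset.erase v).erase u) w).card =
        (Z ∩ Tokens.comp Adj ((G.toFinset.erase v).erase u) w).card := by
  obtain ⟨Y, hY, h⟩ := exists_distribution (W := without (without G v) u) (X := X)
    (nodup_without (nodup_without hG))
    (dirs.map (fun d => d.step v) ++ dirs.map fun d => d.step u) Z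
  rw [toFinset_without, toFinset_without] at h
  refine ⟨Y, hY, fun w hw => ?_⟩
  rw [h w hw]
  split_ifs with hn
  · rfl
  · refine (hZ w hw fun x hx => ⟨?_, ?_⟩).symm
    · rintro ⟨d, rfl⟩
      exact hn ⟨_, by simp [mem_dirs], hx⟩
    · rintro ⟨d, rfl⟩
      exact hn ⟨_, List.mem_append_right _ (List.mem_map_of_mem (mem_dirs d)), hx⟩

theorem mem_plans (hG : G.Nodup) (hk : k ∈ G) : (v, u, Y) ∈ plans G X k ↔
    Tokens.Plan Adj G.toFinset k X.toFinset (fun v u Y => Y ∈ candidates G X v u) v u Y := by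
  have hdom : ∀ {v u Y}, (v, u, Y) ∈ (G.flatMap fun v =>
      ((dirs.map fun d => d.step v).filter fun u => decide (u ∈ G)).flatMap
      fun u => (candidates G X v u).map fun Y => (v, u, Y)) ↔
      v ∈ G ∧ u ∈ G ∧ Adj v u ∧ Y ∈ candidates G X v u := by
    intro v u Y
    simp only [List.mem_flatMap, List.mem_filter, List.mem_map, decide_eq_true_eq, Prod.mk.injEq]
    constructor
    · rintro ⟨v', hv, u', ⟨⟨d, -, rfl⟩, hu⟩, Y', hY, rfl, rfl, rfl⟩
      exact ⟨hv, hu, ⟨d, rfl⟩, hY⟩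
    · rintro ⟨hv, hu, ⟨d, rfl⟩, hY⟩
      exact ⟨v, hv, _, ⟨⟨d, mem_dirs d, rfl⟩, hu⟩, Y, hY, rfl, rfl, rfl⟩
  rw [plans, mem_reach_iff]
  constructor
  · rintro ⟨⟨v₀, u₀, Y₀⟩, h₀, hs, h⟩
    simp only [Bool.and_eq_true, decide_eq_true_eq, sameb_without_iff hG] at hs
    obtain ⟨rfl, hs⟩ := hs
    obtain ⟨hv, hu, hvu, hY⟩ := hdom.1 h₀
    suffices h' : ∀ t, ReflTransGen _ (v₀, u₀, Y₀) t → Tokens.Plan Adj G.toFinset v₀ X.toFinset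
        (fun v u Y => Y ∈ candidates G X v u) t.1 t.2.1 t.2.2 from h' _ h
    intro t ht
    induction ht with
    | refl => exact .start (List.mem_toFinset.2 hu) hvu hY hs
    | @tail t t' _ htt' ih =>
      obtain ⟨-, ht', htt'⟩ := htt'
      obtain ⟨v, u, Y⟩ := t
      obtain ⟨v', u', Y'⟩ := t'
      simp only [Bool.and_eq_true, decide_eq_true_eq, sameb_without_iff hG] at htt'
      obtain ⟨rfl, hs⟩ := htt'
      obtain ⟨hv, hu, hvu, hY⟩ := hdom.1 ht'
      exact .next ih (List.mem_toFinset.2 hu) hvu hY hs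
  · intro h
    suffices h' : (v ∈ G ∧ u ∈ G ∧ Adj v u ∧ Y ∈ candidates G X v u) ∧ _ from h'.2
    induction h with
    | @start u Y hu hku hY hs =>
      have h₀ : k ∈ G ∧ u ∈ G ∧ Adj k u ∧ Y ∈ candidates G X k u :=
        ⟨hk, List.mem_toFinset.1 hu, hku, hY⟩
      exact ⟨h₀, _, hdom.2 h₀, by simp [(sameb_without_iff hG).2 hs], .refl⟩
    | @next v u u' Y Y' _ hu' huu' hY' hs ih =>
      obtain ⟨h₀, y, hy, hys, h⟩ := ih
      have h₁ : u ∈ G ∧ u' ∈ G ∧ Adj u u' ∧ Y' ∈ candidates G X u u' :=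
        ⟨h₀.2.1, List.mem_toFinset.1 hu', huu', hY'⟩
      exact ⟨h₁, y, hy, hys, h.tail ⟨hdom.2 h₀, hdom.2 h₁, by
        simp [(sameb_without_iff hG).2 hs]⟩⟩

end

end PushFight


open Function Relation

namespace PushFight

/-! ### Reading a drawing -/

/-- Whether a symbol ends a row. -/
def Symbol.isEnd : Symbol → Bool
  | entry _ => false
  | endRow => true

/-- The square that a symbol denotes, if any. -/
def Symbol.squares : Symbol → List Square
  | entry (some sq) => [sq]
  | _ => []

/-- The state while reading a drawing: whether the last symbol ended a row, the position of the next
symbol, and the squares found so far. -/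
abbrev ParseState : Type := Bool × (ℕ × ℕ) × List (Pos × Square)

/-- Read one symbol. -/
def parseStep (s : ParseState) (a : Symbol) : ParseState :=
  (a.isEnd, (bif a.isEnd then (s.2.1.1 + 1, 0) else (s.2.1.1, s.2.1.2 + 1)),
    (a.squares.map fun sq => (((s.2.1.1 : ℤ), (s.2.1.2 : ℤ)), sq)) ++ s.2.2)

/-- Read a word. -/
def parse (w : List Symbol) : ParseState := w.foldl parseStep (false, (0, 0), [])

/-- A list contains the squares of a diagram, each exactly once. -/
structure IsCells (D : Diagram) (C : List (Pos × Square)) : Prop where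
  nodup : (C.map Prod.fst).Nodup
  mem_iff : ∀ p sq, (p, sq) ∈ C ↔ D.squareAt p = some sq

theorem squareAt_eq_some {D : Diagram} {p : Pos} {sq : Square} : D.squareAt p = some sq ↔
    ∃ (i j : ℕ) (row : List (Option Square)), D[i]? = some row ∧ row[j]? = some (some sq) ∧
      p = ((i : ℤ), (j : ℤ)) := by
  unfold Diagram.squareAt
  constructor
  · intro h
    split_ifs at h with hp
    cases hr : D[p.1.toNat]? with
    | none => simp [hr] at h
    | some row =>
      refine ⟨p.1.toNat, p.2.toNat, row, hr, ?_, ?_⟩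
      · cases hs : row[p.2.toNat]? with
        | none => simp [hr, hs] at h
        | some e => simpa [hr, hs] using h
      · ext <;> simp [hp.1, hp.2]
  · rintro ⟨i, j, row, hi, hj, rfl⟩
    simp [hi, hj]

theorem parse_row (row : List (Option Square)) (f : Bool) (r c : ℕ) (acc : List (Pos × Square)) :
    ∃ f' C, (row.map Symbol.entry).foldl parseStep (f, (r, c), acc) = (f', (r, c + row.length), C) ∧
      ∀ p sq, (p, sq) ∈ C ↔ (p, sq) ∈ acc ∨
        ∃ j : ℕ, row[j]? = some (some sq) ∧ p = ((r : ℤ), ((c + j : ℕ) : ℤ)) := by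
  induction row generalizing f c acc with
  | nil => exact ⟨f, acc, rfl, by simp⟩
  | cons e row ih =>
    obtain ⟨f', C, h, hC⟩ := ih false (c + 1)
      (((Symbol.entry e).squares.map fun sq => (((r : ℤ), (c : ℤ)), sq)) ++ acc)
    refine ⟨f', C, ?_, fun p sq => ?_⟩
    · rw [List.length_cons, Nat.add_comm row.length 1, ← Nat.add_assoc]
      exact h
    · rw [hC, List.mem_append]
      constructor
      · rintro ((h | h) | ⟨j, h, hp⟩)
        · right
          refine ⟨0, ?_⟩
          cases e with
          | none => simp [Symbol.squares] at h
          | some sq' =>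
            simp only [Symbol.squares, List.map_cons, List.map_nil, List.mem_singleton,
              Prod.mk.injEq] at h
            simp [h.1, h.2]
        · exact .inl h
        · exact .inr ⟨j + 1, by simpa using h, by rw [hp]; congr 2; omega⟩
      · rintro (h | ⟨j, h, hp⟩)
        · exact .inl (.inr h)
        · cases j with
          | zero =>
            left; left
            simp only [List.getElem?_cons_zero, Option.some.injEq] at h
            subst h
            simp [Symbol.squares, hp]
          | succ j => exact .inr ⟨j, by simpa using h, by rw [hp]; congr 2; omega⟩

theorem parse_encode (D : Diagram) (f : Bool) (r : ℕ) (acc : List (Pos × Square)) (p : Pos)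
    (sq : Square) : (p, sq) ∈ ((Diagram.encode D).foldl parseStep (f, (r, 0), acc)).2.2 ↔ (p, sq) ∈ acc ∨
      ∃ (i j : ℕ) (row : List (Option Square)), D[i]? = some row ∧ row[j]? = some (some sq) ∧
        p = (((r + i : ℕ) : ℤ), (j : ℤ)) := by
  induction D generalizing f r acc with
  | nil => simp [Diagram.encode]
  | cons row D ih =>
    obtain ⟨f', C, h, hC⟩ := parse_row row f r 0 acc
    have he : Diagram.encode (row :: D) = row.map Symbol.entry ++ Symbol.endRow :: Diagram.encode D := by
      simp [Diagram.encode]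
    rw [he, List.foldl_append, h, List.foldl_cons]
    change (p, sq) ∈ ((Diagram.encode D).foldl parseStep (true, (r + 1, 0), C)).2.2 ↔ _
    rw [ih, hC]
    constructor
    · rintro ((h | ⟨j, h, hp⟩) | ⟨i, j, row', hi, hj, hp⟩)
      · exact .inl h
      · exact .inr ⟨0, j, row, by simp, h, by simpa using hp⟩
      · exact .inr ⟨i + 1, j, row', by simpa using hi, hj, by rw [hp]; congr 2; omega⟩
    · rintro (h | ⟨i, j, row', hi, hj, hp⟩)
      · exact .inl (.inl h)
      · cases i with
        | zero =>
          simp only [List.getElem?_cons_zero, Option.some.injEq] at hi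
          subst hi
          exact .inl (.inr ⟨j, hj, by simpa using hp⟩)
        | succ i => exact .inr ⟨i, j, row', by simpa using hi, hj, by rw [hp]; congr 2; omega⟩

theorem parse_append (w : List Symbol) (a : Symbol) : parse (w ++ [a]) = parseStep (parse w) a := by
  simp [parse]

/-- The squares found precede the current reading position in lexicographic order; a new square at
that position is therefore not a repetition. -/
theorem parse_nodup (w : List Symbol) : ((parse w).2.2.map Prod.fst).Nodup ∧
    ∀ e ∈ (parse w).2.2, e.1.1 < (parse w).2.1.1 ∨
      e.1.1 = (parse w).2.1.1 ∧ e.1.2 < (parse w).2.1.2 := by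
  induction w using List.reverseRecOn with
  | nil => simp [parse]
  | append_singleton w a ih =>
    rw [parse_append]
    obtain ⟨h₁, h₂⟩ := ih
    rcases a with (_ | sq) | _
    · refine ⟨h₁, fun e he => ?_⟩
      have := h₂ e he
      simp only [parseStep, Symbol.isEnd, cond_false]
      omega
    · refine ⟨?_, fun e he => ?_⟩
      · refine List.nodup_cons.2 ⟨fun h => ?_, h₁⟩
        obtain ⟨e, he, hp⟩ := List.mem_map.1 h
        have := h₂ e he
        rw [hp] at this
        simp at this
      · simp only [parseStep, Symbol.isEnd, cond_false, Symbol.squares, List.map_cons, List.map_nil,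
          List.singleton_append, List.mem_cons] at he ⊢
        rcases he with rfl | he
        · right; simp
        · have := h₂ e he
          omega
    · refine ⟨h₁, fun e he => ?_⟩
      have := h₂ e he
      simp only [parseStep, Symbol.isEnd, cond_true]
      omega

theorem isCells_parse (D : Diagram) : IsCells D (parse D.encode).2.2 where
  nodup := (parse_nodup _).1
  mem_iff p sq := by
    rw [squareAt_eq_some, parse, parse_encode]
    simp

theorem exists_encode (w : List Symbol) : ∃ (D : Diagram) (row : List (Option Square)),
    w = D.encode ++ row.map Symbol.entry := by
  induction w using List.reverseRecOn with
  | nil => exact ⟨[], [], rfl⟩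
  | append_singleton w a ih =>
    obtain ⟨D, row, rfl⟩ := ih
    cases a with
    | entry e => exact ⟨D, row ++ [e], by simp⟩
    | endRow => exact ⟨D ++ [row], [], by simp [Diagram.encode]⟩

/-- Every word is a drawing followed by an unfinished row (`exists_encode`), and the flag reports
that a row mark came last. Excluding the empty drawing loses nothing, as its board is empty and
hence no polyomino. -/
theorem parse_fst_iff (w : List Symbol) :
    (parse w).1 = true ↔ ∃ D : Diagram, D ≠ [] ∧ D.encode = w := by
  constructor
  · intro h
    rcases List.eq_nil_or_concat w with rfl | ⟨w, a, rfl⟩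
    · simp [parse] at h
    · rw [List.concat_eq_append] at h ⊢
      rw [parse_append] at h
      cases a with
      | entry e => simp [parseStep, Symbol.isEnd] at h
      | endRow =>
        obtain ⟨D, row, rfl⟩ := exists_encode w
        exact ⟨D ++ [row], by simp, by simp [Diagram.encode]⟩
  · rintro ⟨D, hD, rfl⟩
    obtain ⟨D, row, rfl⟩ : ∃ D' row, D = D' ++ [row] := by
      rcases List.eq_nil_or_concat D with rfl | ⟨D, row, rfl⟩
      · exact absurd rfl hD
      · exact ⟨D, row, List.concat_eq_append⟩
    have : Diagram.encode (D ++ [row]) =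
        (Diagram.encode D ++ row.map Symbol.entry) ++ [Symbol.endRow] := by simp [Diagram.encode]
    rw [this, parse_append]
    rfl

/-! ### Deciding a position -/

/-- Whether the piece on a square is an anchored king. -/
def Square.isAnchored (sq : Square) : Bool :=
  match sq.piece with
  | some (.anchoredKing _) => true
  | _ => false

/-- Whether a square has a piece, and this is not an anchored king. -/
def Square.isMovable (sq : Square) : Bool :=
  match sq.piece with
  | some x => decide (∀ c, x ≠ .anchoredKing c)
  | none => false

/-- Whether a square has a piece of the given player. -/
def Square.isOwn (c : Color) (sq : Square) : Bool :=
  match sq.piece with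
  | some x => decide (x.color = c)
  | none => false

/-- Whether a square has no piece of the opponent of the given player. -/
def Square.isFree (c : Color) (sq : Square) : Bool :=
  match sq.piece with
  | some x => decide (x.color = c)
  | none => true

/-- Whether a square has an unanchored king of the given player. -/
def Square.isKing (c : Color) (sq : Square) : Bool := decide (sq.piece = some (.king c))

/-- Whether a list of squares describes a game state. -/
def validb (C : List (Pos × Square)) : Bool :=
  !decide (C = []) &&
  (C.all fun e => C.all fun e' => decide (e'.1 ∈ compList (C.map Prod.fst) e.1)) &&
  (C.all fun e => dirs.all fun d => !e.2.rail d || !decide (d.step e.1 ∈ C.map Prod.fst)) &&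
  C.all fun e => C.all fun e' => !(e.2.isAnchored && e'.2.isAnchored) || decide (e.1 = e'.1)

/-- The player whose turn it is. -/
def turnb (C : List (Pos × Square)) : Color :=
  bif C.any fun e => decide (e.2.piece = some (.anchoredKing .white)) then .black else .white

/-- The positions of the squares with a given property. -/
def select (C : List (Pos × Square)) (p : Square → Bool) : List Pos :=
  (C.filter fun e => p e.2).map Prod.fst

/-- Whether the king on `s` can win with a push after the other pieces of its owner, initially on
the squares `Y`, are rearranged. -/
def winb (C : List (Pos × Square)) (t : Color) (G : List Pos) (s : Pos) (Y : List Pos) : Bool :=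
  dirs.any fun d => (List.range C.length).any fun m =>
    ((List.range (m + 1)).all fun i => decide (ray s d (i + 1) ∈ G) ||
      C.any fun e => decide (e.1 = ray s d (i + 1)) && e.2.isMovable) &&
    !decide (ray s d (m + 2) ∈ C.map Prod.fst) &&
    (C.any fun e => decide (e.1 = ray s d (m + 1)) && (!e.2.rail d && e.2.isOwn t.other)) &&
    (without G s).all fun w => decide (countComp (without G s) w
      ((List.range (m + 1)).map fun i => ray s d (i + 1)) ≤ countComp (without G s) w Y)

/-- Whether player `t` can win starting with the king on `k`. -/
def kingb (C : List (Pos × Square)) (t : Color) (k : Pos) : Bool :=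
  ((k, without (select C (Square.isOwn t)) k) ::
    (plans (select C (Square.isFree t)) (without (select C (Square.isOwn t)) k) k).map
      fun x => x.2).any fun x => winb C t (select C (Square.isFree t)) x.1 x.2

/-- The decision procedure. -/
def mateb (w : List Symbol) : Bool :=
  (parse w).1 && validb (parse w).2.2 &&
    (select (parse w).2.2 (Square.isKing (turnb (parse w).2.2))).any fun k =>
      kingb (parse w).2.2 (turnb (parse w).2.2) k

theorem mem_select (C : List (Pos × Square)) (q : Square → Bool) (p : Pos) :
    p ∈ select C q ↔ ∃ sq, (p, sq) ∈ C ∧ q sq = true := by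
  simp [select]

namespace IsCells

variable {D : Diagram} {C : List (Pos × Square)}

theorem mem_squares (h : IsCells D C) (p : Pos) : p ∈ C.map Prod.fst ↔ p ∈ D.board := by
  simp only [List.mem_map, Prod.exists, exists_and_right, exists_eq_right, h.mem_iff]
  exact Option.isSome_iff_exists.symm

theorem pieceAt_eq_some (h : IsCells D C) (p : Pos) (x : Piece) :
    D.pieceAt p = some x ↔ ∃ sq, (p, sq) ∈ C ∧ sq.piece = some x := by
  simp only [Diagram.pieceAt, Option.bind_eq_some_iff, h.mem_iff]

theorem nodup_select (h : IsCells D C) (q : Square → Bool) : (select C q).Nodup :=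
  h.nodup.sublist (List.filter_sublist.map _)

theorem eq_of_mem (h : IsCells D C) {p : Pos} {sq sq' : Square} (h₁ : (p, sq) ∈ C) (h₂ : (p, sq') ∈ C) : sq = sq' := by
  rw [h.mem_iff] at h₁ h₂
  exact Option.some.inj (h₁.symm.trans h₂)

theorem validb_iff (h : IsCells D C) : validb C = true ↔ IsPolyomino D.board ∧
    (∀ p d, D.HasRail p d → d.step p ∉ D.board) ∧
    ∀ p q c c', D.pieceAt p = some (Piece.anchoredKing c) →
      D.pieceAt q = some (Piece.anchoredKing c') → p = q := by
  have hanch : ∀ p, (∃ sq, (p, sq) ∈ C ∧ sq.isAnchored = true) ↔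
      ∃ c, D.pieceAt p = some (Piece.anchoredKing c) := by
    intro p
    simp only [h.pieceAt_eq_some]
    constructor
    · rintro ⟨sq, hsq, ha⟩
      unfold Square.isAnchored at ha
      split at ha
      · exact ⟨_, sq, hsq, by assumption⟩
      · simp at ha
    · rintro ⟨c, sq, hsq, ha⟩
      exact ⟨sq, hsq, by simp [Square.isAnchored, ha]⟩
  simp only [validb, Bool.and_eq_true, List.all_eq_true, Bool.not_eq_true', decide_eq_false_iff_not,
    Bool.or_eq_true, decide_eq_true_eq]
  rw [and_assoc, and_assoc, ← and_assoc]
  refine and_congr (and_congr ?_ ?_) (and_congr ?_ ?_)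
  · constructor
    · intro hC
      obtain ⟨e, he⟩ := List.exists_mem_of_ne_nil _ hC
      exact ⟨e.1, (h.mem_squares _).1 (List.mem_map_of_mem he)⟩
    · rintro ⟨p, hp⟩
      obtain ⟨e, he, -⟩ := List.mem_map.1 ((h.mem_squares p).2 hp)
      exact List.ne_nil_of_mem he
  · have hconn : ∀ p q, p ∈ D.board → q ∈ D.board → (q ∈ compList (C.map Prod.fst) p ↔
        ReflTransGen (fun a b => a ∈ D.board ∧ b ∈ D.board ∧ Adj a b) p q) := by
      intro p q hp hq
      rw [mem_compList, Tokens.mem_comp, Tokens.Conn]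
      simp only [List.mem_toFinset, h.mem_squares]
      tauto
    constructor
    · intro hC p hp q hq
      obtain ⟨e, he, rfl⟩ := List.mem_map.1 ((h.mem_squares p).2 hp)
      obtain ⟨e', he', rfl⟩ := List.mem_map.1 ((h.mem_squares q).2 hq)
      exact (hconn _ _ hp hq).1 (hC e he e' he')
    · intro hB e he e' he'
      have h₁ := (h.mem_squares _).1 (List.mem_map_of_mem he)
      have h₂ := (h.mem_squares _).1 (List.mem_map_of_mem he')
      exact (hconn _ _ h₁ h₂).2 (hB _ h₁ _ h₂)
  · constructor
    · rintro hC p d ⟨sq, hsq, hr⟩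
      have := hC (p, sq) ((h.mem_iff _ _).2 hsq) d (mem_dirs d)
      rw [h.mem_squares] at this
      simpa [hr] using this
    · rintro hD ⟨p, sq⟩ he d -
      rw [h.mem_squares]
      by_cases hr : sq.rail d = true
      · exact .inr (hD p d ⟨sq, (h.mem_iff _ _).1 he, hr⟩)
      · exact .inl (by simpa using hr)
  · constructor
    · intro hC p q c c' hp hq
      obtain ⟨sq, hsq, ha⟩ := (hanch p).2 ⟨c, hp⟩
      obtain ⟨sq', hsq', ha'⟩ := (hanch q).2 ⟨c', hq⟩
      simpa [ha, ha'] using hC _ hsq _ hsq'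
    · rintro hD ⟨p, sq⟩ hsq ⟨q, sq'⟩ hsq'
      by_cases ha : sq.isAnchored = true
      · by_cases ha' : sq'.isAnchored = true
        · obtain ⟨c, hc⟩ := (hanch p).1 ⟨sq, hsq, ha⟩
          obtain ⟨c', hc'⟩ := (hanch q).1 ⟨sq', hsq', ha'⟩
          exact .inr (hD p q c c' hc hc')
        · simp [ha']
      · simp [ha]

end IsCells

/-! ### Correctness of the tests on a list of squares -/

section

variable {S : GameState} {C : List (Pos × Square)}

theorem turnb_eq (h : IsCells S.diagram C) : turnb C = S.turn := by
  have : (C.any fun e => decide (e.2.piece = some (.anchoredKing .white))) = true ↔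
      ∃ p, S.diagram.pieceAt p = some (Piece.anchoredKing Color.white) := by
    simp [h.pieceAt_eq_some]
  unfold turnb GameState.turn
  split_ifs with h'
  · rw [this.2 h']; rfl
  · rw [Bool.eq_false_iff.2 (mt this.1 h')]; rfl

theorem regions (h : IsCells S.diagram C) :
    S.Regions (select C (Square.isFree S.turn)).toFinset (select C (Square.isOwn S.turn)).toFinset where
  mem_free p := by
    rw [List.mem_toFinset, mem_select, ← h.mem_squares]
    simp only [h.pieceAt_eq_some]
    constructor
    · rintro ⟨sq, hsq, hf⟩
      refine ⟨List.mem_map_of_mem hsq, ?_⟩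
      rintro x ⟨sq', hsq', hx⟩
      obtain rfl := h.eq_of_mem hsq hsq'
      simpa [Square.isFree, hx] using hf
    · rintro ⟨hp, hx⟩
      obtain ⟨⟨p, sq⟩, hsq, rfl⟩ := List.mem_map.1 hp
      refine ⟨sq, hsq, ?_⟩
      unfold Square.isFree
      split
      · exact decide_eq_true (hx _ ⟨sq, hsq, by assumption⟩)
      · rfl
  mem_own p := by
    rw [List.mem_toFinset, mem_select]
    simp only [h.pieceAt_eq_some]
    constructor
    · rintro ⟨sq, hsq, hf⟩
      unfold Square.isOwn at hf
      split at hf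
      · exact ⟨_, ⟨sq, hsq, by assumption⟩, of_decide_eq_true hf⟩
      · simp at hf
    · rintro ⟨x, ⟨sq, hsq, hx⟩, hc⟩
      exact ⟨sq, hsq, by simp [Square.isOwn, hx, hc]⟩

/-- The squares of `G` on the ray have to be covered by tokens, which is possible exactly when no
component of `G \ {s}` needs more tokens than it contains. Enemy squares on the ray lie in no
component and need nothing. Thus one test settles all rearrangements of `Y`. -/
theorem winb_iff (h : IsCells S.diagram C) {s : Pos} {Y : List Pos}
    (hY : Y.toFinset ⊆ (select C (Square.isFree S.turn)).toFinset.erase s) :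
    winb C S.turn (select C (Square.isFree S.turn)) s Y = true ↔
      ∃ Z, Tokens.Slide Adj ((select C (Square.isFree S.turn)).toFinset.erase s) Y.toFinset Z ∧
        S.TokenWin (select C (Square.isFree S.turn)).toFinset s Z := by
  have hr := regions h
  set G := select C (Square.isFree S.turn) with hG
  have hGn : G.Nodup := h.nodup_select _
  have hmov : ∀ p, (C.any fun e => decide (e.1 = p) && e.2.isMovable) = true ↔
      ∃ x, S.diagram.pieceAt p = some x ∧ ∀ c, x ≠ Piece.anchoredKing c := by
    intro p
    simp only [List.any_eq_true, Bool.and_eq_true, decide_eq_true_eq, h.pieceAt_eq_some]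
    constructor
    · rintro ⟨⟨p, sq⟩, hsq, rfl, hm⟩
      unfold Square.isMovable at hm
      split at hm
      · exact ⟨_, ⟨sq, hsq, by assumption⟩, of_decide_eq_true hm⟩
      · simp at hm
    · rintro ⟨x, ⟨sq, hsq, hx⟩, hc⟩
      exact ⟨(p, sq), hsq, rfl, by simp [Square.isMovable, hx, hc]⟩
  have hopp : ∀ p d, (C.any fun e => decide (e.1 = p) &&
      (!e.2.rail d && e.2.isOwn S.turn.other)) = true ↔
      ¬ S.diagram.HasRail p d ∧ ∃ x, S.diagram.pieceAt p = some x ∧ x.color = S.turn.other := by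
    intro p d
    simp only [List.any_eq_true, Bool.and_eq_true, decide_eq_true_eq, h.pieceAt_eq_some,
      Diagram.HasRail, ← h.mem_iff, Bool.not_eq_true']
    constructor
    · rintro ⟨⟨p, sq⟩, hsq, rfl, hd, hm⟩
      refine ⟨?_, ?_⟩
      · rintro ⟨sq', hsq', hd'⟩
        obtain rfl := h.eq_of_mem hsq hsq'
        exact Bool.false_ne_true (hd.symm.trans hd')
      · unfold Square.isOwn at hm
        split at hm
        · exact ⟨_, ⟨sq, hsq, by assumption⟩, of_decide_eq_true hm⟩
        · simp at hm
    · rintro ⟨hd, x, ⟨sq, hsq, hx⟩, hc⟩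
      refine ⟨(p, sq), hsq, rfl, ?_, by simp [Square.isOwn, hx, hc]⟩
      by_contra hd'
      exact hd ⟨sq, hsq, by simpa using hd'⟩
  have hcount : ∀ w X, countComp (without G s) w X =
      (X.toFinset ∩ Tokens.comp Adj (G.toFinset.erase s) w).card := by
    intro w X
    rw [countComp_eq (nodup_without hGn), toFinset_without]
  have hwin : winb C S.turn G s Y = true ↔ ∃ d, ∃ m < C.length,
      (∀ i < m + 1, ray s d (i + 1) ∈ G ∨
        ∃ x, S.diagram.pieceAt (ray s d (i + 1)) = some x ∧ ∀ c, x ≠ Piece.anchoredKing c) ∧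
      ray s d (m + 2) ∉ S.diagram.board ∧
      (¬ S.diagram.HasRail (ray s d (m + 1)) d ∧
        ∃ x, S.diagram.pieceAt (ray s d (m + 1)) = some x ∧ x.color = S.turn.other) ∧
      ∀ w ∈ G.toFinset.erase s,
        (((List.range (m + 1)).map fun i => ray s d (i + 1)).toFinset ∩
          Tokens.comp Adj (G.toFinset.erase s) w).card ≤
          (Y.toFinset ∩ Tokens.comp Adj (G.toFinset.erase s) w).card := by
    simp only [winb, List.any_eq_true (l := dirs), mem_dirs, true_and,
      List.any_eq_true (l := List.range _), List.mem_range, Bool.and_eq_true, List.all_eq_true,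
      Bool.or_eq_true, decide_eq_true_eq, hmov, hopp, hcount, Bool.not_eq_true',
      decide_eq_false_iff_not, h.mem_squares, and_assoc, ← toFinset_without, List.mem_toFinset]
  rw [hwin]
  constructor
  · rintro ⟨d, m, -, hi, hb, ⟨hrail, hx⟩, hc⟩
    obtain ⟨Z, hZ, hTZ⟩ := Tokens.exists_slide_superset
      (T := ((List.range (m + 1)).map fun i => ray s d (i + 1)).toFinset ∩ G.toFinset.erase s)
      hY Finset.inter_subset_right (fun w hw => by
        rw [Finset.inter_assoc, Finset.inter_eq_right.2 Tokens.comp_subset]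
        exact hc w hw) Adj.symm
    refine ⟨Z, hZ, d, m + 1, by omega, fun i h₁ h₂ => ?_, hb, hrail, hx⟩
    obtain ⟨i, rfl⟩ := Nat.exists_eq_add_of_le' h₁
    by_cases hiG : ray s d (i + 1) ∈ G
    · left
      refine hTZ (Finset.mem_inter.2 ⟨?_, Finset.mem_erase.2 ⟨ray_ne h₁, by simpa using hiG⟩⟩)
      rw [List.mem_toFinset, List.mem_map]
      exact ⟨i, List.mem_range.2 (by omega), rfl⟩
    · exact .inr ⟨by simpa using hiG, (hi i (by omega)).resolve_left hiG⟩
  · rintro ⟨Z, hZ, d, m, hm, hi, hb, hrail, hx⟩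
    obtain ⟨m, rfl⟩ := Nat.exists_eq_add_of_le' hm
    have hZG := hZ.subset hY
    have hGD : ∀ p ∈ Z, p ∈ G := fun p hp => by simpa using Finset.mem_of_mem_erase (hZG hp)
    refine ⟨d, m, ?_, fun i h₁ => ?_, hb, ⟨hrail, hx⟩, fun w hw => ?_⟩
    -- The pushed pieces stand on distinct squares of the board, so their number `m + 1` is at most
    -- `C.length`.
    · have hsub : ((Finset.range (m + 1)).image fun i => ray s d (i + 1)) ⊆
          (C.map Prod.fst).toFinset := by
        intro p hp
        obtain ⟨i, hi', rfl⟩ := Finset.mem_image.1 hp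
        rw [List.mem_toFinset, h.mem_squares]
        rcases hi (i + 1) (by omega) (by simpa using hi') with h₁ | ⟨_, x, hx, _⟩
        · exact ((hr.mem_free _).1 (by simpa using hGD _ h₁)).1
        · exact GameState.mem_board_of_pieceAt hx
      have hcard := Finset.card_le_card hsub
      rw [Finset.card_image_of_injective _ fun i j hij => by
        have := ray_injective s d hij
        omega, Finset.card_range] at hcard
      have := (C.map Prod.fst).toFinset_card_le
      rw [List.length_map] at this
      omega
    · exact (hi (i + 1) (by omega) (by omega)).imp (hGD _) And.right
    · rw [← hZ.card_inter hY (Tokens.closed_comp Adj.symm w)]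
      refine Finset.card_le_card fun p hp => ?_
      obtain ⟨hp, hpw⟩ := Finset.mem_inter.1 hp
      refine Finset.mem_inter.2 ⟨?_, hpw⟩
      rw [List.mem_toFinset, List.mem_map] at hp
      obtain ⟨i, hi', rfl⟩ := hp
      rw [List.mem_range] at hi'
      refine (hi (i + 1) (by omega) (by omega)).resolve_right fun h => h.1 ?_
      exact Finset.mem_of_mem_erase (Tokens.comp_subset hpw)

/-- As `winb` accounts for all later sliding, one representative per equivalence class suffices: the
initial position for classes in which the king is back on `k` or never left it with the initial
counts, and the plans for the others. -/
theorem kingb_iff (h : IsCells S.diagram C) {k : Pos}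
    (hk : S.diagram.pieceAt k = some (Piece.king S.turn)) :
    kingb C S.turn k = true ↔ ∃ p, ReflTransGen
      (Tokens.Step Adj (select C (Square.isFree S.turn)).toFinset)
      (k, (select C (Square.isOwn S.turn)).toFinset.erase k) p ∧
      S.TokenWin (select C (Square.isFree S.turn)).toFinset p.1 p.2 := by
  have hr := regions h
  have hwin := fun s Y => winb_iff (s := s) (Y := Y) h
  unfold kingb
  set G := select C (Square.isFree S.turn) with hG
  set O := select C (Square.isOwn S.turn) with hO
  have hGn : G.Nodup := h.nodup_select _
  have hkG' : k ∈ G.toFinset := hr.normal.mem_of_color hr hk rfl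
  have hkG : k ∈ G := List.mem_toFinset.1 hkG'
  have hOG : O.toFinset ⊆ G.toFinset := fun p hp => by
    rw [← hr.occupied_eq] at hp
    exact (GameState.mem_occupied.1 hp).1
  have hX₀ : (without O k).toFinset ⊆ G.toFinset.erase k := by
    rw [toFinset_without]; exact Finset.erase_subset_erase _ hOG
  have hΩ : ∀ v u Y, Y ∈ candidates G (without O k) v u →
      Y.toFinset ⊆ (G.toFinset.erase v).erase u := fun _ _ _ => toFinset_subset_of_mem_candidates
  rw [← toFinset_without, List.any_eq_true]
  constructor
  · rintro ⟨⟨s, Y⟩, hmem, hw⟩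
    have key : Y.toFinset ⊆ G.toFinset.erase s ∧
        ReflTransGen (Tokens.Step Adj G.toFinset) (k, (without O k).toFinset) (s, Y.toFinset) := by
      rcases List.mem_cons.1 hmem with he | hmem
      · obtain ⟨rfl, rfl⟩ := Prod.mk.inj he
        exact ⟨hX₀, .refl⟩
      · obtain ⟨⟨v, u, Y'⟩, hp, he⟩ := List.mem_map.1 hmem
        obtain ⟨rfl, rfl⟩ := Prod.mk.inj he
        have hp := (mem_plans hGn hkG).1 hp
        refine ⟨?_, hp.reachable Adj.symm hX₀ hΩ⟩
        have : Y' ∈ candidates G (without O k) v u := by cases hp <;> assumption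
        exact (hΩ _ _ _ this).trans (Finset.erase_subset_erase _ (Finset.erase_subset _ _))
    obtain ⟨Z, hZ, hw⟩ := (hwin s Y key.1).1 hw
    exact ⟨_, key.2.trans hZ.step, hw⟩
  · rintro ⟨p, hp, hw⟩
    have hvalid : p.1 ∈ G.toFinset ∧ p.2 ⊆ G.toFinset.erase p.1 := by
      clear hw
      induction hp with
      | refl => exact ⟨hkG', hX₀⟩
      | tail _ h ih => exact h.valid ih.1 ih.2
    have key : ∀ Y : List Pos, Y.toFinset ⊆ G.toFinset.erase p.1 →
        Tokens.Same Adj G.toFinset p.1 Y.toFinset p.2 → winb C S.turn G p.1 Y = true :=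
      fun Y hY hs => (hwin p.1 Y hY).2
        ⟨p.2, Tokens.slide_of_card_eq Adj.symm hY hvalid.2 hs, hw⟩
    rcases Tokens.exists_plan Adj.symm hkG' hX₀ hΩ (fun v _ u _ X _ hX =>
      exists_candidate hGn hX) hp with ⟨hpk, hs⟩ | ⟨v, Y, hY, hs⟩
    · refine ⟨_, List.mem_cons_self, ?_⟩
      rw [← hpk] at hs hX₀ ⊢
      exact key _ hX₀ hs
    · refine ⟨(p.1, Y), List.mem_cons_of_mem _ (List.mem_map.2
        ⟨(v, p.1, Y), (mem_plans hGn hkG).2 hY, rfl⟩), key _ ?_ hs⟩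
      have : Y ∈ candidates G (without O k) v p.1 := by cases hY <;> assumption
      exact (hΩ _ _ _ this).trans (Finset.erase_subset_erase _ (Finset.erase_subset _ _))

theorem any_kingb_iff (h : IsCells S.diagram C) :
    ((select C (Square.isKing (turnb C))).any fun k => kingb C (turnb C) k) = true ↔
      S.UnboundedMateInOne := by
  rw [GameState.unboundedMateInOne_iff (regions h), turnb_eq h, List.any_eq_true]
  refine exists_congr fun k => ?_
  have hk : k ∈ select C (Square.isKing S.turn) ↔
      S.diagram.pieceAt k = some (Piece.king S.turn) := by
    simp [mem_select, h.pieceAt_eq_some, Square.isKing]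
  rw [hk]
  exact and_congr_right fun hk => kingb_iff h hk

end

theorem mateb_iff (w : List Symbol) : mateb w = true ↔ w ∈ unboundedMoveMateInOne := by
  simp only [mateb, Bool.and_eq_true]
  constructor
  · rintro ⟨⟨h₁, h₂⟩, h₃⟩
    obtain ⟨D, -, rfl⟩ := (parse_fst_iff w).1 h₁
    obtain ⟨hp, hr, ha⟩ := (isCells_parse D).validb_iff.1 h₂
    exact ⟨⟨D, hp, hr, ha⟩, rfl, (any_kingb_iff (S := ⟨D, hp, hr, ha⟩) (isCells_parse D)).1 h₃⟩
  · rintro ⟨S, rfl, hS⟩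
    have hC := isCells_parse S.diagram
    refine ⟨⟨(parse_fst_iff _).2 ⟨S.diagram, ?_, rfl⟩,
      hC.validb_iff.2 ⟨S.polyomino, S.rail_boundary, S.anchor_unique⟩⟩, (any_kingb_iff hC).2 hS⟩
    intro hD
    obtain ⟨p, hp⟩ := S.polyomino.1
    simp [Diagram.board, Diagram.squareAt, hD] at hp

end PushFight


open Function

open BitEnc

/-! ### The decision procedure takes polynomial time -/

@[fun_prop]
theorem PolyTime.decide_mem {α γ : Type} [BitEnc α] [BitEnc γ] [BEq α] [LawfulBEq α]
    {f : γ → α} {l : γ → List α} (hf : PolyTime f) (hl : PolyTime l) :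
    PolyTime fun c => decide (f c ∈ l c) := by
  classical
  have h : PolyTime fun c => (l c).any fun a => decide (f c = a) := by fun_prop
  convert h using 2 with c
  rw [Bool.eq_iff_iff]
  simp

theorem BitEnc.exists_size_le (α : Type) [BitEnc α] [Finite α] : ∃ B, ∀ a : α, size a ≤ B := by
  obtain ⟨B, hB⟩ := (Set.finite_range (size : α → ℕ)).bddAbove
  exact ⟨B, fun a => hB ⟨a, rfl⟩⟩

namespace PushFight

noncomputable instance : BitEnc Color := .ofFinite Color

noncomputable instance : BitEnc Dir := .ofFinite Dir

noncomputable instance : BitEnc Square := .ofFinite Square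

noncomputable instance : BitEnc Symbol := .ofFinite Symbol

section

variable {γ : Type} [BitEnc γ]

@[fun_prop]
theorem polyTime_rail {sq : γ → Square} {d : γ → Dir} (hs : PolyTime sq) (hd : PolyTime d) :
    PolyTime fun c => (sq c).rail (d c) :=
  (PolyTime.of_finite fun x : Square × Dir => x.1.rail x.2).comp (hs.prodMk hd)

@[fun_prop]
theorem polyTime_isOwn {sq : γ → Square} {t : γ → Color} (hs : PolyTime sq) (ht : PolyTime t) :
    PolyTime fun c => (sq c).isOwn (t c) :=
  (PolyTime.of_finite fun x : Square × Color => x.1.isOwn x.2).comp (hs.prodMk ht)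

@[fun_prop]
theorem polyTime_isFree {sq : γ → Square} {t : γ → Color} (hs : PolyTime sq) (ht : PolyTime t) :
    PolyTime fun c => (sq c).isFree (t c) :=
  (PolyTime.of_finite fun x : Square × Color => x.1.isFree x.2).comp (hs.prodMk ht)

@[fun_prop]
theorem polyTime_isKing {sq : γ → Square} {t : γ → Color} (hs : PolyTime sq) (ht : PolyTime t) :
    PolyTime fun c => (sq c).isKing (t c) :=
  (PolyTime.of_finite fun x : Square × Color => x.1.isKing x.2).comp (hs.prodMk ht)

@[fun_prop]
theorem polyTime_isMovable {sq : γ → Square} (hs : PolyTime sq) :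
    PolyTime fun c => (sq c).isMovable :=
  (PolyTime.of_finite Square.isMovable).comp hs

@[fun_prop]
theorem polyTime_isAnchored {sq : γ → Square} (hs : PolyTime sq) :
    PolyTime fun c => (sq c).isAnchored :=
  (PolyTime.of_finite Square.isAnchored).comp hs

@[fun_prop]
theorem polyTime_isEnd {a : γ → Symbol} (ha : PolyTime a) : PolyTime fun c => (a c).isEnd :=
  (PolyTime.of_finite Symbol.isEnd).comp ha

@[fun_prop]
theorem polyTime_squares {a : γ → Symbol} (ha : PolyTime a) : PolyTime fun c => (a c).squares :=
  (PolyTime.of_finite Symbol.squares).comp ha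

@[fun_prop]
theorem polyTime_other {t : γ → Color} (ht : PolyTime t) : PolyTime fun c => (t c).other :=
  (PolyTime.of_finite Color.other).comp ht

@[fun_prop]
theorem polyTime_dirStep {d : γ → Dir} {p : γ → Pos} (hd : PolyTime d) (hp : PolyTime p) :
    PolyTime fun c => (d c).step (p c) := by
  have h : PolyTime fun c => bif decide (d c = .north) then ((p c).1 - 1, (p c).2) else
      bif decide (d c = .south) then ((p c).1 + 1, (p c).2) else
      bif decide (d c = .west) then ((p c).1, (p c).2 - 1) else ((p c).1, (p c).2 + 1) := by
    fun_prop
  convert h using 2 with c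
  cases d c <;> rfl

theorem size_int_add_one_le (z : ℤ) : size (z + 1) ≤ size z + 1 := by
  rcases z with n | (_ | n)
  · change size (false, n + 1) ≤ size (false, n) + 1
    simp [size_prod, size_nat]
    omega
  · change size (false, 0) ≤ size (true, 0) + 1
    simp [size_prod, size_nat, size_bool]
  · change size (true, n) ≤ size (true, n + 1) + 1
    simp [size_prod, size_nat]
    omega

theorem size_int_sub_one_le (z : ℤ) : size (z - 1) ≤ size z + 1 := by
  rcases z with (_ | n) | n
  · change size (true, 0) ≤ size (false, 0) + 1
    simp [size_prod, size_nat, size_bool]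
  · have : Int.ofNat (n + 1) - 1 = Int.ofNat n := by simp
    rw [this]
    change size (false, n) ≤ size (false, n + 1) + 1
    simp [size_prod, size_nat]
    omega
  · change size (true, n + 1) ≤ size (true, n) + 1
    simp [size_prod, size_nat]
    omega

/-- The `2` comes from the first coordinate, which the encoding of pairs doubles. Linear growth
keeps the positions on a ray of polynomial size. -/
theorem size_dirStep_le (d : Dir) (p : Pos) : size (d.step p) ≤ size p + 2 := by
  obtain ⟨a, b⟩ := p
  have := size_int_add_one_le a
  have := size_int_add_one_le b
  have := size_int_sub_one_le a
  have := size_int_sub_one_le b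
  cases d <;> simp only [Dir.step, size_prod] <;> omega

@[fun_prop]
theorem polyTime_ray {s : γ → Pos} {d : γ → Dir} {i : γ → ℕ} (hs : PolyTime s) (hd : PolyTime d)
    (hi : PolyTime i) : PolyTime fun c => ray (s c) (d c) (i c) := by
  have key : ∀ (l : List Unit) (d : Dir) (s : Pos),
      l.foldl (fun p _ => d.step p) s = ray s d l.length := by
    intro l d
    induction l with
    | nil => intro s; rfl
    | cons a l ih => intro s; rw [List.foldl_cons, ih]; rfl
  have hsize : ∀ (l : List Unit) (d : Dir) (s : Pos),
      size (l.foldl (fun p _ => d.step p) s) ≤ size s + 2 * l.length := by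
    intro l d
    induction l with
    | nil => intro s; simp
    | cons a l ih =>
      intro s
      have h₁ := ih (d.step s)
      have h₂ := size_dirStep_le d s
      rw [List.foldl_cons, List.length_cons]
      omega
  obtain ⟨Q, hQ⟩ := hs.exists_size_le
  obtain ⟨R, hR⟩ := hi.exists_size_le
  have h : PolyTime fun c => (List.replicate (i c) ()).foldl (fun p _ => (d c).step p) (s c) := by
    refine PolyTime.foldl (f := fun c p _ => (d c).step p) hs (by fun_prop) (by fun_prop)
      (Q + 2 * R) fun c l' hl' => (hsize _ _ _).trans ?_
    have h₁ := hQ c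
    have h₂ := hR c
    have h₃ := hl'.length_le
    rw [size_nat] at h₂
    simp at h₃ ⊢
    omega
  simpa [key] using h

@[fun_prop]
theorem polyTime_adjb {p q : γ → Pos} (hp : PolyTime p) (hq : PolyTime q) :
    PolyTime fun c => adjb (p c) (q c) := by
  unfold adjb
  fun_prop

@[fun_prop]
theorem polyTime_compList {W : γ → List Pos} {w : γ → Pos} (hW : PolyTime W) (hw : PolyTime w) :
    PolyTime fun c => compList (W c) (w c) := by
  unfold compList
  fun_prop

@[fun_prop]
theorem polyTime_countComp {W X : γ → List Pos} {w : γ → Pos} (hW : PolyTime W) (hw : PolyTime w)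
    (hX : PolyTime X) : PolyTime fun c => countComp (W c) (w c) (X c) := by
  unfold countComp
  fun_prop

@[fun_prop]
theorem polyTime_sameb {W X Y : γ → List Pos} (hW : PolyTime W) (hX : PolyTime X)
    (hY : PolyTime Y) : PolyTime fun c => sameb (W c) (X c) (Y c) := by
  unfold sameb
  fun_prop

@[fun_prop]
theorem polyTime_without {W : γ → List Pos} {v : γ → Pos} (hW : PolyTime W) (hv : PolyTime v) :
    PolyTime fun c => without (W c) (v c) := by
  unfold without
  fun_prop

@[fun_prop]
theorem polyTime_redistribute {W : γ → List Pos} {n : γ → Pos} {Ys : γ → List (List Pos)}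
    (hW : PolyTime W) (hn : PolyTime n) (hY : PolyTime Ys) :
    PolyTime fun c => redistribute (W c) (n c) (Ys c) := by
  unfold redistribute
  fun_prop

-- The list of neighbours has the fixed length eight, so `distributions` unfolds to eight nested
-- calls of `redistribute`. With a list of unbounded length the number of candidates could grow
-- exponentially.
@[fun_prop]
theorem polyTime_candidates {G X : γ → List Pos} {v u : γ → Pos} (hG : PolyTime G)
    (hX : PolyTime X) (hv : PolyTime v) (hu : PolyTime u) :
    PolyTime fun c => candidates (G c) (X c) (v c) (u c) := by
  simp only [candidates, distributions, dirs, List.map_cons, List.map_nil, List.cons_append,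
    List.nil_append, List.foldr_cons, List.foldr_nil]
  fun_prop

@[fun_prop]
theorem polyTime_plans {G X : γ → List Pos} {k : γ → Pos} (hG : PolyTime G) (hX : PolyTime X)
    (hk : PolyTime k) : PolyTime fun c => plans (G c) (X c) (k c) := by
  unfold plans
  fun_prop

@[fun_prop]
theorem polyTime_validb {C : γ → List (Pos × Square)} (hC : PolyTime C) :
    PolyTime fun c => validb (C c) := by
  unfold validb
  fun_prop

@[fun_prop]
theorem polyTime_turnb {C : γ → List (Pos × Square)} (hC : PolyTime C) :
    PolyTime fun c => turnb (C c) := by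
  have h : PolyTime fun sq : Square => decide (sq.piece = some (.anchoredKing .white)) :=
    PolyTime.of_finite _
  unfold turnb
  refine PolyTime.cond (PolyTime.any hC ?_) (by fun_prop) (by fun_prop)
  exact h.comp (f := fun q : γ × Pos × Square => q.2.2) (by fun_prop)

@[fun_prop]
theorem polyTime_select {C : γ → List (Pos × Square)} {p : γ → Square → Bool} (hC : PolyTime C)
    (hp : PolyTime fun q : γ × Square => p q.1 q.2) : PolyTime fun c => select (C c) (p c) := by
  have : PolyTime fun q : γ × Pos × Square => p q.1 q.2.2 :=
    hp.comp (f := fun q : γ × Pos × Square => (q.1, q.2.2)) (by fun_prop)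
  unfold select
  fun_prop

@[fun_prop]
theorem polyTime_winb {C : γ → List (Pos × Square)} {t : γ → Color} {G Y : γ → List Pos}
    {s : γ → Pos} (hC : PolyTime C) (ht : PolyTime t) (hG : PolyTime G) (hs : PolyTime s)
    (hY : PolyTime Y) : PolyTime fun c => winb (C c) (t c) (G c) (s c) (Y c) := by
  unfold winb
  fun_prop

@[fun_prop]
theorem polyTime_kingb {C : γ → List (Pos × Square)} {t : γ → Color} {k : γ → Pos}
    (hC : PolyTime C) (ht : PolyTime t) (hk : PolyTime k) :
    PolyTime fun c => kingb (C c) (t c) (k c) := by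
  unfold kingb
  fun_prop

end

@[fun_prop]
theorem polyTime_parseStep : PolyTime fun p : ParseState × Symbol => parseStep p.1 p.2 := by
  unfold parseStep
  fun_prop

theorem size_natCast (n : ℕ) : size (n : ℤ) = n + 3 := by
  change size (false, n) = _
  rw [size_prod, size_bool, size_nat]
  omega

theorem parse_bounds (w : List Symbol) : (parse w).2.1.1 ≤ w.length ∧
    (parse w).2.1.2 ≤ w.length ∧ (parse w).2.2.length ≤ w.length ∧
    ∀ e ∈ (parse w).2.2, ∃ i j : ℕ, e.1 = ((i : ℤ), (j : ℤ)) ∧ i ≤ w.length ∧ j ≤ w.length := by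
  induction w using List.reverseRecOn with
  | nil => simp [parse]
  | append_singleton w a ih =>
    obtain ⟨h₁, h₂, h₃, h₄⟩ := ih
    rw [parse_append, List.length_append, List.length_singleton]
    have h₅ : ∀ e ∈ (parse w).2.2, ∃ i j : ℕ, e.1 = ((i : ℤ), (j : ℤ)) ∧
        i ≤ w.length + 1 ∧ j ≤ w.length + 1 := fun e he => by
      obtain ⟨i, j, h, hi, hj⟩ := h₄ e he
      exact ⟨i, j, h, by omega, by omega⟩
    rcases a with (_ | sq) | _
    · exact ⟨Nat.le_succ_of_le h₁, Nat.succ_le_succ h₂, Nat.le_succ_of_le h₃, h₅⟩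
    · refine ⟨Nat.le_succ_of_le h₁, Nat.succ_le_succ h₂, Nat.succ_le_succ h₃, fun e he => ?_⟩
      rcases List.mem_cons.1 he with rfl | he
      · exact ⟨_, _, rfl, Nat.le_succ_of_le h₁, Nat.le_succ_of_le h₂⟩
      · exact h₅ e he
    · exact ⟨Nat.succ_le_succ h₁, Nat.zero_le _, Nat.le_succ_of_le h₃, h₅⟩

@[fun_prop]
theorem polyTime_parse {γ : Type} [BitEnc γ] {w : γ → List Symbol} (hw : PolyTime w) :
    PolyTime fun c => parse (w c) := by
  obtain ⟨Q, hQ⟩ := hw.exists_size_le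
  obtain ⟨B, hB⟩ := BitEnc.exists_size_le Square
  refine PolyTime.foldl (s₀ := fun _ => ((false, (0, 0), []) : ParseState))
    (f := fun _ => parseStep) (by fun_prop) hw ?_
    (10 * Q + 10 + Q * (2 * (10 * Q + Polynomial.C B + 30) + 1)) fun c l' hl' => ?_
  · exact polyTime_parseStep.comp (f := fun p : γ × ParseState × Symbol => p.2) (by fun_prop)
  -- The intermediate state after the prefix `l'` is `parse l'` itself, so bounds on coordinates and
  -- on the number of squares found suffice.
  · change size (parse l') ≤ _
    have hn : l'.length ≤ Q.eval (size c) :=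
      hl'.length_le.trans ((length_le_size _).trans (hQ c))
    obtain ⟨h₁, h₂, h₃, h₄⟩ := parse_bounds l'
    have h₅ := size_list_le (l := (parse l').2.2) (B := 10 * Q.eval (size c) + B + 30) fun e he => by
      obtain ⟨i, j, h, hi, hj⟩ := h₄ e he
      have := hB e.2
      rw [← Prod.mk.eta (p := e), size_prod, h, size_prod, size_natCast, size_natCast]
      omega
    have h₆ := Nat.mul_le_mul_right (2 * (10 * Q.eval (size c) + B + 30) + 1) (h₃.trans hn)
    have h₇ : size (parse l') = 2 * size (parse l').1 + 1 +
        (2 * (2 * size (parse l').2.1.1 + 1 + size (parse l').2.1.2) + 1 +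
          size (parse l').2.2) := by
      rw [← size_prod, ← size_prod, ← size_prod]
    rw [h₇, size_bool, size_nat, size_nat]
    simp only [Polynomial.eval_add, Polynomial.eval_mul, Polynomial.eval_ofNat,
      Polynomial.eval_one, Polynomial.eval_C]
    omega

theorem polyTime_mateb {γ : Type} [BitEnc γ] {w : γ → List Symbol} (hw : PolyTime w) :
    PolyTime fun c => mateb (w c) := by
  unfold mateb
  fun_prop

end PushFight

/-- A language with a decision procedure that takes polynomial time is in P. -/
theorem PushFight.inP_of_polyTime {Γ : Type} [Fintype Γ] [BitEnc Γ] {L : Language Γ}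
    {g : List Γ → Bool} (hg : PolyTime g) (h : ∀ w, g w = true ↔ w ∈ L) : InP L := by
  classical
  -- Reading the input reverses it, so the program has to compute `g` after a further reversal.
  obtain ⟨p, n, T, hp⟩ : PolyTime fun w : List Γ => g w.reverse := hg.comp (by fun_prop)
  obtain ⟨B, hB⟩ := BitEnc.exists_size_le Γ
  have henc : ∀ w : List Γ, w.flatMap (fun a => StackProg.dbl (enc a) ++ [false]) = enc w := by
    intro w
    induction w with
    | nil => rfl
    | cons a w ih => rw [List.flatMap_cons, ih, enc_cons, List.append_assoc]; rfl
  have hgL : g = fun w => decide (w ∈ L) := by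
    funext w
    rw [Bool.eq_iff_iff, h, decide_eq_true_iff]
  obtain ⟨c⟩ := StackProg.tm2ComputableInPolyTime p
    (fun a => StackProg.dbl (enc a) ++ [false]) g
    (T.comp (Polynomial.X * (2 * Polynomial.C B + 1))) fun w => by
      rw [henc]
      obtain ⟨t, ht, hr⟩ := hp w.reverse (update (fun _ => []) 0 (enc w.reverse)) (by simp)
        fun i hi _ => by rw [update_of_ne hi.ne']
      refine ⟨t, ht.trans ?_, ?_⟩
      · rw [Polynomial.eval_comp]
        refine T.eval_nat_mono ?_
        have := size_list_le (l := w.reverse) (B := B) fun a _ => hB a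
        simpa using this
      · simpa [enc] using hr
  rw [hgL] at c
  unfold InP
  convert Nonempty.intro c

theorem mainTheorem4 : PushFight.InP PushFight.unboundedMoveMateInOne :=
  PushFight.inP_of_polyTime (PushFight.polyTime_mateb PolyTime.id) PushFight.mateb_iff
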